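/- Let $d\ge 1$, $1<p<\infty$, $0<s<1$ and $m>0$. For $q>0$ and $r\in\mathbb R$ write $r^q:=|r|^{q-1}r$ (signed power; $0^q=0$), and let $$\langle(-\Delta_p)^s v,\xi\rangle:=\frac12\int_{\mathbb R^{2d}}\frac{(v(x)-v(y))^{p-1}(\xi(x)-\xi(y))}{|x-y|^{d+sp}}\,d(x,y).$$ A function $u\in C([0,\infty);L^1(\mathbb R^d))$ is called a strong distributional solution in $L^1$ of $$\partial_t u+(-\Delta_p)^s u^m=0\ \text{ in }\mathbb R^d\times(0,\infty),\qquad u(0)=u_0\in L^1(\mathbb R^d),$$ if $u(0)=u_0$, $u^m\in L^p_{loc}((0,\infty);W^{s,p}(\mathbb R^d))$, for all $0<t_1<t_2<\infty$ and all $\xi\in C_c^\infty([0,\infty)\times\mathbb R^d)$ $$\int_{\mathbb R^d}u\,\xi\,dx\,\Big|_{t_1}^{t_2}-\int_{t_1}^{t_2}\int_{\mathbb R^d}u\,\xi_t\,dx\,dt+\int_{t_1}^{t_2}\langle(-\Delta_p)^s u^m(t),\xi(t)\rangle\,dt=0,$$ and $u$ is differentiable with values in $L^1(\mathbb R^d)$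 at a.e. $t>0$. Theorem (Refined dissipation in $L^1$). Let $u_1,u_2$ be strong distributional solutions in $L^1$ (with possibly different initial data). For $\tau>0$ put $$D(\tau)=\{(x,y):u_1(x,\tau)>u_2(x,\tau),\ u_1(y,\tau)\le u_2(y,\tau)\}\cup\{(x,y):u_1(x,\tau)\le u_2(x,\tau),\ u_1(y,\tau)>u_2(y,\tau)\}$$ and $$I(\tau)=\int_{D(\tau)}\frac{\bigl|(u_1^m(x,\tau)-u_1^m(y,\tau))^{p-1}-(u_2^m(x,\tau)-u_2^m(y,\tau))^{p-1}\bigr|}{|x-y|^{d+sp}}\,d(x,y)\in[0,\infty].$$ Then for all $0<t_1<t_2<\infty$ one has $\int_{t_1}^{t_2}I(\tau)\,d\tau<\infty$ and $$\|[u_1-u_2]^+(t_2)\|_1\le\|[u_1-u_2]^+(t_1)\|_1-\frac12\int_{t_1}^{t_2}I(\tau)\,d\tau .$$ Consequently, if the set of times $\tau\in(t_1,t_2)$ at which both $\{u_1(\tau)>u_2(\tau)\}$ and $\{u_1(\tau)\le u_2(\tau)\}$ have positive Lebesgue measure has positive measure, then $\|[u_1-u_2]^+(t_2)\|_1<\|[u_1-u_2]^+(t_1)\|_1$.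 -/

import Mathlib

open MeasureTheory Set
open scoped ENNReal ContDiff

noncomputable section

namespace DoublyNonlinear

/-- The Euclidean space `ℝ^d`. -/
abbrev Space (d : ℕ) : Type := EuclideanSpace ℝ (Fin d)

/-- The Lebesgue space `L¹(ℝ^d)`, with its norm `‖·‖₁`. -/
abbrev L1 (d : ℕ) : Type := Lp ℝ 1 (volume : Measure (Space d))

/-- The signed power `r^q = |r|^(q-1) r`, used for `q > 0` (it vanishes at `r = 0`). -/
def spow (r q : ℝ) : ℝ := |r| ^ (q - 1) * r

/-- The `p`-th power `[v]_{s,p}^p` of the Gagliardo seminorm,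
`∫∫ |v(x) - v(y)|^p / |x - y|^(d + s p) dy dx`. -/
def gagliardo {d : ℕ} (s p : ℝ) (v : Space d → ℝ) : ℝ≥0∞ :=
  ∫⁻ x, ∫⁻ y, ENNReal.ofReal (|v x - v y| ^ p / ‖x - y‖ ^ ((d : ℝ) + s * p))

/-- The `p`-th power `‖v‖_p^p + [v]_{s,p}^p` of the norm of `W^{s,p}(ℝ^d)`. -/
def sobolevPow {d : ℕ} (s p : ℝ) (v : Space d → ℝ) : ℝ≥0∞ :=
  (∫⁻ x, ENNReal.ofReal (|v x| ^ p)) + gagliardo s p v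

/-- `v` belongs to the fractional Sobolev space `W^{s,p}(ℝ^d)`. -/
def MemWsp {d : ℕ} (s p : ℝ) (v : Space d → ℝ) : Prop :=
  AEStronglyMeasurable v volume ∧ sobolevPow s p v < ⊤

/-- The variational fractional `p`-Laplacian paired with `ξ`:
`⟨(-Δ_p)^s v, ξ⟩ = ½ ∫ (v(x) - v(y))^(p-1) (ξ(x) - ξ(y)) / |x - y|^(d + s p) d(x,y)`. -/
def fracPLaplacian {d : ℕ} (s p : ℝ) (v ξ : Space d → ℝ) : ℝ :=
  (1 / 2) * ∫ z : Space d × Space d,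
    spow (v z.1 - v z.2) (p - 1) * (ξ z.1 - ξ z.2) / ‖z.1 - z.2‖ ^ ((d : ℝ) + s * p)

/-- The function `u(t)^m = |u(t)|^(m-1) u(t)` on `ℝ^d`. -/
def powAt {d : ℕ} (m : ℝ) (u : ℝ → L1 d) (t : ℝ) : Space d → ℝ :=
  fun x => spow (u t x) m

/-- Distributional solutions of
`∂_t u + (-Δ_p)^s u^m = 0` in `ℝ^d × (0,∞)`, `u(0) = u₀`.
Only the values `u t` with `0 ≤ t` matter. -/
structure IsDistributionalSolution {d : ℕ} (s p m : ℝ) (u₀ : L1 d) (u : ℝ → L1 d) : Prop where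
  /-- `u ∈ C([0,∞); L¹)`. -/
  continuousOn : ContinuousOn u (Ici 0)
  initial : u 0 = u₀
  /-- `u^m ∈ L^p_loc((0,∞); W^{s,p})`. -/
  memWsp : ∀ᵐ t : ℝ, 0 < t → MemWsp s p (powAt m u t)
  locallyIntegrable : ∀ a b : ℝ, 0 < a → a < b →
    (∫⁻ t in Icc a b, sobolevPow s p (powAt m u t)) < ⊤
  /-- The weak formulation; the elements of `C_c^∞([0,∞) × ℝ^d)` are the restrictions of those
  of `C_c^∞(ℝ × ℝ^d)`. -/
  weak : ∀ ξ : ℝ × Space d → ℝ, ContDiff ℝ ∞ ξ → HasCompactSupport ξ →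
    ∀ t₁ t₂ : ℝ, 0 < t₁ → t₁ < t₂ →
      ((∫ x, u t₂ x * ξ (t₂, x)) - ∫ x, u t₁ x * ξ (t₁, x))
        - (∫ t in t₁..t₂, ∫ x, u t x * deriv (fun r => ξ (r, x)) t)
        + (∫ t in t₁..t₂, fracPLaplacian s p (powAt m u t) (fun x => ξ (t, x))) = 0

/-- Strong distributional solutions in `L¹`: in addition `u` is differentiable, as a function with
values in `L¹`, at almost every `t > 0`. -/
structure IsStrongDistributionalSolution {d : ℕ} (s p m : ℝ) (u₀ : L1 d) (u : ℝ → L1 d) : Prop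
    extends IsDistributionalSolution s p m u₀ u where
  differentiable : ∀ᵐ t : ℝ, 0 < t → DifferentiableAt ℝ u t

/-- The set `D(τ)` of pairs `(x, y)` for which exactly one of `u₁ > u₂` at `x` and
`u₁ > u₂` at `y` holds. -/
def dissipationDomain {d : ℕ} (u₁ u₂ : ℝ → L1 d) (τ : ℝ) : Set (Space d × Space d) :=
  {z | u₂ τ z.1 < u₁ τ z.1 ∧ u₁ τ z.2 ≤ u₂ τ z.2} ∪
    {z | u₁ τ z.1 ≤ u₂ τ z.1 ∧ u₂ τ z.2 < u₁ τ z.2}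

/-- The dissipation `I(τ) ∈ [0,∞]`. -/
def dissipation {d : ℕ} (s p m : ℝ) (u₁ u₂ : ℝ → L1 d) (τ : ℝ) : ℝ≥0∞ :=
  ∫⁻ z in dissipationDomain u₁ u₂ τ, ENNReal.ofReal
    (|spow (powAt m u₁ τ z.1 - powAt m u₁ τ z.2) (p - 1)
        - spow (powAt m u₂ τ z.1 - powAt m u₂ τ z.2) (p - 1)|
      / ‖z.1 - z.2‖ ^ ((d : ℝ) + s * p))

end DoublyNonlinear

end

open MeasureTheory Set
open scoped ENNReal ContDiff
open Filter Topology

noncomputable section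

namespace DoublyNonlinear

/-! ### Signed powers, Hölder exponents and the weighted difference quotient -/

section

/-! Put φ(t) = ‖[u₁ - u₂]⁺(t)‖₁. Formally, testing the difference of the two equations with the
indicator of {u₁ > u₂} gives φ' = -I/2: on D(τ) the flux difference has the sign of the jump of the
indicator, and off D(τ) the indicator does not jump. Two points need proof: the relation at a fixed
time, and its integration in time, since a.e. differentiability in L¹ does not make φ absolutely
continuous.

Fixed time. The weak formulation between two times extends from smooth test functions to bounded
functions of W^{s,p} (`integral_eq_of_forall_smooth`, `weak_increment`). At almost every t both
solutions are differentiable in L¹ and the primitive of the L^{p'}-valued flux has the flux as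
derivative, so the formulation can be differentiated and tested with H_ε(u₁^m - u₂^m), where H_ε is
a Lipschitz Heaviside function. As ε → 0, Fatou and the monotonicity of signed powers give I(t) ≤
-2φ'(t) (`dissipation_le_neg_deriv`); φ'(t) is identified by `hasDerivAt_norm_posPart_eq`.

Integration. It suffices that φ is nonincreasing (`antitoneOn_norm_posPart`): a monotone function
satisfies ∫(-φ') ≤ φ(t₁) - φ(t₂), which is the inequality required. Monotonicity comes from doubling
the time variable. For u₁ at time t and u₂ at time r, two convex entropies, one in u₁ and one in u₂,
have the same gradient H_ε(u₁^m(t) - u₂^m(r)) up to sign. Their backward increments are therefore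
tested with one function; the flux terms have a sign by monotonicity, up to the error of replacing
backward flux averages by the flux (`doubling_increment`). This error vanishes after integration
over a rectangle of times (`rectangle_of_increment`). Letting ε → 0 gives (∂_t + ∂_r)‖(u₁(t) -
u₂(r))⁺‖ ≤ 0 in integrated form (`posPart_rectangle`), and averaging over small squares along the
diagonal returns to t = r (`diagonal_le_of_square`).

Strictness holds because I(τ) > 0 whenever both sets have positive measure (`dissipation_pos`). -/

lemma spow_of_nonneg {r q : ℝ} (hq : 0 < q) (hr : 0 ≤ r) : spow r q = r ^ q := by
  rcases hr.eq_or_lt with rfl | h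
  · simp [spow, Real.zero_rpow hq.ne']
  · rw [spow, abs_of_pos h, ← Real.rpow_add_one h.ne', sub_add_cancel]

lemma spow_neg (r q : ℝ) : spow (-r) q = -spow r q := by
  simp [spow]

/-- This form shows continuity at 0 even for q < 1, where the factor |r|^(q-1) is singular. -/
lemma spow_eq_max {q : ℝ} (hq : 0 < q) (r : ℝ) : spow r q = max r 0 ^ q - max (-r) 0 ^ q := by
  rcases le_total 0 r with h | h
  · rw [max_eq_left h, max_eq_right (by linarith), Real.zero_rpow hq.ne', sub_zero,
      spow_of_nonneg hq h]
  · rw [max_eq_right h, max_eq_left (by linarith), Real.zero_rpow hq.ne', zero_sub,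
      ← spow_of_nonneg hq (by linarith : 0 ≤ -r), spow_neg, neg_neg]

lemma continuous_spow {q : ℝ} (hq : 0 < q) : Continuous fun r => spow r q := by
  simp only [spow_eq_max hq]
  have h : Continuous fun x : ℝ => x ^ q := Real.continuous_rpow_const hq.le
  exact (h.comp (by fun_prop)).sub (h.comp (by fun_prop))

lemma spow_strictMono {q : ℝ} (hq : 0 < q) : StrictMono fun r => spow r q := by
  refine strictMono_of_odd_strictMonoOn_nonneg (fun r => spow_neg r q) fun a ha b hb hab => ?_
  simp only [spow_of_nonneg hq ha, spow_of_nonneg hq hb]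
  exact Real.rpow_lt_rpow ha hab hq

lemma abs_spow {q : ℝ} (hq : 0 < q) (r : ℝ) : |spow r q| = |r| ^ q := by
  rcases le_total 0 r with h | h
  · rw [spow_of_nonneg hq h, abs_of_nonneg h, abs_of_nonneg (by positivity)]
  · rw [← abs_neg, ← spow_neg, spow_of_nonneg hq (by linarith), abs_of_nonpos h,
      abs_of_nonneg (Real.rpow_nonneg (by linarith) _)]

lemma spow_div {q c : ℝ} (hq : 0 < q) (hc : 0 ≤ c) (r : ℝ) :
    spow (r / c) q = spow r q / c ^ q := by
  rcases hc.eq_or_lt with rfl | h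
  · simp [spow, Real.zero_rpow hq.ne']
  · rw [spow, spow, abs_div, abs_of_pos h, Real.div_rpow (abs_nonneg _) hc,
      Real.rpow_sub_one h.ne']
    have : c ^ q ≠ 0 := (Real.rpow_pos_of_pos h q).ne'
    field_simp

instance factOneLeOfReal {p : ℝ} [hp : Fact (1 < p)] : Fact (1 ≤ ENNReal.ofReal p) :=
  ⟨ENNReal.one_le_ofReal.2 hp.out.le⟩

instance factOfRealNeTop {p : ℝ} : Fact (ENNReal.ofReal p ≠ ⊤) := ⟨ENNReal.ofReal_ne_top⟩

instance factOneLtConjExponent {p : ℝ} [hp : Fact (1 < p)] : Fact (1 < p.conjExponent) :=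
  ⟨(Real.HolderConjugate.conjExponent hp.out).symm.lt⟩

instance holderConjugateConjExponent {p : ℝ} [hp : Fact (1 < p)] :
    ENNReal.HolderConjugate (ENNReal.ofReal p.conjExponent) (ENNReal.ofReal p) :=
  (Real.HolderConjugate.conjExponent hp.out).symm.ennrealOfReal

lemma sub_one_mul_conjExponent {p : ℝ} (hp : 1 < p) : (p - 1) * p.conjExponent = p := by
  rw [Real.conjExponent]
  field_simp [(sub_pos.2 hp).ne']

lemma enorm_rpow_ofReal (x : ℝ) {p : ℝ} (hp : 0 ≤ p) : ‖x‖ₑ ^ p = ENNReal.ofReal (|x| ^ p) := by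
  rw [Real.enorm_eq_ofReal_abs, ENNReal.ofReal_rpow_of_nonneg (abs_nonneg _) hp]

/-- Since (p - 1)p' = p, the flux lies in L^{p'} exactly when the difference quotient lies in L^p.
-/
lemma enorm_spow_rpow {p : ℝ} (hp : 1 < p) (x : ℝ) :
    ‖spow x (p - 1)‖ₑ ^ p.conjExponent = ‖x‖ₑ ^ p := by
  have hq : 0 < p.conjExponent := (Real.HolderConjugate.conjExponent hp).symm.pos
  rw [enorm_rpow_ofReal _ hq.le, enorm_rpow_ofReal _ (by linarith), abs_spow (by linarith),
    ← Real.rpow_mul (abs_nonneg _), sub_one_mul_conjExponent hp]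

lemma memLp_ofReal_iff {α E : Type*} [MeasurableSpace α] {μ : Measure α} [NormedAddCommGroup E]
    {f : α → E} {p : ℝ} (hp : 0 < p) :
    MemLp f (ENNReal.ofReal p) μ ↔ AEStronglyMeasurable f μ ∧ ∫⁻ x, ‖f x‖ₑ ^ p ∂μ < ⊤ := by
  rw [MemLp, eLpNorm_lt_top_iff_lintegral_rpow_enorm_lt_top (by simpa using hp)
    ENNReal.ofReal_ne_top, ENNReal.toReal_ofReal hp.le]

lemma eLpNorm_ofReal_rpow {α E : Type*} [MeasurableSpace α] {μ : Measure α}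
    [NormedAddCommGroup E] (f : α → E) {p : ℝ} (hp : 0 < p) :
    eLpNorm f (ENNReal.ofReal p) μ ^ p = ∫⁻ x, ‖f x‖ₑ ^ p ∂μ := by
  rw [eLpNorm_eq_lintegral_rpow_enorm_toReal (by simpa using hp) ENNReal.ofReal_ne_top,
    ENNReal.toReal_ofReal hp.le, ← ENNReal.rpow_mul, one_div_mul_cancel hp.ne', ENNReal.rpow_one]

lemma memLp_spow {α : Type*} [MeasurableSpace α] {μ : Measure α} {f : α → ℝ} {p : ℝ} (hp : 1 < p)
    (hf : MemLp f (ENNReal.ofReal p) μ) :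
    MemLp (fun x => spow (f x) (p - 1)) (ENNReal.ofReal p.conjExponent) μ := by
  have hq : 0 < p.conjExponent := (Real.HolderConjugate.conjExponent hp).symm.pos
  rw [memLp_ofReal_iff (by linarith)] at hf
  rw [memLp_ofReal_iff hq]
  refine ⟨(continuous_spow (by linarith)).comp_aestronglyMeasurable hf.1, ?_⟩
  simpa only [enorm_spow_rpow hp] using hf.2

variable {d : ℕ}

/-- The weighted difference quotient `(v(x) - v(y)) / |x - y|^((d + s p) / p)`. -/
def diffQuot (s p : ℝ) (v : Space d → ℝ) (z : Space d × Space d) : ℝ :=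
  (v z.1 - v z.2) / ‖z.1 - z.2‖ ^ (((d : ℝ) + s * p) / p)

lemma quasiMeasurePreserving_fst' : Measure.QuasiMeasurePreserving
    (Prod.fst : Space d × Space d → Space d) volume volume :=
  Measure.quasiMeasurePreserving_fst

lemma quasiMeasurePreserving_snd' : Measure.QuasiMeasurePreserving
    (Prod.snd : Space d × Space d → Space d) volume volume :=
  Measure.quasiMeasurePreserving_snd

lemma ae_prod_of_ae {P : Space d → Prop} (h : ∀ᵐ x, P x) :
    ∀ᵐ z : Space d × Space d, P z.1 ∧ P z.2 :=
  (quasiMeasurePreserving_fst'.ae h).and (quasiMeasurePreserving_snd'.ae h)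

lemma measurable_weight (k : ℝ) :
    Measurable fun z : Space d × Space d => ‖z.1 - z.2‖ ^ k := by
  fun_prop

lemma aestronglyMeasurable_diffQuot {s p : ℝ} {v : Space d → ℝ}
    (hv : AEStronglyMeasurable v volume) : AEStronglyMeasurable (diffQuot s p v) volume := by
  have h1 := hv.comp_quasiMeasurePreserving quasiMeasurePreserving_fst'
  have h2 := hv.comp_quasiMeasurePreserving quasiMeasurePreserving_snd'
  exact ((h1.sub h2).aemeasurable.div
    (measurable_weight _).aemeasurable).aestronglyMeasurable

lemma abs_diffQuot_rpow {s p : ℝ} (hp : 0 < p) (v : Space d → ℝ) (z : Space d × Space d) :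
    |diffQuot s p v z| ^ p = |v z.1 - v z.2| ^ p / ‖z.1 - z.2‖ ^ ((d : ℝ) + s * p) := by
  rw [diffQuot, abs_div, Real.div_rpow (abs_nonneg _) (abs_nonneg _),
    abs_of_nonneg (by positivity : 0 ≤ ‖z.1 - z.2‖ ^ (((d : ℝ) + s * p) / p)),
    ← Real.rpow_mul (norm_nonneg _), div_mul_cancel₀ _ hp.ne']

lemma gagliardo_eq {s p : ℝ} (hp : 0 < p) {v : Space d → ℝ}
    (hv : AEStronglyMeasurable v volume) :
    gagliardo s p v = ∫⁻ z, ‖diffQuot s p v z‖ₑ ^ p := by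
  have : (volume : Measure (Space d × Space d)) = volume.prod volume := rfl
  rw [this, lintegral_prod _
    ((aestronglyMeasurable_diffQuot hv).enorm.pow_const p), gagliardo]
  simp only [enorm_rpow_ofReal _ hp.le, abs_diffQuot_rpow hp]

/-- Turns fractional regularity into L^p membership on the product space, so that only Hölder
duality is used from here on. -/
lemma memWsp_iff {s p : ℝ} (hp : 0 < p) {v : Space d → ℝ} :
    MemWsp s p v ↔ MemLp v (ENNReal.ofReal p) volume ∧
      MemLp (diffQuot s p v) (ENNReal.ofReal p) volume := by
  rw [MemWsp, memLp_ofReal_iff hp, memLp_ofReal_iff hp, sobolevPow]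
  constructor
  · rintro ⟨h, h'⟩
    rw [ENNReal.add_lt_top] at h'
    rw [gagliardo_eq hp h] at h'
    simp only [enorm_rpow_ofReal _ hp.le] at h' ⊢
    exact ⟨⟨h, h'.1⟩, aestronglyMeasurable_diffQuot h, h'.2⟩
  · rintro ⟨⟨h, h1⟩, _, h2⟩
    refine ⟨h, ?_⟩
    rw [ENNReal.add_lt_top, gagliardo_eq hp h]
    simp only [enorm_rpow_ofReal _ hp.le] at h1 h2 ⊢
    exact ⟨h1, h2⟩

/-- The flux density of the fractional `p`-Laplacian. -/
def flux (s p : ℝ) (v : Space d → ℝ) (z : Space d × Space d) : ℝ :=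
  spow (diffQuot s p v z) (p - 1)

lemma flux_mul_diffQuot {s p : ℝ} (hs : 0 ≤ s) (hp : 1 < p) (v ξ : Space d → ℝ)
    (z : Space d × Space d) : flux s p v z * diffQuot s p ξ z =
      spow (v z.1 - v z.2) (p - 1) * (ξ z.1 - ξ z.2) / ‖z.1 - z.2‖ ^ ((d : ℝ) + s * p) := by
  have h0 : 0 ≤ ((d : ℝ) + s * p) / p := by positivity
  -- The kernel splits as k^(p-1) · k with k = |x - y|^((d+sp)/p). Both exponents are nonnegative,
  -- so the power law also holds on the diagonal, where the base is 0.
  rw [flux, diffQuot, diffQuot, spow_div (by linarith) (by positivity), div_mul_div_comm,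
    ← Real.rpow_mul (norm_nonneg _), ← Real.rpow_add_of_nonneg (norm_nonneg _)
      (mul_nonneg h0 (by linarith)) h0]
  congr 2
  have : p ≠ 0 := by linarith
  field_simp
  ring

lemma fracPLaplacian_eq {s p : ℝ} (hs : 0 ≤ s) (hp : 1 < p) (v ξ : Space d → ℝ) :
    fracPLaplacian s p v ξ = (1 / 2) * ∫ z, flux s p v z * diffQuot s p ξ z := by
  simp only [fracPLaplacian, flux_mul_diffQuot hs hp]

lemma memLp_flux {s p : ℝ} (hp : 1 < p) {v : Space d → ℝ}
    (hv : MemLp (diffQuot s p v) (ENNReal.ofReal p) volume) :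
    MemLp (flux s p v) (ENNReal.ofReal p.conjExponent) volume :=
  memLp_spow hp hv

end

/-! ### Smooth test functions have finite Gagliardo energy -/

section

variable {d : ℕ}

/-- The radial kernel `min(1, |h|) / |h|^((d + s p) / p)`. -/
def lipKernel (s p : ℝ) (h : Space d) : ℝ :=
  min 1 ‖h‖ / ‖h‖ ^ (((d : ℝ) + s * p) / p)

lemma lipKernel_nonneg (s p : ℝ) (h : Space d) : 0 ≤ lipKernel s p h := by
  rw [lipKernel]; positivity

lemma measurable_lipKernel (s p : ℝ) : Measurable (lipKernel (d := d) s p) := by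
  unfold lipKernel; fun_prop

/-- In polar coordinates the integrand is r^(p-1-sp) near 0, integrable because s < 1, and r^(-1-sp)
at infinity, integrable because s > 0. -/
lemma integrableOn_radial {s p : ℝ} (hd : 1 ≤ d) (hs₀ : 0 < s) (hs₁ : s < 1) (hp : 1 < p) :
    IntegrableOn (fun r : ℝ => r ^ (d - 1) • ((min 1 r) ^ p / r ^ ((d : ℝ) + s * p))) (Ioi 0) := by
  have key : ∀ r : ℝ, 0 < r → r ^ (d - 1) • ((min 1 r) ^ p / r ^ ((d : ℝ) + s * p)) =
      (min 1 r) ^ p * r ^ (-1 - s * p) := by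
    intro r hr
    rw [smul_eq_mul, ← Real.rpow_natCast, Nat.cast_sub hd, mul_div_left_comm,
      ← Real.rpow_sub hr]
    congr 2
    push_cast; ring
  rw [← Ioc_union_Ioi_eq_Ioi zero_le_one]
  refine IntegrableOn.union ?_ ?_
  · have h : IntegrableOn (fun r : ℝ => r ^ (p - 1 - s * p)) (Ioc 0 1) := by
      rw [← intervalIntegrable_iff_integrableOn_Ioc_of_le zero_le_one]
      exact intervalIntegral.intervalIntegrable_rpow' (by nlinarith)
    refine h.congr_fun (fun r hr => ?_) measurableSet_Ioc
    simp only
    rw [key r hr.1, min_eq_right hr.2, ← Real.rpow_add hr.1]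
    congr 1; ring
  · have h : IntegrableOn (fun r : ℝ => r ^ (-1 - s * p)) (Ioi 1) :=
      integrableOn_Ioi_rpow_of_lt (by nlinarith) one_pos
    refine h.congr_fun (fun r hr => ?_) measurableSet_Ioi
    simp only
    rw [key r (one_pos.trans hr), min_eq_left (le_of_lt hr), Real.one_rpow, one_mul]

lemma memLp_lipKernel {s p : ℝ} (hd : 1 ≤ d) (hs₀ : 0 < s) (hs₁ : s < 1) (hp : 1 < p) :
    MemLp (lipKernel (d := d) s p) (ENNReal.ofReal p) volume := by
  have : Nonempty (Fin d) := ⟨⟨0, hd⟩⟩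
  have hp0 : 0 < p := by linarith
  have h := (integrable_fun_norm_addHaar (volume : Measure (Space d))
    (f := fun r : ℝ => (min 1 r) ^ p / r ^ ((d : ℝ) + s * p))).2
    (by simpa using integrableOn_radial hd hs₀ hs₁ hp)
  rw [memLp_ofReal_iff hp0]
  refine ⟨(measurable_lipKernel s p).aestronglyMeasurable, ?_⟩
  refine lt_of_eq_of_lt (lintegral_congr fun x => ?_) h.2
  rw [enorm_rpow_ofReal _ hp0.le, abs_of_nonneg (lipKernel_nonneg _ _ _), lipKernel,
    Real.div_rpow (by positivity) (by positivity), ← Real.rpow_mul (norm_nonneg _),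
    div_mul_cancel₀ _ hp0.ne', Real.enorm_eq_ofReal_abs, abs_of_nonneg (by positivity)]

/-- By Tonelli and translation invariance, the p-th power of the norm is the product of those of ζ
and of the kernel. -/
lemma memLp_mul_lipKernel {s p : ℝ} (hd : 1 ≤ d) (hs₀ : 0 < s) (hs₁ : s < 1) (hp : 1 < p)
    {ζ : Space d → ℝ} (hζ : MemLp ζ (ENNReal.ofReal p) volume) :
    MemLp (fun z : Space d × Space d => ζ z.2 * lipKernel s p (z.1 - z.2))
      (ENNReal.ofReal p) volume := by
  have hp0 : 0 < p := by linarith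
  have hk := memLp_lipKernel hd hs₀ hs₁ hp
  have hm : AEStronglyMeasurable
      (fun z : Space d × Space d => ζ z.2 * lipKernel s p (z.1 - z.2)) volume :=
    (hζ.1.comp_quasiMeasurePreserving quasiMeasurePreserving_snd').mul
      ((measurable_lipKernel s p).comp (measurable_fst.sub measurable_snd)).aestronglyMeasurable
  rw [memLp_ofReal_iff hp0] at hk hζ ⊢
  refine ⟨hm, ?_⟩
  have hv : (volume : Measure (Space d × Space d)) = volume.prod volume := rfl
  rw [hv, lintegral_prod_symm _ (hm.enorm.pow_const p)]
  have : ∀ y : Space d, ∫⁻ x, ‖ζ y * lipKernel s p (x - y)‖ₑ ^ p =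
      ‖ζ y‖ₑ ^ p * ∫⁻ x, ‖lipKernel (d := d) s p x‖ₑ ^ p := by
    intro y
    rw [← lintegral_sub_right_eq_self (fun x => ‖lipKernel (d := d) s p x‖ₑ ^ p) y,
      ← lintegral_const_mul]
    · simp only [enorm_mul, ENNReal.mul_rpow_of_nonneg _ _ hp0.le]
    · exact ((measurable_lipKernel s p).comp (measurable_id.sub_const y)).enorm.pow_const p
  simp only [this]
  rw [lintegral_mul_const' _ _ hk.2.ne]
  exact ENNReal.mul_lt_top hζ.2 hk.2

lemma memLp_mul_lipKernel' {s p : ℝ} (hd : 1 ≤ d) (hs₀ : 0 < s) (hs₁ : s < 1) (hp : 1 < p)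
    {ζ : Space d → ℝ} (hζ : MemLp ζ (ENNReal.ofReal p) volume) :
    MemLp (fun z : Space d × Space d => ζ z.1 * lipKernel s p (z.1 - z.2))
      (ENNReal.ofReal p) volume := by
  have h := (memLp_mul_lipKernel hd hs₀ hs₁ hp hζ).comp_measurePreserving
    (Measure.measurePreserving_swap (μ := (volume : Measure (Space d))) (ν := volume))
  refine h.congr_norm ?_ (ae_of_all _ fun z => ?_) 
  · exact (hζ.1.comp_quasiMeasurePreserving quasiMeasurePreserving_fst').mul
      ((measurable_lipKernel s p).comp (measurable_fst.sub measurable_snd)).aestronglyMeasurable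
  · simp [lipKernel, norm_sub_rev]

/-- The increment of ξ is at most a multiple of min(1, |x - y|) and vanishes unless one of the two
points lies in the support; this bounds the quotient by the kernel times the indicators of the
support at x and at y. -/
lemma memLp_diffQuot_smooth {s p : ℝ} (hd : 1 ≤ d) (hs₀ : 0 < s) (hs₁ : s < 1) (hp : 1 < p)
    {ξ : Space d → ℝ} (hξ : ContDiff ℝ ∞ ξ) (hc : HasCompactSupport ξ) :
    MemLp (diffQuot s p ξ) (ENNReal.ofReal p) volume := by
  obtain ⟨L, hL⟩ := hξ.lipschitzWith_of_hasCompactSupport hc (by simp)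
  obtain ⟨M, hM⟩ := hc.exists_bound_of_continuous hξ.continuous
  set K := tsupport ξ
  have hK : MemLp (K.indicator fun _ => (1 : ℝ)) (ENNReal.ofReal p) (volume : Measure (Space d)) :=
    memLp_indicator_const _ (isClosed_tsupport ξ).measurableSet _ (Or.inr hc.measure_lt_top.ne)
  have hM0 : 0 ≤ M := (norm_nonneg _).trans (hM 0)
  have hb := ((memLp_mul_lipKernel hd hs₀ hs₁ hp hK).add
    (memLp_mul_lipKernel' hd hs₀ hs₁ hp hK)).const_mul (2 * M + L)
  refine hb.mono (aestronglyMeasurable_diffQuot hξ.continuous.aestronglyMeasurable)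
    (ae_of_all _ fun z => ?_)
  have hi : ∀ x, 0 ≤ K.indicator (fun _ => (1 : ℝ)) x := fun x =>
    indicator_nonneg (fun _ _ => zero_le_one) x
  have hkn := lipKernel_nonneg s p (z.1 - z.2)
  rw [Real.norm_eq_abs, Real.norm_eq_abs]
  refine le_trans ?_ (le_abs_self _)
  simp only [Pi.add_apply]
  rw [← add_mul, ← mul_assoc]
  by_cases h1 : z.1 ∈ K ∨ z.2 ∈ K
  · have h2 : 1 ≤ K.indicator (fun _ => (1 : ℝ)) z.2 + K.indicator (fun _ => (1 : ℝ)) z.1 := by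
      rcases h1 with h | h
      · rw [indicator_of_mem h]; linarith [hi z.2]
      · rw [indicator_of_mem h]; linarith [hi z.1]
    have h3 : |ξ z.1 - ξ z.2| ≤ (2 * M + L) * min 1 ‖z.1 - z.2‖ := by
      have e1 : |ξ z.1 - ξ z.2| ≤ L * ‖z.1 - z.2‖ := by
        simpa [Real.dist_eq, dist_eq_norm] using hL.dist_le_mul z.1 z.2
      have e2 : |ξ z.1 - ξ z.2| ≤ 2 * M := by
        have := hM z.1
        have := hM z.2
        have := abs_sub (ξ z.1) (ξ z.2)
        simp only [Real.norm_eq_abs] at *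
        linarith
      have hL0 : (0 : ℝ) ≤ L := L.2
      rcases min_cases 1 ‖z.1 - z.2‖ with ⟨h, -⟩ | ⟨h, -⟩ <;> rw [h]
      · linarith
      · nlinarith [norm_nonneg (z.1 - z.2)]
    calc |diffQuot s p ξ z| ≤ (2 * M + L) * 1 * lipKernel s p (z.1 - z.2) := by
          rw [diffQuot, abs_div, lipKernel, mul_one, ← mul_div_assoc,
            abs_of_nonneg (by positivity : 0 ≤ ‖z.1 - z.2‖ ^ (((d : ℝ) + s * p) / p))]
          gcongr
      _ ≤ _ := by gcongr
  · push Not at h1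
    rw [diffQuot, image_eq_zero_of_notMem_tsupport h1.1, image_eq_zero_of_notMem_tsupport h1.2]
    have := hi z.1; have := hi z.2
    simp only [sub_zero, zero_div, abs_zero]
    positivity

end

/-! ### Enlarging the class of test functions -/

section

section Pairing

variable {α : Type*} [MeasurableSpace α] {μ : Measure α} {p : ℝ} [Fact (1 < p)]

/-- The duality pairing between `L^{p'}` and `L^p`. -/
def dualPairing (μ : Measure α) (p : ℝ) [Fact (1 < p)] :
    Lp ℝ (ENNReal.ofReal p.conjExponent) μ →L[ℝ] Lp ℝ (ENNReal.ofReal p) μ →L[ℝ] ℝ :=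
  (ContinuousLinearMap.mul ℝ ℝ).lpPairing μ _ _

lemma dualPairing_toLp {g f : α → ℝ} (hg : MemLp g (ENNReal.ofReal p.conjExponent) μ)
    (hf : MemLp f (ENNReal.ofReal p) μ) :
    dualPairing μ p (hg.toLp g) (hf.toLp f) = ∫ x, g x * f x ∂μ := by
  rw [dualPairing, ContinuousLinearMap.lpPairing_eq_integral]
  refine integral_congr_ae ?_
  filter_upwards [hg.coeFn_toLp, hf.coeFn_toLp] with x h1 h2
  simp [h1, h2]

lemma dualPairing_apply (g : Lp ℝ (ENNReal.ofReal p.conjExponent) μ)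
    (f : Lp ℝ (ENNReal.ofReal p) μ) : dualPairing μ p g f = ∫ x, g x * f x ∂μ := by
  rw [dualPairing, ContinuousLinearMap.lpPairing_eq_integral]
  rfl

lemma abs_integral_mul_le {g f : α → ℝ} (hg : MemLp g (ENNReal.ofReal p.conjExponent) μ)
    (hf : MemLp f (ENNReal.ofReal p) μ) :
    ∫ x, |g x * f x| ∂μ ≤ (eLpNorm g (ENNReal.ofReal p.conjExponent) μ).toReal *
      (eLpNorm f (ENNReal.ofReal p) μ).toReal := by
  have h : eLpNorm (fun x => g x * f x) 1 μ ≤ eLpNorm g (ENNReal.ofReal p.conjExponent) μ *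
      eLpNorm f (ENNReal.ofReal p) μ := by
    have := eLpNorm_smul_le_mul_eLpNorm (p := ENNReal.ofReal p.conjExponent)
      (q := ENNReal.ofReal p) (r := 1) hf.1 hg.1
    simpa [Pi.mul_def] using this
  rw [← ENNReal.toReal_mul]
  have h2 : ∫ x, |g x * f x| ∂μ = (eLpNorm (fun x => g x * f x) 1 μ).toReal := by
    rw [eLpNorm_one_eq_lintegral_enorm]
    exact integral_norm_eq_lintegral_enorm (hg.1.mul hf.1)
  rw [h2]
  exact ENNReal.toReal_mono (ENNReal.mul_ne_top hg.2.ne hf.2.ne) h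

lemma abs_dualPairing_le (g : Lp ℝ (ENNReal.ofReal p.conjExponent) μ)
    (f : Lp ℝ (ENNReal.ofReal p) μ) : |dualPairing μ p g f| ≤ ‖g‖ * ‖f‖ := by
  rw [dualPairing_apply, Lp.norm_def, Lp.norm_def]
  exact (abs_integral_le_integral_abs).trans (abs_integral_mul_le (Lp.memLp g) (Lp.memLp f))

lemma integrable_mul_of_conj {g f : α → ℝ} (hg : MemLp g (ENNReal.ofReal p.conjExponent) μ)
    (hf : MemLp f (ENNReal.ofReal p) μ) : Integrable (fun x => g x * f x) μ :=
  hg.integrable_mul hf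

end Pairing

variable {d : ℕ}

instance isAddHaarMeasure_volume_prod :
    (volume : Measure (Space d × Space d)).IsAddHaarMeasure :=
  inferInstanceAs ((volume.prod volume : Measure (Space d × Space d)).IsAddHaarMeasure)

/-- Translations act continuously on L^p for p < ∞, and pairing with g is a bounded functional. -/
lemma continuous_correlation {p : ℝ} [Fact (1 < p)] {g Z : Space d × Space d → ℝ}
    (hg : MemLp g (ENNReal.ofReal p.conjExponent) volume)
    (hZ : MemLp Z (ENNReal.ofReal p) volume) :
    Continuous fun h : Space d => ∫ z, g z * Z ((h, h) + z) := by
  have hc : ContinuousVAdd (Space d × Space d)ᵈᵃᵃ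
      (Lp ℝ (ENNReal.ofReal p) (volume : Measure (Space d × Space d))) :=
    Lp.instContinuousVAddDomAddAct
  have h1 : Continuous fun h : Space d => DomAddAct.mk (h, h) +ᵥ hZ.toLp Z :=
    (DomAddAct.continuous_mk.comp (continuous_id.prodMk continuous_id)).vadd continuous_const
  have h2 := (dualPairing volume p (hg.toLp g)).continuous.comp h1
  refine h2.congr fun h => ?_
  simp only [Function.comp_apply]
  rw [DomAddAct.mk_vadd_toLp, dualPairing_toLp]
  rfl

/-- The weight depends only on x - y, so the quotient commutes with diagonal translations and hence
with averages of them. -/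
lemma diffQuot_convolution {s p : ℝ} {ρ ζ : Space d → ℝ} (hρ : Continuous ρ)
    (hρc : HasCompactSupport ρ) (hζ : LocallyIntegrable ζ volume) (z : Space d × Space d) :
    diffQuot s p (convolution ρ ζ (ContinuousLinearMap.lsmul ℝ ℝ) volume) z =
      ∫ h, ρ h * diffQuot s p ζ (z - (h, h)) := by
  have hi : ∀ x, Integrable (fun h => ρ h * ζ (x - h)) volume := fun x => by
    have := hρc.convolutionExists_left (ContinuousLinearMap.lsmul ℝ ℝ) hρ hζ x
    simpa [ConvolutionExistsAt] using this
  simp only [diffQuot, convolution, ContinuousLinearMap.lsmul_apply, smul_eq_mul]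
  rw [← integral_sub (hi _) (hi _), ← integral_div]
  refine integral_congr_ae (ae_of_all _ fun h => ?_)
  simp only [Prod.fst_sub, Prod.snd_sub, sub_sub_sub_cancel_right]
  ring

lemma eLpNorm_comp_sub_right {q : ℝ≥0∞} {Z : Space d × Space d → ℝ}
    (hZ : AEStronglyMeasurable Z volume) (c : Space d × Space d) :
    eLpNorm (fun z => Z (z - c)) q volume = eLpNorm Z q volume :=
  eLpNorm_comp_measurePreserving (p := q) hZ (measurePreserving_sub_right volume c)

/-- Fubini moves the mollifier off the test function and onto the correlation h ↦ ∫ g(z) Z(z -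
(h,h)), which is continuous. Absolute integrability is Hölder for each h, with a bound independent
of h. -/
lemma integral_mul_diffQuot_convolution {s p : ℝ} [Fact (1 < p)] {g : Space d × Space d → ℝ}
    {ρ ζ : Space d → ℝ} (hg : MemLp g (ENNReal.ofReal p.conjExponent) volume)
    (hρ : Continuous ρ) (hρc : HasCompactSupport ρ) (hζm : Measurable ζ)
    (hζ : LocallyIntegrable ζ volume) (hZ : MemLp (diffQuot s p ζ) (ENNReal.ofReal p) volume) :
    ∫ z, g z * diffQuot s p (convolution ρ ζ (ContinuousLinearMap.lsmul ℝ ℝ) volume) z =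
      ∫ h, ρ h * ∫ z, g z * diffQuot s p ζ ((-h, -h) + z) := by
  have hdm : Measurable (diffQuot s p ζ) := by
    unfold diffQuot; fun_prop
  have hsub : ∀ (z : Space d × Space d) (h : Space d), (-h, -h) + z = z - (h, h) := by
    intro z h
    rw [sub_eq_neg_add]; rfl
  have htr : ∀ h : Space d, MemLp (fun z => diffQuot s p ζ (z - (h, h)))
      (ENNReal.ofReal p) volume := fun h =>
    hZ.comp_measurePreserving (measurePreserving_sub_right volume (h, h))
  have hint : Integrable (Function.uncurry fun (z : Space d × Space d) (h : Space d) =>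
      g z * (ρ h * diffQuot s p ζ (z - (h, h)))) (volume.prod volume) := by
    have hm : AEStronglyMeasurable (Function.uncurry fun (z : Space d × Space d) (h : Space d) =>
        g z * (ρ h * diffQuot s p ζ (z - (h, h)))) (volume.prod volume) := by
      refine (hg.1.comp_fst).mul (Measurable.aestronglyMeasurable ?_)
      exact (hρ.measurable.comp measurable_snd).mul (hdm.comp (by fun_prop))
    rw [integrable_prod_iff' hm]
    constructor
    · refine ae_of_all _ fun h => ?_
      have := (integrable_mul_of_conj hg (htr h)).const_mul (ρ h)
      refine this.congr (ae_of_all _ fun z => ?_)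
      simp only [Function.uncurry_apply_pair]; ring
    · refine Integrable.mono' (g := fun h => |ρ h| *
        ((eLpNorm g (ENNReal.ofReal p.conjExponent) volume).toReal *
          (eLpNorm (diffQuot s p ζ) (ENNReal.ofReal p) volume).toReal))
        ((hρ.integrable_of_hasCompactSupport hρc).abs.mul_const _)
        hm.norm.prod_swap.integral_prod_right' (ae_of_all _ fun h => ?_)
      have h1 := abs_integral_mul_le hg (htr h)
      rw [eLpNorm_comp_sub_right hZ.1] at h1
      rw [Real.norm_eq_abs, abs_of_nonneg (integral_nonneg fun _ => norm_nonneg _)]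
      simp only [Function.uncurry_apply_pair, mul_left_comm _ (ρ h), norm_mul (ρ h)]
      rw [integral_const_mul]
      exact mul_le_mul_of_nonneg_left h1 (norm_nonneg _)
  simp only [diffQuot_convolution hρ hρc hζ, ← integral_const_mul]
  rw [integral_integral_swap hint]
  simp only [hsub]
  refine integral_congr_ae (ae_of_all _ fun h => ?_)
  simp only [mul_left_comm]

lemma abs_convolution_le {ρ ζ : Space d → ℝ} {C : ℝ} (hρ0 : ∀ x, 0 ≤ ρ x)
    (hρi : Integrable ρ volume) (hρ1 : ∫ x, ρ x = 1) (hb : ∀ x, |ζ x| ≤ C) (x : Space d) :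
    |convolution ρ ζ (ContinuousLinearMap.lsmul ℝ ℝ) volume x| ≤ C := by
  simp only [convolution, ContinuousLinearMap.lsmul_apply, smul_eq_mul]
  rw [← Real.norm_eq_abs]
  refine (norm_integral_le_of_norm_le (hρi.mul_const C) (ae_of_all _ fun h => ?_)).trans ?_
  · rw [norm_mul, Real.norm_of_nonneg (hρ0 h)]
    exact mul_le_mul_of_nonneg_left (hb _) (hρ0 h)
  · rw [integral_mul_const, hρ1, one_mul]

/-- An identity tested with smooth compactly supported functions holds for bounded compactly
supported functions of finite Gagliardo seminorm. -/
lemma integral_eq_of_forall_smooth_of_compact {s p : ℝ} [Fact (1 < p)] {f : Space d → ℝ}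
    {g : Space d × Space d → ℝ} (hf : Integrable f volume)
    (hg : MemLp g (ENNReal.ofReal p.conjExponent) volume)
    (H : ∀ ξ : Space d → ℝ, ContDiff ℝ ∞ ξ → HasCompactSupport ξ →
      ∫ x, f x * ξ x = ∫ z, g z * diffQuot s p ξ z)
    {ζ : Space d → ℝ} (hζm : Measurable ζ) {C : ℝ} (hb : ∀ x, |ζ x| ≤ C)
    (hc : HasCompactSupport ζ) (hZ : MemLp (diffQuot s p ζ) (ENNReal.ofReal p) volume) :
    ∫ x, f x * ζ x = ∫ z, g z * diffQuot s p ζ z := by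
  -- The ratio 2 of outer to inner radius stays bounded, as a.e. convergence at Lebesgue points of ζ
  -- requires.
  let φ : ℕ → ContDiffBump (0 : Space d) := fun n =>
    { rIn := 1 / (n + 1), rOut := 2 / (n + 1), rIn_pos := by positivity,
      rIn_lt_rOut := by gcongr; norm_num }
  have hφ : Tendsto (fun n => (φ n).rOut) atTop (𝓝 0) := by
    have := (tendsto_one_div_add_atTop_nhds_zero_nat (𝕜 := ℝ)).const_mul 2
    simpa [φ, div_eq_mul_inv] using this
  have hζ : LocallyIntegrable ζ volume := by
    refine (memLp_top_of_bound hζm.aestronglyMeasurable C (ae_of_all _ hb)).locallyIntegrable ?_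
    exact le_top
  let ρ : ℕ → Space d → ℝ := fun n => (φ n).normed volume
  have hρcont : ∀ n, Continuous (ρ n) := fun n => (φ n).continuous_normed
  have hρc : ∀ n, HasCompactSupport (ρ n) := fun n => (φ n).hasCompactSupport_normed
  have h1 : ∀ n, ∫ x, f x * convolution (ρ n) ζ (ContinuousLinearMap.lsmul ℝ ℝ) volume x =
      ∫ h, ρ n h * ∫ z, g z * diffQuot s p ζ ((-h, -h) + z) := by
    intro n
    rw [← integral_mul_diffQuot_convolution hg (hρcont n) (hρc n) hζm hζ hZ]
    refine H _ ((hρc n).contDiff_convolution_left _ (φ n).contDiff_normed hζ) ?_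
    exact (hρc n).convolution _ hc
  -- As f is only integrable, this limit needs the uniform bound on ζ, which mollification
  -- preserves.
  have h2 : Tendsto (fun n => ∫ x, f x *
      convolution (ρ n) ζ (ContinuousLinearMap.lsmul ℝ ℝ) volume x) atTop
      (𝓝 (∫ x, f x * ζ x)) := by
    refine tendsto_integral_of_dominated_convergence (fun x => |f x| * C) (fun n => ?_)
      (hf.abs.mul_const C) (fun n => ae_of_all _ fun x => ?_) ?_
    · exact hf.1.mul ((hρc n).contDiff_convolution_left (n := 0) _
        (φ n).contDiff_normed hζ).continuous.aestronglyMeasurable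
    · rw [norm_mul]
      exact mul_le_mul_of_nonneg_left (abs_convolution_le (fun x => (φ n).nonneg_normed x)
        ((hρcont n).integrable_of_hasCompactSupport (hρc n)) (φ n).integral_normed hb x)
        (abs_nonneg _)
    · filter_upwards [ContDiffBump.ae_convolution_tendsto_right_of_locallyIntegrable (K := 2) hφ
        (Eventually.of_forall fun n => (by simp [φ, div_eq_mul_inv])) hζ] with x hx
      exact hx.const_mul _
  have h3 : Tendsto (fun n => ∫ h, ρ n h * ∫ z, g z * diffQuot s p ζ ((-h, -h) + z)) atTop
      (𝓝 (∫ z, g z * diffQuot s p ζ z)) := by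
    have := ContDiffBump.convolution_tendsto_right_of_continuous (μ := volume) hφ
      (continuous_correlation hg hZ) 0
    simpa [convolution, Prod.mk_zero_zero] using this
  exact tendsto_nhds_unique h2 (by simpa only [h1] using h3)

/-- The piecewise linear cutoff equal to `1` on the ball of radius `n - 1`. -/
def cutoff (n : ℕ) (x : Space d) : ℝ := max 0 (min 1 (n - ‖x‖))

lemma cutoff_nonneg (n : ℕ) (x : Space d) : 0 ≤ cutoff n x := le_max_left _ _

lemma cutoff_le_one (n : ℕ) (x : Space d) : cutoff n x ≤ 1 :=
  max_le zero_le_one (min_le_left _ _)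

lemma continuous_cutoff (n : ℕ) : Continuous (cutoff (d := d) n) := by
  unfold cutoff; fun_prop

lemma hasCompactSupport_cutoff (n : ℕ) : HasCompactSupport (cutoff (d := d) n) := by
  refine HasCompactSupport.of_support_subset_isCompact (isCompact_closedBall 0 (n : ℝ))
    fun x hx => ?_
  rw [mem_closedBall_zero_iff]
  by_contra! h
  exact hx (max_eq_left ((min_le_right _ _).trans (by linarith)))

lemma tendsto_cutoff (x : Space d) : Tendsto (fun n => cutoff n x) atTop (𝓝 1) := by
  refine tendsto_const_nhds.congr' ?_
  filter_upwards [eventually_ge_atTop ⌈1 + ‖x‖⌉₊] with n hn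
  have : 1 + ‖x‖ ≤ n := Nat.ceil_le.1 hn
  rw [cutoff, min_eq_left (by linarith), max_eq_right zero_le_one]

lemma abs_cutoff_sub_le (n : ℕ) (x y : Space d) :
    |cutoff n x - cutoff n y| ≤ min 1 ‖x - y‖ := by
  refine le_min ?_ ?_
  · have := cutoff_nonneg n x; have := cutoff_nonneg n y
    have := cutoff_le_one n x; have := cutoff_le_one n y
    rw [abs_le]; constructor <;> linarith
  · refine (abs_max_sub_max_le_max _ _ _ _).trans (max_le (by simp) ?_)
    refine (abs_min_sub_min_le_max _ _ _ _).trans (max_le (by simp) ?_)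
    rw [sub_sub_sub_cancel_left, abs_sub_comm]
    exact abs_norm_sub_norm_le x y

/-- A discrete product rule. All cutoffs are 1-Lipschitz with values in [0,1], so the majorant does
not depend on n and serves for dominated convergence. -/
lemma abs_diffQuot_cutoff_mul_le {s p : ℝ} (n : ℕ) (ζ : Space d → ℝ) (z : Space d × Space d) :
    |diffQuot s p (fun x => cutoff n x * ζ x) z| ≤
      |diffQuot s p ζ z| + |ζ z.2| * lipKernel s p (z.1 - z.2) := by
  have h : diffQuot s p (fun x => cutoff n x * ζ x) z = cutoff n z.1 * diffQuot s p ζ z +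
      ζ z.2 * ((cutoff n z.1 - cutoff n z.2) / ‖z.1 - z.2‖ ^ (((d : ℝ) + s * p) / p)) := by
    simp only [diffQuot]; ring
  rw [h]
  refine (abs_add_le _ _).trans (add_le_add ?_ ?_)
  · rw [abs_mul, abs_of_nonneg (cutoff_nonneg _ _)]
    exact mul_le_of_le_one_left (abs_nonneg _) (cutoff_le_one _ _)
  · rw [abs_mul, abs_div, lipKernel,
      abs_of_nonneg (by positivity : 0 ≤ ‖z.1 - z.2‖ ^ (((d : ℝ) + s * p) / p))]
    gcongr
    exact abs_cutoff_sub_le _ _ _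

/-- An identity tested with smooth compactly supported functions holds for bounded functions
in `W^{s,p}`. -/
theorem integral_eq_of_forall_smooth {s p : ℝ} [hp : Fact (1 < p)] (hd : 1 ≤ d) (hs₀ : 0 < s)
    (hs₁ : s < 1) {f : Space d → ℝ} {g : Space d × Space d → ℝ} (hf : Integrable f volume)
    (hg : MemLp g (ENNReal.ofReal p.conjExponent) volume)
    (H : ∀ ξ : Space d → ℝ, ContDiff ℝ ∞ ξ → HasCompactSupport ξ →
      ∫ x, f x * ξ x = ∫ z, g z * diffQuot s p ξ z)
    {ζ : Space d → ℝ} (hζm : Measurable ζ) {C : ℝ} (hb : ∀ x, |ζ x| ≤ C)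
    (hζ : MemLp ζ (ENNReal.ofReal p) volume)
    (hZ : MemLp (diffQuot s p ζ) (ENNReal.ofReal p) volume) :
    ∫ x, f x * ζ x = ∫ z, g z * diffQuot s p ζ z := by
  have hC : 0 ≤ C := (abs_nonneg _).trans (hb 0)
  have hdom : MemLp (fun z => |diffQuot s p ζ z| + |ζ z.2| * lipKernel s p (z.1 - z.2))
      (ENNReal.ofReal p) volume :=
    hZ.abs.add (memLp_mul_lipKernel hd hs₀ hs₁ hp.out hζ.abs)
  have hmn : ∀ n, Measurable fun x => cutoff n x * ζ x := fun n =>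
    (continuous_cutoff n).measurable.mul hζm
  have hZn : ∀ n, MemLp (diffQuot s p fun x => cutoff n x * ζ x) (ENNReal.ofReal p) volume := by
    intro n
    refine hdom.mono (aestronglyMeasurable_diffQuot (hmn n).aestronglyMeasurable)
      (ae_of_all _ fun z => ?_)
    exact (abs_diffQuot_cutoff_mul_le n ζ z).trans (le_abs_self _)
  have h1 : ∀ n, ∫ x, f x * (cutoff n x * ζ x) =
      ∫ z, g z * diffQuot s p (fun x => cutoff n x * ζ x) z := by
    intro n
    refine integral_eq_of_forall_smooth_of_compact hf hg H (hmn n) (C := C) (fun x => ?_)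
      (hasCompactSupport_cutoff n).mul_right (hZn n)
    rw [abs_mul, abs_of_nonneg (cutoff_nonneg _ _)]
    exact (mul_le_of_le_one_left (abs_nonneg _) (cutoff_le_one _ _)).trans (hb x)
  have h2 : Tendsto (fun n => ∫ x, f x * (cutoff n x * ζ x)) atTop (𝓝 (∫ x, f x * ζ x)) := by
    refine tendsto_integral_of_dominated_convergence (fun x => |f x| * C)
      (fun n => hf.1.mul (hmn n).aestronglyMeasurable) (hf.abs.mul_const C)
      (fun n => ae_of_all _ fun x => ?_) (ae_of_all _ fun x => ?_)
    · rw [norm_mul, norm_mul, Real.norm_of_nonneg (cutoff_nonneg _ _)]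
      exact mul_le_mul_of_nonneg_left ((mul_le_of_le_one_left (abs_nonneg _)
        (cutoff_le_one _ _)).trans (hb x)) (abs_nonneg _)
    · simpa using ((tendsto_cutoff x).mul_const (ζ x)).const_mul (f x)
  have h3 : Tendsto (fun n => ∫ z, g z * diffQuot s p (fun x => cutoff n x * ζ x) z) atTop
      (𝓝 (∫ z, g z * diffQuot s p ζ z)) := by
    refine tendsto_integral_of_dominated_convergence _ (fun n => hg.1.mul (hZn n).1)
      (integrable_mul_of_conj hg.abs hdom)
      (fun n => ae_of_all _ fun z => ?_) (ae_of_all _ fun z => ?_)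
    · rw [norm_mul]
      exact mul_le_mul_of_nonneg_left (abs_diffQuot_cutoff_mul_le n ζ z) (abs_nonneg _)
    · refine Tendsto.const_mul _ ?_
      simp only [diffQuot]
      refine Tendsto.div_const (Tendsto.sub ?_ ?_) _
      · simpa using (tendsto_cutoff z.1).mul_const (ζ z.1)
      · simpa using (tendsto_cutoff z.2).mul_const (ζ z.2)
  exact tendsto_nhds_unique h2 (by simpa only [h1] using h3)

end

/-! ### Measurability in time and the weak formulation between two times -/

section

section Measurability

variable {α X : Type*} [MeasurableSpace α] {μ : Measure α}

/-- By Fatou along subsequences the sublevel sets are sequentially closed. Convergence in L¹ yields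
only a.e. convergent subsequences, and lower semicontinuity is enough for Borel measurability. -/
lemma lowerSemicontinuous_lintegral_of_subseq [TopologicalSpace X] [SequentialSpace X]
    (f : X → α → ℝ≥0∞) (hm : ∀ x, AEMeasurable (f x) μ)
    (hs : ∀ (u : ℕ → X) (x : X), Tendsto u atTop (𝓝 x) → ∃ φ : ℕ → ℕ, StrictMono φ ∧
      ∀ᵐ a ∂μ, Tendsto (fun n => f (u (φ n)) a) atTop (𝓝 (f x a))) :
    LowerSemicontinuous fun x => ∫⁻ a, f x a ∂μ := by
  rw [lowerSemicontinuous_iff_isClosed_preimage]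
  intro c
  refine IsSeqClosed.isClosed fun u x hu hx => ?_
  obtain ⟨φ, -, h⟩ := hs u x hx
  calc ∫⁻ a, f x a ∂μ = ∫⁻ a, liminf (fun n => f (u (φ n)) a) atTop ∂μ :=
        lintegral_congr_ae (h.mono fun a ha => ha.liminf_eq.symm)
    _ ≤ liminf (fun n => ∫⁻ a, f (u (φ n)) a ∂μ) atTop := lintegral_liminf_le' fun n => hm _
    _ ≤ liminf (fun _ : ℕ => c) atTop :=
        liminf_le_liminf (Eventually.of_forall fun n => hu (φ n))
    _ = c := liminf_const c

lemma exists_subseq_ae_tendsto {E : Type*} [NormedAddCommGroup E] {u : ℕ → Lp E 1 μ}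
    {v : Lp E 1 μ} (h : Tendsto u atTop (𝓝 v)) : ∃ φ : ℕ → ℕ, StrictMono φ ∧
      ∀ᵐ x ∂μ, Tendsto (fun n => u (φ n) x) atTop (𝓝 (v x)) :=
  (tendstoInMeasure_of_tendsto_Lp h).exists_seq_tendsto_ae

/-- In a second countable space every open set is a countable union of balls, and the hypothesis
makes preimages of balls measurable. -/
lemma stronglyMeasurable_of_measurable_enorm_sub {E : Type*} [NormedAddCommGroup E]
    [SecondCountableTopology E] {F : α → E} (h : ∀ g, Measurable fun t => ‖F t - g‖ₑ) :
    StronglyMeasurable F := by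
  borelize E
  refine Measurable.stronglyMeasurable (measurable_of_isOpen fun O hO => ?_)
  choose! r hr hrO using fun x (hx : x ∈ O) => EMetric.isOpen_iff.1 hO x hx
  obtain ⟨T, hTO, hTc, hT⟩ := TopologicalSpace.isOpen_biUnion_countable O
    (fun x => Metric.eball x (r x)) fun x _ => Metric.isOpen_eball
  have hOT : O = ⋃ x ∈ T, Metric.eball x (r x) := by
    rw [hT]
    refine Subset.antisymm (fun x hx => mem_biUnion hx (Metric.mem_eball_self (hr x hx)))
      (iUnion₂_subset hrO)
  rw [hOT, preimage_iUnion₂]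
  refine MeasurableSet.biUnion hTc fun x _ => ?_
  have : F ⁻¹' Metric.eball x (r x) = {t | ‖F t - x‖ₑ < r x} := by
    ext t; simp [edist_eq_enorm_sub]
  rw [this]
  exact measurableSet_lt (h x) measurable_const

end Measurability

variable {d : ℕ} {s p m : ℝ}

lemma measurable_powAt (u : ℝ → L1 d) (hm : 0 < m) (t : ℝ) : Measurable (powAt m u t) :=
  (continuous_spow hm).measurable.comp (Lp.stronglyMeasurable (u t)).measurable

lemma measurable_diffQuot {v : Space d → ℝ} (hv : Measurable v) :
    Measurable (diffQuot s p v) := by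
  unfold diffQuot; fun_prop

lemma measurable_flux (hp : 1 < p) {v : Space d → ℝ} (hv : Measurable v) :
    Measurable (flux s p v) :=
  (continuous_spow (by linarith)).measurable.comp (measurable_diffQuot hv)

lemma exists_subseq_diffQuot (hm : 0 < m) {v : ℝ → L1 d} (hv : Continuous v) (τ : ℕ → ℝ) (t : ℝ)
    (hτ : Tendsto τ atTop (𝓝 t)) : ∃ φ : ℕ → ℕ, StrictMono φ ∧
      ∀ᵐ z, Tendsto (fun n => diffQuot s p (powAt m v (τ (φ n))) z) atTop
        (𝓝 (diffQuot s p (powAt m v t) z)) := by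
  obtain ⟨φ, hφ, h⟩ := exists_subseq_ae_tendsto ((hv.tendsto t).comp hτ)
  refine ⟨φ, hφ, ?_⟩
  filter_upwards [ae_prod_of_ae h] with z hz
  have hc := continuous_spow hm
  exact (((hc.tendsto _).comp hz.1).sub ((hc.tendsto _).comp hz.2)).div_const _

lemma measurable_lintegral_diffQuot (hm : 0 < m) {v : ℝ → L1 d} (hv : Continuous v)
    {Θ : Space d × Space d → ℝ → ℝ≥0∞} (hΘ : ∀ z, Continuous (Θ z))
    (hΘm : ∀ t, AEMeasurable (fun z => Θ z (diffQuot s p (powAt m v t) z)) volume) :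
    Measurable fun t => ∫⁻ z, Θ z (diffQuot s p (powAt m v t) z) := by
  refine (lowerSemicontinuous_lintegral_of_subseq _ hΘm fun τ t hτ => ?_).measurable
  obtain ⟨φ, hφ, h⟩ := exists_subseq_diffQuot (s := s) (p := p) hm hv τ t hτ
  exact ⟨φ, hφ, h.mono fun z hz => ((hΘ z).tendsto _).comp hz⟩

open Classical in
/-- The flux as an element of `L^{p'}`, with value `0` if it is not in this space. -/
def fluxLp (s p : ℝ) [Fact (1 < p)] (v : Space d → ℝ) :
    Lp ℝ (ENNReal.ofReal p.conjExponent) (volume : Measure (Space d × Space d)) :=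
  if h : MemLp (flux s p v) (ENNReal.ofReal p.conjExponent) volume then h.toLp _ else 0

lemma fluxLp_of_memLp [ Fact (1 < p)] {v : Space d → ℝ}
    (h : MemLp (flux s p v) (ENNReal.ofReal p.conjExponent) volume) :
    fluxLp s p v = h.toLp _ := dif_pos h

lemma fluxLp_of_not_memLp [Fact (1 < p)] {v : Space d → ℝ}
    (h : ¬ MemLp (flux s p v) (ENNReal.ofReal p.conjExponent) volume) :
    fluxLp s p v = 0 := dif_neg h

/-- Gives separability of L^{p'} on the product, which strong measurability of the flux in time
relies on. -/
instance isSeparable_volume_prod :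
    MeasureTheory.IsSeparable (volume : Measure (Space d × Space d)) := by
  have h1 : MeasurableSpace.CountablyGenerated (Space d × Space d) := inferInstance
  have h2 : SFinite (volume : Measure (Space d × Space d)) := inferInstance
  infer_instance

/-- The distance to a fixed g is a power of an integral depending measurably on t where the flux is
in L^{p'}, and the constant ‖g‖ elsewhere; the set separating the two cases is itself measurable. -/
lemma stronglyMeasurable_fluxLp [hp : Fact (1 < p)] (hm : 0 < m) {v : ℝ → L1 d}
    (hv : Continuous v) : StronglyMeasurable fun t => fluxLp s p (powAt m v t) := by
  have hq : 0 < p.conjExponent := (Real.HolderConjugate.conjExponent hp.out).symm.pos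
  have hfm : ∀ t, Measurable (flux s p (powAt m v t)) := fun t =>
    measurable_flux hp.out (measurable_powAt v hm t)
  have hc := continuous_spow (sub_pos.2 hp.out)
  have key : ∀ g : Space d × Space d → ℝ, AEMeasurable g volume →
      Measurable fun t => ∫⁻ z, ‖flux s p (powAt m v t) z - g z‖ₑ ^ p.conjExponent := by
    intro g hg
    refine measurable_lintegral_diffQuot (s := s) (p := p) hm hv
      (Θ := fun z x => ‖spow x (p - 1) - g z‖ₑ ^ p.conjExponent) (fun z => ?_) fun t => ?_
    · exact (ENNReal.continuous_rpow_const.comp (hc.sub continuous_const).enorm)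
    · exact ((hfm t).aemeasurable.sub hg).enorm.pow_const _
  refine stronglyMeasurable_of_measurable_enorm_sub fun g => ?_
  have hS : MeasurableSet {t | MemLp (flux s p (powAt m v t))
      (ENNReal.ofReal p.conjExponent) volume} := by
    have h0 := key (fun _ => 0) aemeasurable_const
    simp only [sub_zero] at h0
    simp only [memLp_ofReal_iff hq, (hfm _).aestronglyMeasurable, true_and]
    exact measurableSet_lt h0 measurable_const
  have hg := key g (Lp.aestronglyMeasurable g).aemeasurable
  classical
  have heq : (fun t => ‖fluxLp s p (powAt m v t) - g‖ₑ) =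
      {t | MemLp (flux s p (powAt m v t)) (ENNReal.ofReal p.conjExponent) volume}.piecewise
        (fun t => (∫⁻ z, ‖flux s p (powAt m v t) z - g z‖ₑ ^ p.conjExponent) ^
          (1 / p.conjExponent)) fun _ => ‖-g‖ₑ := by
    ext t
    by_cases h : t ∈ {t | MemLp (flux s p (powAt m v t))
      (ENNReal.ofReal p.conjExponent) volume}
    · rw [piecewise_eq_of_mem _ _ _ h, fluxLp_of_memLp h, Lp.enorm_def,
        ← eLpNorm_ofReal_rpow _ hq, ← ENNReal.rpow_mul, mul_one_div_cancel hq.ne',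
        ENNReal.rpow_one]
      refine eLpNorm_congr_ae ?_
      filter_upwards [Lp.coeFn_sub (MemLp.toLp _ h) g, MemLp.coeFn_toLp h] with z h1 h2
      rw [h1, Pi.sub_apply, h2]
    · rw [piecewise_eq_of_notMem _ _ _ h, fluxLp_of_not_memLp h, zero_sub]
  rw [heq]
  exact Measurable.piecewise hS (hg.pow_const _) measurable_const

lemma enorm_fluxLp_rpow [hp : Fact (1 < p)] {v : Space d → ℝ}
    (h : MemLp (diffQuot s p v) (ENNReal.ofReal p) volume) :
    ‖fluxLp s p v‖ₑ ^ p.conjExponent = ∫⁻ z, ‖diffQuot s p v z‖ₑ ^ p := by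
  have hq : 0 < p.conjExponent := (Real.HolderConjugate.conjExponent hp.out).symm.pos
  rw [fluxLp_of_memLp (memLp_flux hp.out h), Lp.enorm_def,
    eLpNorm_congr_ae (MemLp.coeFn_toLp _), eLpNorm_ofReal_rpow _ hq]
  simp only [flux, enorm_spow_rpow hp.out]

/-- Continuous extension by the initial value to negative times. -/
def extend (u : ℝ → L1 d) (t : ℝ) : L1 d := u (max t 0)

lemma extend_of_nonneg (u : ℝ → L1 d) {t : ℝ} (ht : 0 ≤ t) : extend u t = u t := by
  rw [extend, max_eq_left ht]

lemma powAt_extend (u : ℝ → L1 d) {t : ℝ} (ht : 0 ≤ t) :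
    powAt m (extend u) t = powAt m u t := by
  funext x
  simp only [powAt, extend_of_nonneg u ht]

namespace IsDistributionalSolution

variable {u₀ : L1 d} {u : ℝ → L1 d}

lemma continuous_extend (h : IsDistributionalSolution s p m u₀ u) : Continuous (extend u) :=
  h.continuousOn.comp_continuous (by fun_prop) fun t => le_max_right t 0

lemma ae_memLp (hp : 1 < p) (h : IsDistributionalSolution s p m u₀ u) : ∀ᵐ t : ℝ, 0 < t →
    MemLp (powAt m (extend u) t) (ENNReal.ofReal p) volume ∧
      MemLp (diffQuot s p (powAt m (extend u) t)) (ENNReal.ofReal p) volume := by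
  filter_upwards [h.memWsp] with t ht ht0
  rw [powAt_extend u ht0.le]
  exact (memWsp_iff (by linarith)).1 (ht ht0)

lemma lintegral_diffQuot_lt_top (hp : 1 < p) (hm : 0 < m)
    (h : IsDistributionalSolution s p m u₀ u) {a b : ℝ} (ha : 0 < a) (hab : a < b) :
    ∫⁻ t in Icc a b, ∫⁻ z, ‖diffQuot s p (powAt m (extend u) t) z‖ₑ ^ p < ⊤ := by
  refine lt_of_le_of_lt (setLIntegral_mono' measurableSet_Icc fun t ht => ?_)
    (h.locallyIntegrable a b ha hab)
  rw [powAt_extend u (ha.le.trans ht.1), ← gagliardo_eq (by linarith)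
    (measurable_powAt u hm t).aestronglyMeasurable]
  exact le_add_self

/-- The p'-th power of the flux norm is the Gagliardo energy, which is locally integrable in time;
the flux therefore has Bochner integrals over compact intervals of positive times. -/
lemma memLp_fluxLp [hp : Fact (1 < p)] (hm : 0 < m)
    (h : IsDistributionalSolution s p m u₀ u) {a b : ℝ} (ha : 0 < a) (hab : a < b) :
    MemLp (fun t => fluxLp s p (powAt m (extend u) t)) (ENNReal.ofReal p.conjExponent)
      (volume.restrict (Icc a b)) := by
  have hq : 0 < p.conjExponent := (Real.HolderConjugate.conjExponent hp.out).symm.pos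
  rw [memLp_ofReal_iff hq]
  refine ⟨(stronglyMeasurable_fluxLp hm h.continuous_extend).aestronglyMeasurable, ?_⟩
  refine lt_of_eq_of_lt (setLIntegral_congr_fun_ae measurableSet_Icc ?_)
    (h.lintegral_diffQuot_lt_top hp.out hm ha hab)
  filter_upwards [h.ae_memLp hp.out] with t ht htab
  exact enorm_fluxLp_rpow (ht (ha.trans_le htab.1)).2

/-- The `L^p` norm of the difference quotient as a function of time. -/
lemma memLp_eLpNorm_diffQuot [hp : Fact (1 < p)] (hm : 0 < m)
    (h : IsDistributionalSolution s p m u₀ u) {a b : ℝ} (ha : 0 < a) (hab : a < b) :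
    MemLp (fun t => (eLpNorm (diffQuot s p (powAt m (extend u) t)) (ENNReal.ofReal p)
      volume).toReal) (ENNReal.ofReal p) (volume.restrict (Icc a b)) := by
  have hp0 : 0 < p := by linarith [hp.out]
  have hmeas : Measurable fun t =>
      ∫⁻ z, ‖diffQuot s p (powAt m (extend u) t) z‖ₑ ^ p :=
    measurable_lintegral_diffQuot hm h.continuous_extend (Θ := fun _ x => ‖x‖ₑ ^ p)
      (fun _ => ENNReal.continuous_rpow_const.comp continuous_enorm)
      fun t => (measurable_diffQuot (measurable_powAt _ hm t)).enorm.pow_const p |>.aemeasurable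
  have heq : ∀ t, eLpNorm (diffQuot s p (powAt m (extend u) t)) (ENNReal.ofReal p) volume =
      (∫⁻ z, ‖diffQuot s p (powAt m (extend u) t) z‖ₑ ^ p) ^ (1 / p) := by
    intro t
    rw [← eLpNorm_ofReal_rpow _ hp0, ← ENNReal.rpow_mul, mul_one_div_cancel hp0.ne',
      ENNReal.rpow_one]
  rw [memLp_ofReal_iff hp0]
  constructor
  · simp only [heq]
    exact ((hmeas.pow_const _).ennreal_toReal).aestronglyMeasurable
  · refine lt_of_le_of_lt (lintegral_mono fun t => ?_)
      (h.lintegral_diffQuot_lt_top hp.out hm ha hab)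
    rw [← eLpNorm_ofReal_rpow _ hp0]
    refine ENNReal.rpow_le_rpow ?_ hp0.le
    rw [Real.enorm_eq_ofReal_abs, abs_of_nonneg ENNReal.toReal_nonneg]
    exact ENNReal.ofReal_toReal_le

lemma intervalIntegrable_fluxLp [hp : Fact (1 < p)] (hm : 0 < m)
    (h : IsDistributionalSolution s p m u₀ u) {a b : ℝ} (ha : 0 < a) (hb : 0 < b) :
    IntervalIntegrable (fun t => fluxLp s p (powAt m (extend u) t)) volume a b := by
  have hab : min a b / 2 < max a b + 1 := by
    have : min a b ≤ max a b := min_le_max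
    have : 0 < min a b := lt_min ha hb
    linarith
  have hmin : 0 < min a b := lt_min ha hb
  have hq : (1 : ℝ≥0∞) ≤ ENNReal.ofReal p.conjExponent := Fact.out
  have := (h.memLp_fluxLp hm (half_pos hmin) hab).integrable hq
  rw [intervalIntegrable_iff]
  refine IntegrableOn.mono_set this fun t ht => ?_
  exact ⟨by linarith [ht.1], by linarith [ht.2]⟩

lemma weak_smooth [hp : Fact (1 < p)] (hd : 1 ≤ d) (hs₀ : 0 < s) (hs₁ : s < 1) (hm : 0 < m)
    (h : IsDistributionalSolution s p m u₀ u) {a b : ℝ} (ha : 0 < a) (hab : a < b)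
    {ξ : Space d → ℝ} (hξ : ContDiff ℝ ∞ ξ) (hc : HasCompactSupport ξ) :
    ∫ x, (u b - u a : L1 d) x * ξ x = ∫ z, (-(1 / 2 : ℝ) •
      ∫ t in a..b, fluxLp s p (powAt m (extend u) t) :
        Lp ℝ (ENNReal.ofReal p.conjExponent) volume) z * diffQuot s p ξ z := by
  have hZ := memLp_diffQuot_smooth hd hs₀ hs₁ hp.out hξ hc
  -- A time cutoff equal to 1 on a neighbourhood of [a, b], hence the extra 1 in the radius; this
  -- removes the term with the time derivative of the test function.
  let χ : ContDiffBump ((a + b) / 2 : ℝ) :=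
    { rIn := (b - a) / 2 + 1, rOut := (b - a) / 2 + 2, rIn_pos := by linarith,
      rIn_lt_rOut := by linarith }
  have hχ : ∀ t ∈ Icc a b, χ t = 1 := fun t ht => by
    refine χ.one_of_mem_closedBall ?_
    rw [Metric.mem_closedBall, Real.dist_eq, abs_le]
    constructor <;> simp only [χ] <;> linarith [ht.1, ht.2]
  have hχ' : ∀ t ∈ Icc a b, (fun r => χ r) =ᶠ[𝓝 t] fun _ => 1 := fun t ht => by
    refine χ.eventuallyEq_one_of_mem_ball ?_
    rw [Metric.mem_ball, Real.dist_eq, abs_lt]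
    constructor <;> simp only [χ] <;> linarith [ht.1, ht.2]
  have hsmooth : ContDiff ℝ ∞ fun z : ℝ × Space d => χ z.1 * ξ z.2 :=
    (χ.contDiff.comp contDiff_fst).mul (hξ.comp contDiff_snd)
  have hsupp : HasCompactSupport fun z : ℝ × Space d => χ z.1 * ξ z.2 := by
    refine HasCompactSupport.of_support_subset_isCompact
      (χ.hasCompactSupport.isCompact.prod hc.isCompact) fun z hz => ?_
    exact ⟨subset_tsupport _ (left_ne_zero_of_mul hz), subset_tsupport _ (right_ne_zero_of_mul hz)⟩
  have hw := h.weak _ hsmooth hsupp a b ha hab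
  have e1 : ∀ t ∈ Icc a b, ∀ x, deriv (fun r => χ r * ξ x) t = 0 := by
    intro t ht x
    have : (fun r => χ r * ξ x) =ᶠ[𝓝 t] fun _ => 1 * ξ x := by
      filter_upwards [hχ' t ht] with r hr
      rw [hr]
    rw [this.deriv_eq]; simp
  have e2 : ∫ t in a..b, ∫ x, u t x * deriv (fun r => χ r * ξ x) t = 0 := by
    refine intervalIntegral.integral_zero_ae (ae_of_all _ fun t ht => ?_)
    rw [uIoc_of_le hab.le] at ht
    simp [e1 t (Ioc_subset_Icc_self ht)]
  have e3 : ∫ t in a..b, fracPLaplacian s p (powAt m u t) (fun x => χ t * ξ x) =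
      (1 / 2) * dualPairing volume p (∫ t in a..b, fluxLp s p (powAt m (extend u) t))
        (hZ.toLp _) := by
    -- Pairing with a fixed element is bounded and linear, so it commutes with the Bochner integral
    -- in time.
    have hL := ((dualPairing volume p).flip (hZ.toLp _)).intervalIntegral_comp_comm
      (h.intervalIntegrable_fluxLp hm ha (ha.trans hab))
    simp only [ContinuousLinearMap.flip_apply] at hL
    rw [← hL, ← intervalIntegral.integral_const_mul]
    refine intervalIntegral.integral_congr_ae ?_
    filter_upwards [h.ae_memLp hp.out] with t ht htab
    rw [uIoc_of_le hab.le] at htab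
    have ht0 : 0 < t := ha.trans htab.1
    rw [fluxLp_of_memLp (memLp_flux hp.out (ht ht0).2), dualPairing_toLp,
      fracPLaplacian_eq hs₀.le hp.out, powAt_extend u ht0.le]
    simp [hχ t (Ioc_subset_Icc_self htab)]
  rw [e2, e3] at hw
  simp only [hχ a (left_mem_Icc.2 hab.le), hχ b (right_mem_Icc.2 hab.le), one_mul, sub_zero] at hw
  obtain ⟨M, hM⟩ := hc.exists_bound_of_continuous hξ.continuous
  have hi : ∀ v : L1 d, Integrable (fun x => v x * ξ x) volume := fun v =>
    (L1.integrable_coeFn v).mul_bdd hξ.continuous.aestronglyMeasurable (ae_of_all _ hM)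
  have e4 : ∫ x, (u b - u a : L1 d) x * ξ x = (∫ x, u b x * ξ x) - ∫ x, u a x * ξ x := by
    rw [← integral_sub (hi _) (hi _)]
    refine integral_congr_ae ?_
    filter_upwards [Lp.coeFn_sub (u b) (u a)] with x hx
    rw [hx, Pi.sub_apply, sub_mul]
  have e5 := dualPairing_apply (-(1 / 2 : ℝ) • ∫ t in a..b, fluxLp s p (powAt m (extend u) t))
    (hZ.toLp _)
  rw [e4, show _ - _ = _ from eq_neg_of_add_eq_zero_left hw]
  refine Eq.trans ?_ (e5.trans (integral_congr_ae ?_))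
  · simp
  · filter_upwards [hZ.coeFn_toLp] with z hz
    rw [hz]

/-- The weak formulation between two times, tested with a bounded function in `W^{s,p}`. -/
lemma weak_increment [hp : Fact (1 < p)] (hd : 1 ≤ d) (hs₀ : 0 < s) (hs₁ : s < 1) (hm : 0 < m)
    (h : IsDistributionalSolution s p m u₀ u) {a b : ℝ} (ha : 0 < a) (hb : 0 < b)
    {ζ : Space d → ℝ} (hζm : Measurable ζ) {C : ℝ} (hbd : ∀ x, |ζ x| ≤ C)
    (hζ : MemLp ζ (ENNReal.ofReal p) volume)
    (hZ : MemLp (diffQuot s p ζ) (ENNReal.ofReal p) volume) :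
    ∫ x, (u b - u a : L1 d) x * ζ x = -(1 / 2) *
      dualPairing volume p (∫ t in a..b, fluxLp s p (powAt m (extend u) t)) (hZ.toLp _) := by
  have key : ∀ a b : ℝ, 0 < a → a < b → ∫ x, (u b - u a : L1 d) x * ζ x = -(1 / 2) *
      dualPairing volume p (∫ t in a..b, fluxLp s p (powAt m (extend u) t)) (hZ.toLp _) := by
    intro a b ha hab
    rw [integral_eq_of_forall_smooth hd hs₀ hs₁ (L1.integrable_coeFn _) (Lp.memLp _)
      (fun ξ hξ hc => h.weak_smooth hd hs₀ hs₁ hm ha hab hξ hc) hζm hbd hζ hZ]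
    have e5 := dualPairing_apply (-(1 / 2 : ℝ) • ∫ t in a..b, fluxLp s p (powAt m (extend u) t))
      (hZ.toLp _)
    rw [map_smul, smul_apply, smul_eq_mul] at e5
    rw [e5]
    refine integral_congr_ae ?_
    filter_upwards [hZ.coeFn_toLp] with z hz
    rw [hz]
  -- Both sides change sign when the endpoints are exchanged, so no order of the times is needed;
  -- two-sided derivatives can then be taken.
  rcases lt_trichotomy a b with hab | rfl | hab
  · exact key a b ha hab
  · simp only [sub_self, intervalIntegral.integral_same, map_zero, zero_apply,
      mul_zero]
    refine integral_eq_zero_of_ae ?_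
    filter_upwards [Lp.coeFn_zero ℝ 1 (volume : Measure (Space d))] with x hx
    rw [hx, Pi.zero_apply, zero_mul]
  · have := key b a hb hab
    rw [intervalIntegral.integral_symm, map_neg, neg_apply, mul_neg, ← this,
      ← integral_neg]
    refine integral_congr_ae ?_
    filter_upwards [Lp.coeFn_neg (u a - u b)] with x hx
    rw [← neg_sub, hx, Pi.neg_apply, neg_mul]

end IsDistributionalSolution

end

/-! ### Backward averages of vector-valued functions -/

section

section Translation

variable {E : Type*} [NormedAddCommGroup E]

lemma tendsto_eLpNorm_translate_sub {q : ℝ≥0∞} [Fact (1 ≤ q)] [Fact (q ≠ ⊤)] {F : ℝ → E}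
    (hF : MemLp F q volume) :
    Tendsto (fun σ : ℝ => eLpNorm (fun t => F (t - σ) - F t) q volume) (𝓝 0) (𝓝 0) := by
  have hc : ContinuousVAdd ℝᵈᵃᵃ (Lp E q (volume : Measure ℝ)) := Lp.instContinuousVAddDomAddAct
  have h1 : Continuous fun σ : ℝ => DomAddAct.mk (-σ) +ᵥ hF.toLp F :=
    (DomAddAct.continuous_mk.comp continuous_neg).vadd continuous_const
  have h2 : Tendsto (fun σ : ℝ => edist (DomAddAct.mk (-σ) +ᵥ hF.toLp F) (hF.toLp F)) (𝓝 0)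
      (𝓝 (edist (DomAddAct.mk (-(0 : ℝ)) +ᵥ hF.toLp F) (hF.toLp F))) :=
    (h1.edist continuous_const).tendsto 0
  have h3 : ∀ σ : ℝ, edist (DomAddAct.mk (-σ) +ᵥ hF.toLp F) (hF.toLp F) =
      eLpNorm (fun t => F (t - σ) - F t) q volume := by
    intro σ
    rw [DomAddAct.mk_vadd_toLp, Lp.edist_toLp_toLp]
    refine eLpNorm_congr_ae (ae_of_all _ fun t => ?_)
    simp only [Pi.sub_apply, vadd_eq_add, neg_add_eq_sub]
  simp only [h3] at h2
  simpa using h2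

/-- The average is continuous in t, hence bounded on [a, b]. The margin a - a' > h keeps every
window inside the interval where F is integrable. -/
lemma memLp_average_sub [NormedSpace ℝ E] {q : ℝ} (hq : 1 < q) {F : ℝ → E}
    {a' a b h : ℝ} (ha : a' < a) (hab : a < b)
    (hF : MemLp F (ENNReal.ofReal q) (volume.restrict (Icc a' b))) (hh : h < a - a')
    (hh0 : 0 < h) :
    MemLp (fun t => ‖h⁻¹ • (∫ r in (t - h)..t, F r) - F t‖) (ENNReal.ofReal q)
      (volume.restrict (Icc a b)) := by
  have hi : IntegrableOn F (Icc a' b) :=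
    hF.integrable (ENNReal.one_le_ofReal.2 hq.le)
  have hi' : ∀ x ∈ Icc a' b, ∀ y ∈ Icc a' b, IntervalIntegrable F volume x y := fun x hx y hy =>
    intervalIntegrable_iff.2 (hi.mono_set (uIoc_subset_uIcc.trans
      (uIcc_subset_Icc hx hy)))
  have hcont : ContinuousOn (fun x => ∫ r in a'..x, F r) (Icc a' b) := by
    have := intervalIntegral.continuousOn_primitive_interval (μ := volume) (a := a') (b := b)
      (f := F) (by rwa [uIcc_of_le (ha.trans hab).le])
    rwa [uIcc_of_le (ha.trans hab).le] at this
  have hcont2 : ContinuousOn (fun t => ∫ r in (t - h)..t, F r) (Icc a b) := by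
    have h1 : ContinuousOn (fun t => (∫ r in a'..t, F r) - ∫ r in a'..(t - h), F r) (Icc a b) := by
      refine (hcont.mono (Icc_subset_Icc_left ha.le)).sub (hcont.comp (by fun_prop) fun t ht => ?_)
      exact ⟨by linarith [ht.1], by linarith [ht.2]⟩
    refine h1.congr fun t ht => ?_
    have ht' : t ∈ Icc a' b := ⟨by linarith [ht.1], ht.2⟩
    have ht'' : t - h ∈ Icc a' b := ⟨by linarith [ht.1], by linarith [ht.2]⟩
    have hl : a' ∈ Icc a' b := ⟨le_rfl, by linarith⟩
    exact (intervalIntegral.integral_interval_sub_left (hi' _ hl _ ht') (hi' _ hl _ ht'')).symm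
  obtain ⟨C, hC⟩ := isCompact_Icc.exists_bound_of_continuousOn hcont2
  have h1 : MemLp (fun t => ∫ r in (t - h)..t, F r) (ENNReal.ofReal q)
      (volume.restrict (Icc a b)) := by
    refine MemLp.of_bound (hcont2.aestronglyMeasurable_of_isCompact isCompact_Icc
      measurableSet_Icc) C ?_
    filter_upwards [ae_restrict_mem measurableSet_Icc] with t ht using hC t ht
  exact ((h1.const_smul h⁻¹).sub (hF.mono_measure
    (Measure.restrict_mono (Icc_subset_Icc_left ha.le) le_rfl))).norm

/-- Average minus value is the mean over σ ∈ (0, h) of G(t - σ) - G(t); exchange the integrals and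
apply Hölder in t for each σ. Truncating F to [a', b] changes nothing for t ∈ [a, b] and makes
translation on the whole line available. -/
lemma lintegral_average_sub_mul_le [NormedSpace ℝ E] [CompleteSpace E] {p : ℝ} [hp : Fact (1 < p)]
    {F : ℝ → E} (hFm : StronglyMeasurable F) {w : ℝ → ℝ} {a' a b h : ℝ} (ha : a' < a)
    (hF : IntegrableOn F (Icc a' b))
    (hw : MemLp w (ENNReal.ofReal p) (volume.restrict (Icc a b))) (hh : h < a - a')
    (hh0 : 0 < h) {η : ℝ≥0∞} (hη : ∀ σ ∈ Ioc 0 h, eLpNorm (fun t => (Icc a' b).indicator F (t - σ) -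
      (Icc a' b).indicator F t) (ENNReal.ofReal p.conjExponent) volume ≤ η) :
    ∫⁻ t in Icc a b, ‖‖h⁻¹ • (∫ r in (t - h)..t, F r) - F t‖ * w t‖ₑ ≤
      η * eLpNorm w (ENNReal.ofReal p) (volume.restrict (Icc a b)) := by
  set G := (Icc a' b).indicator F with hG
  have hGm : StronglyMeasurable G := hFm.indicator measurableSet_Icc
  have hGi : Integrable G volume := (integrable_indicator_iff measurableSet_Icc).2 hF
  set μ := (volume : Measure ℝ).restrict (Icc a b)
  have hpt : ∀ t ∈ Icc a b, ‖‖h⁻¹ • (∫ r in (t - h)..t, F r) - F t‖ * w t‖ₑ ≤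
      ENNReal.ofReal h⁻¹ * ∫⁻ σ in Ioc 0 h, ‖G (t - σ) - G t‖ₑ * ‖w t‖ₑ := by
    intro t ht
    have e1 : ∫ r in (t - h)..t, F r = ∫ σ in (0 : ℝ)..h, G (t - σ) := by
      rw [intervalIntegral.integral_comp_sub_left (fun x => G x), sub_zero]
      refine intervalIntegral.integral_congr fun r hr => ?_
      rw [uIcc_of_le (by linarith)] at hr
      exact (indicator_of_mem (show r ∈ Icc a' b from
        ⟨by linarith [hr.1, ht.1], hr.2.trans ht.2⟩) F).symm
    have e2 : F t = G t :=
      (indicator_of_mem (show t ∈ Icc a' b from ⟨ha.le.trans ht.1, ht.2⟩) F).symm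
    have e3 : h⁻¹ • (∫ r in (t - h)..t, F r) - F t =
        h⁻¹ • ∫ σ in (0 : ℝ)..h, (G (t - σ) - G t) := by
      rw [e1, e2, intervalIntegral.integral_sub (hGi.comp_sub_left t).intervalIntegrable
        intervalIntegrable_const, intervalIntegral.integral_const, sub_zero, smul_sub,
        inv_smul_smul₀ hh0.ne']
    rw [enorm_mul, enorm_norm, e3, enorm_smul, Real.enorm_of_nonneg (by positivity), mul_assoc,
      intervalIntegral.integral_of_le hh0.le]
    gcongr
    rw [lintegral_mul_const' _ _ enorm_ne_top]
    gcongr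
    exact enorm_integral_le_lintegral_enorm _
  calc ∫⁻ t, ‖‖h⁻¹ • (∫ r in (t - h)..t, F r) - F t‖ * w t‖ₑ ∂μ
      ≤ ∫⁻ t, (ENNReal.ofReal h⁻¹ * ∫⁻ σ in Ioc 0 h, ‖G (t - σ) - G t‖ₑ * ‖w t‖ₑ) ∂μ :=
        setLIntegral_mono' measurableSet_Icc hpt
    _ = ENNReal.ofReal h⁻¹ * ∫⁻ t, (∫⁻ σ in Ioc 0 h, ‖G (t - σ) - G t‖ₑ * ‖w t‖ₑ) ∂μ :=
        lintegral_const_mul' _ _ ENNReal.ofReal_ne_top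
    _ = ENNReal.ofReal h⁻¹ * ∫⁻ σ in Ioc 0 h, ∫⁻ t, ‖G (t - σ) - G t‖ₑ * ‖w t‖ₑ ∂μ := by
        congr 1
        refine lintegral_lintegral_swap ?_
        refine AEMeasurable.mul (f := fun z : ℝ × ℝ => ‖G (z.1 - z.2) - G z.1‖ₑ) (StronglyMeasurable.enorm ?_).aemeasurable hw.1.comp_fst.enorm
        exact (hGm.comp_measurable (measurable_fst.sub measurable_snd)).sub
          (hGm.comp_measurable measurable_fst)
    _ ≤ ENNReal.ofReal h⁻¹ * ∫⁻ σ in Ioc 0 h,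
          (η * eLpNorm w (ENNReal.ofReal p) μ) := by
        gcongr ENNReal.ofReal h⁻¹ * ?_
        refine setLIntegral_mono' measurableSet_Ioc fun σ hσ => ?_
        have hm : AEStronglyMeasurable (fun t => ‖G (t - σ) - G t‖) μ :=
          ((hGm.comp_measurable (measurable_id.sub_const σ)).sub hGm).norm.aestronglyMeasurable
        have := eLpNorm_smul_le_mul_eLpNorm (p := ENNReal.ofReal p.conjExponent)
          (q := ENNReal.ofReal p) (r := 1) hw.1 hm
        rw [eLpNorm_one_eq_lintegral_enorm] at this
        simp only [Pi.smul_apply', enorm_smul, enorm_norm, eLpNorm_norm] at this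
        refine this.trans ?_
        gcongr
        exact (eLpNorm_mono_measure _ Measure.restrict_le_self).trans (hη σ hσ)
    _ = η * eLpNorm w (ENNReal.ofReal p) μ := by
        rw [setLIntegral_const, Real.volume_Ioc, sub_zero, mul_comm _ (ENNReal.ofReal h),
          ← mul_assoc, ← ENNReal.ofReal_mul (by positivity), inv_mul_cancel₀ hh0.ne',
          ENNReal.ofReal_one, one_mul]

/-- Backward averages of an `L^{p'}` function converge in `L^{p'}`, tested against `L^p`. -/
lemma tendsto_integral_average_sub_mul [NormedSpace ℝ E] [CompleteSpace E] {p : ℝ}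
    [hp : Fact (1 < p)] {F : ℝ → E} (hFm : StronglyMeasurable F) {w : ℝ → ℝ} {a' a b : ℝ}
    (ha : a' < a)
    (hF : MemLp F (ENNReal.ofReal p.conjExponent) (volume.restrict (Icc a' b)))
    (hw : MemLp w (ENNReal.ofReal p) (volume.restrict (Icc a b))) :
    Tendsto (fun h => ∫ t in Icc a b, ‖h⁻¹ • (∫ r in (t - h)..t, F r) - F t‖ * w t)
      (𝓝[>] 0) (𝓝 0) := by
  have hq : (1 : ℝ≥0∞) ≤ ENNReal.ofReal p.conjExponent := Fact.out
  have hG : MemLp ((Icc a' b).indicator F) (ENNReal.ofReal p.conjExponent) volume :=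
    (memLp_indicator_iff_restrict measurableSet_Icc).2 hF
  have hT := tendsto_eLpNorm_translate_sub hG
  set W := eLpNorm w (ENNReal.ofReal p) (volume.restrict (Icc a b))
  rw [tendsto_zero_iff_enorm_tendsto_zero, ENNReal.tendsto_nhds_zero]
  intro ε hε
  have h0 : Tendsto (fun η : ℝ≥0∞ => η * W) (𝓝 0) (𝓝 0) := by
    simpa using ENNReal.Tendsto.mul_const (m := id) (b := W) (tendsto_id (α := ℝ≥0∞) (x := 𝓝 0))
      (Or.inr hw.2.ne)
  -- Taken from continuity at 0 of multiplication by the finite number W, which avoids dividing by W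
  -- when W = 0.
  obtain ⟨η, hη, hηε⟩ : ∃ η : ℝ≥0∞, 0 < η ∧ η * W ≤ ε := by
    have h1 : ∀ᶠ η : ℝ≥0∞ in 𝓝[>] 0, η * W ≤ ε :=
      (h0.mono_left nhdsWithin_le_nhds).eventually (Iic_mem_nhds hε)
    obtain ⟨η, h2, h3⟩ := (h1.and self_mem_nhdsWithin).exists
    exact ⟨η, h3, h2⟩
  obtain ⟨r, hr, hrη⟩ := Metric.eventually_nhds_iff.1 (ENNReal.tendsto_nhds_zero.1 hT η hη)
  have hpos : 0 < min r (a - a') := lt_min hr (by linarith)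
  filter_upwards [Ioo_mem_nhdsGT hpos] with h hh
  refine (enorm_integral_le_lintegral_enorm _).trans
    ((lintegral_average_sub_mul_le hFm ha (hF.integrable hq) hw
      (hh.2.trans_le (min_le_right _ _)) hh.1 fun σ hσ => hrη ?_).trans hηε)
  rw [Real.dist_eq, sub_zero, abs_of_pos hσ.1]
  exact hσ.2.trans_lt (hh.2.trans_le (min_le_left _ _))

end Translation

end

/-! ### Regularised Heaviside function and its convex entropies -/

section

/-- The Lipschitz regularisation of the Heaviside function. -/
def ramp (ε r : ℝ) : ℝ := max 0 (min 1 (r / ε))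

section Ramp

variable {ε : ℝ}

lemma ramp_nonneg (ε r : ℝ) : 0 ≤ ramp ε r := le_max_left _ _

lemma ramp_le_one (ε r : ℝ) : ramp ε r ≤ 1 := max_le zero_le_one (min_le_left _ _)

lemma abs_ramp_le_one (ε r : ℝ) : |ramp ε r| ≤ 1 := by
  rw [abs_of_nonneg (ramp_nonneg _ _)]
  exact ramp_le_one _ _

lemma continuous_ramp (ε : ℝ) : Continuous (ramp ε) := by
  unfold ramp; fun_prop

lemma monotone_ramp (hε : 0 < ε) : Monotone (ramp ε) := fun a b hab => by
  unfold ramp; gcongr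

lemma ramp_of_nonpos (hε : 0 < ε) {r : ℝ} (hr : r ≤ 0) : ramp ε r = 0 :=
  max_eq_left ((min_le_right _ _).trans (div_nonpos_of_nonpos_of_nonneg hr hε.le))

lemma abs_ramp_sub_le (hε : 0 < ε) (a b : ℝ) : |ramp ε a - ramp ε b| ≤ |a - b| / ε := by
  refine (abs_max_sub_max_le_max _ _ _ _).trans (max_le (by simp; positivity) ?_)
  refine (abs_min_sub_min_le_max _ _ _ _).trans (max_le (by simp; positivity) ?_)
  rw [← sub_div, abs_div, abs_of_pos hε]

lemma abs_ramp_le (hε : 0 < ε) (a : ℝ) : |ramp ε a| ≤ |a| / ε := by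
  simpa [ramp_of_nonpos hε le_rfl] using abs_ramp_sub_le hε a 0

lemma tendsto_ramp {ε : ℕ → ℝ} (hε : ∀ n, 0 < ε n) (h0 : Tendsto ε atTop (𝓝 0)) (r : ℝ) :
    Tendsto (fun n => ramp (ε n) r) atTop (𝓝 (if 0 < r then 1 else 0)) := by
  split_ifs with h
  · refine tendsto_const_nhds.congr' ?_
    filter_upwards [h0.eventually (Iio_mem_nhds h)] with n hn
    have : 1 ≤ r / ε n := (one_le_div (hε n)).2 (le_of_lt hn)
    rw [ramp, min_eq_left this, max_eq_right zero_le_one]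
  · simp only [ramp_of_nonpos (hε _) (not_lt.1 h), tendsto_const_nhds]

end Ramp

/-- The subgradient inequality for the convex primitive of f; it holds for either order of a and b.
-/
lemma integral_le_mul_of_monotone {f : ℝ → ℝ} (hf : Monotone f) (a b : ℝ) :
    ∫ r in b..a, f r ≤ (a - b) * f a := by
  have hc : ∫ _ in b..a, f a = (a - b) * f a := by
    rw [intervalIntegral.integral_const, smul_eq_mul]
  have hi := hf.intervalIntegrable (μ := volume) (a := b) (b := a)
  rw [← hc]
  rcases le_total b a with h | h
  · exact intervalIntegral.integral_mono_on h hi intervalIntegrable_const fun x hx => hf hx.2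
  · rw [intervalIntegral.integral_symm, intervalIntegral.integral_symm a b, neg_le_neg_iff]
    exact intervalIntegral.integral_mono_on h intervalIntegrable_const hi.symm fun x hx => hf hx.1

lemma abs_intervalIntegral_ramp_le {ε : ℝ} {g : ℝ → ℝ} (a b : ℝ) :
    |∫ r in b..a, ramp ε (g r)| ≤ |a - b| := by
  have := intervalIntegral.norm_integral_le_of_norm_le_const (a := b) (b := a) (C := 1)
    (f := fun r => ramp ε (g r)) fun r _ => abs_ramp_le_one _ _
  simpa using this

section Entropy

variable {m ε : ℝ}

/-- The entropy `∫_b^a H_ε(r^m - b^m) dr`. -/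
def entropyLeft (m ε a b : ℝ) : ℝ := ∫ r in b..a, ramp ε (spow r m - spow b m)

lemma continuous_ramp_spow (hm : 0 < m) (b : ℝ) :
    Continuous fun r => ramp ε (spow r m - spow b m) :=
  (continuous_ramp ε).comp ((continuous_spow hm).sub continuous_const)

/-- Convexity in the first variable, with the slope taken at the later state a. A backward time
increment is thus controlled by a test function evaluated at the current time. -/
lemma entropyLeft_sub_le (hm : 0 < m) (hε : 0 < ε) (a a' b : ℝ) :
    entropyLeft m ε a b - entropyLeft m ε a' b ≤ (a - a') * ramp ε (spow a m - spow b m) := by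
  have hc := continuous_ramp_spow (ε := ε) hm b
  rw [entropyLeft, entropyLeft, intervalIntegral.integral_interval_sub_left
    (hc.intervalIntegrable _ _) (hc.intervalIntegrable _ _)]
  exact integral_le_mul_of_monotone ((monotone_ramp hε).comp fun x y hxy =>
    sub_le_sub_right ((spow_strictMono hm).monotone hxy) _) a a'

lemma abs_entropyLeft_sub_le (hm : 0 < m) (a a' b : ℝ) :
    |entropyLeft m ε a b - entropyLeft m ε a' b| ≤ |a - a'| := by
  have hc := continuous_ramp_spow (ε := ε) hm b
  rw [entropyLeft, entropyLeft, intervalIntegral.integral_interval_sub_left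
    (hc.intervalIntegrable _ _) (hc.intervalIntegrable _ _)]
  exact abs_intervalIntegral_ramp_le a a'

lemma entropyLeft_nonneg (hm : 0 < m) (hε : 0 < ε) (a b : ℝ) : 0 ≤ entropyLeft m ε a b := by
  rcases le_total b a with h | h
  · exact intervalIntegral.integral_nonneg h fun r _ => ramp_nonneg _ _
  · rw [entropyLeft, intervalIntegral.integral_zero_ae]
    refine ae_of_all _ fun r hr => ramp_of_nonpos hε (sub_nonpos.2 ?_)
    rw [uIoc_of_ge h] at hr
    exact (spow_strictMono hm).monotone hr.2

lemma entropyLeft_le_abs (a b : ℝ) : entropyLeft m ε a b ≤ |a - b| :=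
  (le_abs_self _).trans (abs_intervalIntegral_ramp_le a b)

lemma continuous_entropyLeft (hm : 0 < m) :
    Continuous fun z : ℝ × ℝ => entropyLeft m ε z.1 z.2 := by
  have hc : Continuous (Function.uncurry fun (z : ℝ × ℝ) (r : ℝ) =>
      ramp ε (spow r m - spow z.2 m)) :=
    (continuous_ramp ε).comp (((continuous_spow hm).comp continuous_snd).sub
      ((continuous_spow hm).comp (continuous_snd.comp continuous_fst)))
  have h1 := intervalIntegral.continuous_parametric_intervalIntegral_of_continuous (μ := volume)
    (a₀ := 0) hc continuous_fst
  have h2 := intervalIntegral.continuous_parametric_intervalIntegral_of_continuous (μ := volume)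
    (a₀ := 0) hc continuous_snd
  refine (h1.sub h2).congr fun z => ?_
  have hcz := continuous_ramp_spow (ε := ε) hm z.2
  exact intervalIntegral.integral_interval_sub_left
    (hcz.intervalIntegrable _ _) (hcz.intervalIntegrable _ _)

lemma tendsto_entropyLeft_of_tendsto (hm : 0 < m) {a b : ℕ → ℝ} {a₀ b₀ : ℝ}
    (ha : Tendsto a atTop (𝓝 a₀)) (hb : Tendsto b atTop (𝓝 b₀)) :
    Tendsto (fun n => entropyLeft m ε (a n) (b n)) atTop (𝓝 (entropyLeft m ε a₀ b₀)) := by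
  have h1 : ContinuousAt (fun z : ℝ × ℝ => entropyLeft m ε z.1 z.2) (a₀, b₀) :=
    (continuous_entropyLeft (ε := ε) hm).continuousAt
  have h2 : Tendsto (fun n => (a n, b n)) atTop (𝓝 (a₀, b₀)) := ha.prodMk_nhds hb
  generalize entropyLeft m ε = f at h1 ⊢
  exact h1.tendsto.comp h2

/-- In the limit the integrand is the indicator of r > b, because r ↦ r^m is strictly increasing. -/
lemma tendsto_entropyLeft (hm : 0 < m) {ε : ℕ → ℝ} (hε : ∀ n, 0 < ε n)
    (h0 : Tendsto ε atTop (𝓝 0)) (a b : ℝ) :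
    Tendsto (fun n => entropyLeft m (ε n) a b) atTop (𝓝 (max (a - b) 0)) := by
  have h : Tendsto (fun n => entropyLeft m (ε n) a b) atTop
      (𝓝 (∫ r in b..a, if 0 < spow r m - spow b m then (1 : ℝ) else 0)) := by
    refine intervalIntegral.tendsto_integral_filter_of_dominated_convergence (fun _ => 1)
      (Eventually.of_forall fun n => (continuous_ramp_spow hm b).aestronglyMeasurable)
      (Eventually.of_forall fun n => ae_of_all _ fun r _ => abs_ramp_le_one _ _)
      intervalIntegrable_const (ae_of_all _ fun r _ => tendsto_ramp hε h0 _)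
  convert h using 2
  rcases le_total b a with hab | hab
  · rw [max_eq_left (by linarith)]
    rw [intervalIntegral.integral_congr_ae (g := fun _ => (1 : ℝ))]
    · simp
    · refine ae_of_all _ fun r hr => ?_
      rw [uIoc_of_le hab] at hr
      exact if_pos (sub_pos.2 (spow_strictMono hm hr.1))
  · rw [max_eq_right (by linarith), intervalIntegral.integral_zero_ae]
    refine ae_of_all _ fun r hr => ?_
    rw [uIoc_of_ge hab] at hr
    exact if_neg (not_lt.2 (sub_nonpos.2 ((spow_strictMono hm).monotone hr.2)))

end Entropy

variable {d : ℕ} {m ε : ℝ}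

/-- The integrated entropy `∫ η(A(x), B(x)) dx`. -/
def entropyInt (m ε : ℝ) (A B : L1 d) : ℝ := ∫ x, entropyLeft m ε (A x) (B x)

lemma integrable_entropyLeft (hm : 0 < m) (hε : 0 < ε) (A B : L1 d) :
    Integrable (fun x => entropyLeft m ε (A x) (B x)) volume := by
  have hmeas : AEStronglyMeasurable (fun x => entropyLeft m ε (A x) (B x)) volume :=
    Continuous.comp_aestronglyMeasurable (g := fun z : ℝ × ℝ => entropyLeft m ε z.1 z.2)
      (f := fun x => (A x, B x)) (continuous_entropyLeft hm)
      ((Lp.aestronglyMeasurable A).prodMk (Lp.aestronglyMeasurable B))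
  refine Integrable.mono' ((L1.integrable_coeFn A).sub (L1.integrable_coeFn B)).abs hmeas
    (ae_of_all _ fun x => ?_)
  rw [Real.norm_eq_abs, abs_of_nonneg (entropyLeft_nonneg hm hε _ _)]
  exact entropyLeft_le_abs _ _

lemma entropyInt_sub_le (hm : 0 < m) (hε : 0 < ε) (A A' B : L1 d) :
    entropyInt m ε A B - entropyInt m ε A' B ≤
      ∫ x, (A - A' : L1 d) x * ramp ε (spow (A x) m - spow (B x) m) := by
  rw [entropyInt, entropyInt, ← integral_sub (integrable_entropyLeft hm hε _ _)
    (integrable_entropyLeft hm hε _ _)]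
  have hc : Continuous fun z : ℝ × ℝ => ramp ε (spow z.1 m - spow z.2 m) :=
    (continuous_ramp ε).comp (((continuous_spow hm).comp continuous_fst).sub
      ((continuous_spow hm).comp continuous_snd))
  have h1 : Integrable (fun x => entropyLeft m ε (A x) (B x) - entropyLeft m ε (A' x) (B x))
      volume := (integrable_entropyLeft hm hε _ _).sub (integrable_entropyLeft hm hε _ _)
  have hmeas : AEStronglyMeasurable (fun x => ramp ε (spow (A x) m - spow (B x) m)) volume :=
    Continuous.comp_aestronglyMeasurable (g := fun z : ℝ × ℝ => ramp ε (spow z.1 m - spow z.2 m))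
      (f := fun x => (A x, B x)) hc
      ((Lp.aestronglyMeasurable A).prodMk (Lp.aestronglyMeasurable B))
  have h2 : Integrable (fun x => (A - A' : L1 d) x * ramp ε (spow (A x) m - spow (B x) m))
      volume := (L1.integrable_coeFn (A - A')).mul_bdd (c := 1) hmeas
      (ae_of_all _ fun x => abs_ramp_le_one _ _)
  refine integral_mono_ae h1 h2 ?_
  filter_upwards [Lp.coeFn_sub A A'] with x hx
  simp only [hx, Pi.sub_apply]
  exact entropyLeft_sub_le hm hε _ _ _

lemma norm_eq_integral_abs (A : L1 d) : ‖A‖ = ∫ x, |A x| := L1.norm_eq_integral_norm A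

lemma abs_entropyInt_sub_le (hm : 0 < m) (hε : 0 < ε) (A A' B : L1 d) :
    |entropyInt m ε A B - entropyInt m ε A' B| ≤ ‖A - A'‖ := by
  rw [entropyInt, entropyInt, ← integral_sub (integrable_entropyLeft hm hε _ _)
    (integrable_entropyLeft hm hε _ _), norm_eq_integral_abs]
  have h1 : Integrable (fun x => entropyLeft m ε (A x) (B x) - entropyLeft m ε (A' x) (B x))
      volume := (integrable_entropyLeft hm hε _ _).sub (integrable_entropyLeft hm hε _ _)
  refine abs_integral_le_integral_abs.trans (integral_mono_ae h1.abs
    (L1.integrable_coeFn (A - A')).abs ?_)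
  filter_upwards [Lp.coeFn_sub A A'] with x hx
  simp only [hx, Pi.sub_apply]
  exact abs_entropyLeft_sub_le hm _ _ _

lemma entropyInt_nonneg (hm : 0 < m) (hε : 0 < ε) (A B : L1 d) : 0 ≤ entropyInt m ε A B :=
  integral_nonneg fun _ => entropyLeft_nonneg hm hε _ _

lemma entropyInt_le (hm : 0 < m) (hε : 0 < ε) (A B : L1 d) : entropyInt m ε A B ≤ ‖A - B‖ := by
  rw [norm_eq_integral_abs]
  refine integral_mono_ae (integrable_entropyLeft hm hε _ _)
    (L1.integrable_coeFn (A - B)).abs ?_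
  filter_upwards [Lp.coeFn_sub A B] with x hx
  simp only [hx, Pi.sub_apply]
  exact entropyLeft_le_abs _ _

lemma norm_posPart_eq (A : L1 d) : ‖A⁺‖ = ∫ x, max (A x) 0 := by
  rw [norm_eq_integral_abs]
  refine integral_congr_ae ?_
  filter_upwards [Lp.coeFn_sup A 0, Lp.coeFn_zero ℝ 1 (volume : Measure (Space d))] with x hx h0
  rw [posPart_def, hx, Pi.sup_apply, h0, Pi.zero_apply, abs_of_nonneg le_sup_right]

lemma tendsto_entropyInt (hm : 0 < m) {ε : ℕ → ℝ} (hε : ∀ n, 0 < ε n)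
    (h0 : Tendsto ε atTop (𝓝 0)) (A B : L1 d) :
    Tendsto (fun n => entropyInt m (ε n) A B) atTop (𝓝 ‖(A - B)⁺‖) := by
  have h : ‖(A - B)⁺‖ = ∫ x, max (A x - B x) 0 := by
    rw [norm_posPart_eq]
    refine integral_congr_ae ?_
    filter_upwards [Lp.coeFn_sub A B] with x hx
    rw [hx, Pi.sub_apply]
  rw [h]
  refine tendsto_integral_of_dominated_convergence (fun x => |A x - B x|)
    (fun n => (integrable_entropyLeft hm (hε n) A B).1)
    ((L1.integrable_coeFn A).sub (L1.integrable_coeFn B)).abs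
    (fun n => ae_of_all _ fun x => ?_) (ae_of_all _ fun x => tendsto_entropyLeft hm hε h0 _ _)
  rw [Real.norm_eq_abs, abs_of_nonneg (entropyLeft_nonneg hm (hε n) _ _)]
  exact entropyLeft_le_abs _ _

/-- Stated over a general space X in order to cover joint measurability in the two times. The
Lipschitz bound concerns only the first argument, so measurability again goes through lower
semicontinuity. -/
lemma measurable_entropyInt (hm : 0 < m) (hε : 0 < ε) {X : Type*} [TopologicalSpace X]
    [SequentialSpace X] [MeasurableSpace X] [OpensMeasurableSpace X] {A B : X → L1 d}
    (hA : Continuous A) (hB : Continuous B) :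
    Measurable fun t => entropyInt m ε (A t) (B t) := by
  have h : (fun t => entropyInt m ε (A t) (B t)) = fun t =>
      (∫⁻ x, ENNReal.ofReal (entropyLeft m ε (A t x) (B t x))).toReal := by
    ext t
    exact integral_eq_lintegral_of_nonneg_ae
      (ae_of_all _ fun x => entropyLeft_nonneg hm hε _ _)
      (integrable_entropyLeft hm hε (A t) (B t)).1
  rw [h]
  have hsc : LowerSemicontinuous fun t =>
      ∫⁻ x, ENNReal.ofReal (entropyLeft m ε (A t x) (B t x)) := by
    refine lowerSemicontinuous_lintegral_of_subseq
      (fun t x => ENNReal.ofReal (entropyLeft m ε (A t x) (B t x)))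
      (fun t => (integrable_entropyLeft hm hε (A t) (B t)).1.aemeasurable.ennreal_ofReal)
      fun τ t hτ => ?_
    obtain ⟨φ, hφ, h1⟩ := exists_subseq_ae_tendsto ((hA.tendsto t).comp hτ)
    obtain ⟨ψ, hψ, h2⟩ := exists_subseq_ae_tendsto
      ((hB.tendsto t).comp (hτ.comp hφ.tendsto_atTop))
    refine ⟨φ ∘ ψ, hφ.comp hψ, ?_⟩
    filter_upwards [h1, h2] with x h1 h2
    exact ENNReal.tendsto_ofReal (tendsto_entropyLeft_of_tendsto hm (h1.comp hψ.tendsto_atTop) h2)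
  exact hsc.measurable.ennreal_toReal

end

/-! ### From increments to a divergence inequality on rectangles -/

section

/-- The integral telescopes to the last window minus the first, each of length h and each within κh
of h times the endpoint value. -/
lemma le_integral_sub_translate {L : ℝ → ℝ} {a b h κ : ℝ} (hab : a ≤ b) (hh : 0 < h)
    (hL : Continuous L) (hb : ∀ x ∈ Icc (b - h) b, |L x - L b| ≤ κ)
    (ha : ∀ x ∈ Icc (a - h) a, |L x - L a| ≤ κ) :
    h * (L b - L a - 2 * κ) ≤ ∫ t in Icc a b, (L t - L (t - h)) := by
  have hi : ∀ x y, IntervalIntegrable L volume x y := fun x y => hL.intervalIntegrable x y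
  have hs : Continuous fun t => L (t - h) := by fun_prop
  rw [integral_Icc_eq_integral_Ioc, ← intervalIntegral.integral_of_le hab,
    intervalIntegral.integral_sub (hi _ _) (hs.intervalIntegrable _ _),
    intervalIntegral.integral_comp_sub_right L]
  have e1 : (∫ x in a..b, L x) - ∫ x in (a - h)..(b - h), L x =
      (∫ x in (b - h)..b, L x) - ∫ x in (a - h)..a, L x := by
    have h1 := intervalIntegral.integral_add_adjacent_intervals (hi (a - h) (b - h)) (hi (b - h) b)
    have h2 := intervalIntegral.integral_add_adjacent_intervals (hi (a - h) a) (hi a b)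
    linarith
  rw [e1]
  have e2 : h * (L b - κ) ≤ ∫ x in (b - h)..b, L x := by
    have : ∫ _ in (b - h)..b, (L b - κ) = h * (L b - κ) := by
      rw [intervalIntegral.integral_const, smul_eq_mul]; ring
    rw [← this]
    refine intervalIntegral.integral_mono_on (by linarith) intervalIntegrable_const (hi _ _)
      fun x hx => ?_
    have := abs_le.1 (hb x hx)
    linarith
  have e3 : ∫ x in (a - h)..a, L x ≤ h * (L a + κ) := by
    have : ∫ _ in (a - h)..a, (L a + κ) = h * (L a + κ) := by
      rw [intervalIntegral.integral_const, smul_eq_mul]; ring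
    rw [← this]
    refine intervalIntegral.integral_mono_on (by linarith) (hi _ _) intervalIntegrable_const
      fun x hx => ?_
    have := abs_le.1 (ha x hx)
    linarith
  nlinarith

/-- A difference inequality in two time variables yields the divergence inequality on a
rectangle. -/
lemma rectangle_of_increment {E : Type*} [NormedAddCommGroup E] {U₁ U₂ : ℝ → E}
    (hU₁ : Continuous U₁) (hU₂ : Continuous U₂) {G₁ G₂ : ℝ → ℝ → ℝ}
    (hm₁ : Measurable (Function.uncurry G₁)) (hm₂ : Measurable (Function.uncurry G₂))
    (hb₁ : ∀ t r, |G₁ t r| ≤ ‖U₁ t - U₂ r‖) (hb₂ : ∀ t r, |G₂ t r| ≤ ‖U₁ t - U₂ r‖)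
    (hl₁ : ∀ t t' r, |G₁ t r - G₁ t' r| ≤ ‖U₁ t - U₁ t'‖)
    (hl₂ : ∀ t r r', |G₂ t r - G₂ t r'| ≤ ‖U₂ r - U₂ r'‖)
    {a b c e K h₀ : ℝ} (hab : a ≤ b) (hce : c ≤ e) (hh₀ : 0 < h₀)
    {δ₁ δ₂ : ℝ → ℝ → ℝ} {N₁ N₂ : ℝ → ℝ}
    (hδ₁ : ∀ h ∈ Ioo 0 h₀, IntegrableOn (δ₁ h) (Icc a b))
    (hδ₂ : ∀ h ∈ Ioo 0 h₀, IntegrableOn (δ₂ h) (Icc c e))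
    (hN₁ : IntegrableOn N₁ (Icc a b)) (hN₂ : IntegrableOn N₂ (Icc c e))
    (hδN₁ : ∀ h ∈ Ioo 0 h₀, IntegrableOn (fun t => δ₁ h t * N₁ t) (Icc a b))
    (hδN₂ : ∀ h ∈ Ioo 0 h₀, IntegrableOn (fun t => δ₂ h t * N₂ t) (Icc c e))
    (ht₁ : Tendsto (fun h => ∫ t in Icc a b, δ₁ h t) (𝓝[>] 0) (𝓝 0))
    (ht₂ : Tendsto (fun h => ∫ t in Icc c e, δ₂ h t) (𝓝[>] 0) (𝓝 0))
    (htN₁ : Tendsto (fun h => ∫ t in Icc a b, δ₁ h t * N₁ t) (𝓝[>] 0) (𝓝 0))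
    (htN₂ : Tendsto (fun h => ∫ t in Icc c e, δ₂ h t * N₂ t) (𝓝[>] 0) (𝓝 0))
    (hinc : ∀ h ∈ Ioo 0 h₀, ∀ᵐ z ∂(volume.restrict (Icc a b)).prod (volume.restrict (Icc c e)),
      G₁ z.1 z.2 - G₁ (z.1 - h) z.2 + (G₂ z.1 z.2 - G₂ z.1 (z.2 - h)) ≤
        h * (K * ((δ₁ h z.1 + δ₂ h z.2) * (N₁ z.1 + N₂ z.2)))) :
    (∫ r in Icc c e, (G₁ b r - G₁ a r)) + ∫ t in Icc a b, (G₂ t e - G₂ t c) ≤ 0 := by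
  set μ := (volume : Measure ℝ).restrict (Icc a b)
  set ν := (volume : Measure ℝ).restrict (Icc c e)
  have hcL₁ : ∀ r, Continuous fun t => G₁ t r := fun r => by
    refine continuous_iff_continuousAt.2 fun t => ?_
    refine tendsto_iff_norm_sub_tendsto_zero.2 (squeeze_zero (fun _ => norm_nonneg _)
      (fun t' => hl₁ t' t r) ?_)
    exact tendsto_iff_norm_sub_tendsto_zero.1 (hU₁.tendsto t)
  have hcL₂ : ∀ t, Continuous fun r => G₂ t r := fun t => by
    refine continuous_iff_continuousAt.2 fun r => ?_
    refine tendsto_iff_norm_sub_tendsto_zero.2 (squeeze_zero (fun _ => norm_nonneg _)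
      (fun r' => hl₂ t r' r) ?_)
    exact tendsto_iff_norm_sub_tendsto_zero.1 (hU₂.tendsto r)
  obtain ⟨C, hC⟩ := (isCompact_Icc.prod isCompact_Icc :
      IsCompact (Icc (a - h₀) b ×ˢ Icc (c - h₀) e)).exists_bound_of_continuousOn
    (f := fun z : ℝ × ℝ => U₁ z.1 - U₂ z.2) (by fun_prop)
  have hC' : ∀ t ∈ Icc (a - h₀) b, ∀ r ∈ Icc (c - h₀) e, ‖U₁ t - U₂ r‖ ≤ C :=
    fun t ht r hr => hC (t, r) ⟨ht, hr⟩
  have hmem : ∀ᵐ z ∂μ.prod ν, z.1 ∈ Icc a b ∧ z.2 ∈ Icc c e :=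
    (Measure.quasiMeasurePreserving_fst.ae (ae_restrict_mem measurableSet_Icc)).and
      (Measure.quasiMeasurePreserving_snd.ae (ae_restrict_mem measurableSet_Icc))
  have hD₁ : ∀ h ∈ Ioo 0 h₀,
      Integrable (fun z : ℝ × ℝ => G₁ z.1 z.2 - G₁ (z.1 - h) z.2) (μ.prod ν) := by
    intro h hh
    have hmeas : Measurable fun z : ℝ × ℝ => G₁ z.1 z.2 - G₁ (z.1 - h) z.2 :=
      hm₁.sub (hm₁.comp ((measurable_fst.sub_const h).prodMk measurable_snd))
    refine Integrable.of_bound hmeas.aestronglyMeasurable (C + C) ?_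
    filter_upwards [hmem] with z hz
    refine (norm_sub_le _ _).trans (add_le_add ((hb₁ _ _).trans (hC' _ ?_ _ ?_))
      ((hb₁ _ _).trans (hC' _ ?_ _ ?_)))
    all_goals constructor <;> linarith [hz.1.1, hz.1.2, hz.2.1, hz.2.2, hh.1, hh.2]
  have hD₂ : ∀ h ∈ Ioo 0 h₀,
      Integrable (fun z : ℝ × ℝ => G₂ z.1 z.2 - G₂ z.1 (z.2 - h)) (μ.prod ν) := by
    intro h hh
    have hmeas : Measurable fun z : ℝ × ℝ => G₂ z.1 z.2 - G₂ z.1 (z.2 - h) :=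
      hm₂.sub (hm₂.comp (measurable_fst.prodMk (measurable_snd.sub_const h)))
    refine Integrable.of_bound hmeas.aestronglyMeasurable (C + C) ?_
    filter_upwards [hmem] with z hz
    refine (norm_sub_le _ _).trans (add_le_add ((hb₂ _ _).trans (hC' _ ?_ _ ?_))
      ((hb₂ _ _).trans (hC' _ ?_ _ ?_)))
    all_goals constructor <;> linarith [hz.1.1, hz.1.2, hz.2.1, hz.2.2, hh.1, hh.2]
  have hX₁ : IntegrableOn (fun r => G₁ b r - G₁ a r) (Icc c e) := by
    have hmeas : Measurable fun r => G₁ b r - G₁ a r :=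
      (hm₁.comp measurable_prodMk_left).sub (hm₁.comp measurable_prodMk_left)
    refine Integrable.of_bound hmeas.aestronglyMeasurable (C + C) ?_
    filter_upwards [ae_restrict_mem measurableSet_Icc] with r hr
    refine (norm_sub_le _ _).trans (add_le_add ((hb₁ _ _).trans (hC' _ ?_ _ ?_))
      ((hb₁ _ _).trans (hC' _ ?_ _ ?_)))
    all_goals constructor <;> linarith [hr.1, hr.2]
  have hX₂ : IntegrableOn (fun t => G₂ t e - G₂ t c) (Icc a b) := by
    have hmeas : Measurable fun t => G₂ t e - G₂ t c :=
      (hm₂.comp measurable_prodMk_right).sub (hm₂.comp measurable_prodMk_right)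
    refine Integrable.of_bound hmeas.aestronglyMeasurable (C + C) ?_
    filter_upwards [ae_restrict_mem measurableSet_Icc] with r hr
    refine (norm_sub_le _ _).trans (add_le_add ((hb₂ _ _).trans (hC' _ ?_ _ ?_))
      ((hb₂ _ _).trans (hC' _ ?_ _ ?_)))
    all_goals constructor <;> linarith [hr.1, hr.2]
  -- The cross terms factor into products of one-variable integrals, so L¹ smallness of the errors
  -- suffices for them; the products of δᵢ with its own Nᵢ are covered by separate hypotheses.
  have hexp : ∀ h, (fun z : ℝ × ℝ => (δ₁ h z.1 + δ₂ h z.2) * (N₁ z.1 + N₂ z.2)) =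
      fun z => ((δ₁ h z.1 * N₁ z.1) * 1 + δ₁ h z.1 * N₂ z.2) +
        (N₁ z.1 * δ₂ h z.2 + 1 * (δ₂ h z.2 * N₂ z.2)) := fun h => by
    ext z; ring
  have hone₁ : Integrable (fun _ : ℝ => (1 : ℝ)) μ := integrable_const 1
  have hone₂ : Integrable (fun _ : ℝ => (1 : ℝ)) ν := integrable_const 1
  have hRint : ∀ h ∈ Ioo 0 h₀,
      Integrable (fun z : ℝ × ℝ => (δ₁ h z.1 + δ₂ h z.2) * (N₁ z.1 + N₂ z.2)) (μ.prod ν) := by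
    intro h hh
    rw [hexp]
    exact ((Integrable.mul_prod (hδN₁ h hh) hone₂).add (Integrable.mul_prod (hδ₁ h hh) hN₂)).add
      ((Integrable.mul_prod hN₁ (hδ₂ h hh)).add (Integrable.mul_prod hone₁ (hδN₂ h hh)))
  have hR : Tendsto (fun h => ∫ z, (δ₁ h z.1 + δ₂ h z.2) * (N₁ z.1 + N₂ z.2) ∂μ.prod ν)
      (𝓝[>] 0) (𝓝 0) := by
    have h1 : Tendsto (fun h => ((∫ t, δ₁ h t * N₁ t ∂μ) * (∫ _, 1 ∂ν) +
        (∫ t, δ₁ h t ∂μ) * ∫ r, N₂ r ∂ν) + ((∫ t, N₁ t ∂μ) * (∫ r, δ₂ h r ∂ν) +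
        (∫ _, 1 ∂μ) * ∫ r, δ₂ h r * N₂ r ∂ν)) (𝓝[>] 0)
        (𝓝 ((0 * (∫ _, (1 : ℝ) ∂ν) + 0 * ∫ r, N₂ r ∂ν) +
          ((∫ t, N₁ t ∂μ) * 0 + (∫ _, (1 : ℝ) ∂μ) * 0))) :=
      ((htN₁.mul_const _).add (ht₁.mul_const _)).add
        ((ht₂.const_mul _).add (htN₂.const_mul _))
    simp only [zero_mul, mul_zero, add_zero] at h1
    refine h1.congr' ?_
    filter_upwards [Ioo_mem_nhdsGT hh₀] with h hh
    have i1 : Integrable (fun z : ℝ × ℝ => (δ₁ h z.1 * N₁ z.1) * 1) (μ.prod ν) :=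
      Integrable.mul_prod (hδN₁ h hh) hone₂
    have i2 : Integrable (fun z : ℝ × ℝ => δ₁ h z.1 * N₂ z.2) (μ.prod ν) :=
      Integrable.mul_prod (hδ₁ h hh) hN₂
    have i3 : Integrable (fun z : ℝ × ℝ => N₁ z.1 * δ₂ h z.2) (μ.prod ν) :=
      Integrable.mul_prod hN₁ (hδ₂ h hh)
    have i4 : Integrable (fun z : ℝ × ℝ => 1 * (δ₂ h z.2 * N₂ z.2)) (μ.prod ν) :=
      Integrable.mul_prod hone₁ (hδN₂ h hh)
    have i12 : Integrable (fun z : ℝ × ℝ => (δ₁ h z.1 * N₁ z.1) * 1 + δ₁ h z.1 * N₂ z.2)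
      (μ.prod ν) := i1.add i2
    have i34 : Integrable (fun z : ℝ × ℝ => N₁ z.1 * δ₂ h z.2 + 1 * (δ₂ h z.2 * N₂ z.2))
      (μ.prod ν) := i3.add i4
    rw [hexp, integral_add i12 i34, integral_add i1 i2, integral_add i3 i4,
      integral_prod_mul (fun t => δ₁ h t * N₁ t) (fun _ => (1 : ℝ)),
      integral_prod_mul (δ₁ h) N₂, integral_prod_mul N₁ (δ₂ h),
      integral_prod_mul (fun _ => (1 : ℝ)) fun r => δ₂ h r * N₂ r]
  have key : ∀ κ : ℝ, 0 < κ → (∫ r, (G₁ b r - G₁ a r) ∂ν) + ∫ t, (G₂ t e - G₂ t c) ∂μ ≤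
      (2 * κ) * ((e - c) + (b - a)) := by
    intro κ hκ
    -- Continuity at the four sides of the rectangle makes the telescoped windows accurate to κ,
    -- uniformly in the other time variable.
    have hnear : ∀ {U : ℝ → E} (_ : Continuous U) (x : ℝ), ∀ᶠ h in 𝓝[>] (0 : ℝ),
        ∀ y ∈ Icc (x - h) x, ‖U y - U x‖ ≤ κ := by
      intro U hU x
      obtain ⟨r, hr, hr'⟩ := Metric.continuousAt_iff.1 hU.continuousAt κ hκ
      filter_upwards [Ioo_mem_nhdsGT hr] with h hh y hy
      rw [← dist_eq_norm]
      refine (hr' ?_).le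
      rw [Real.dist_eq, abs_lt]
      constructor <;> linarith [hy.1, hy.2, hh.1, hh.2]
    have hev : ∀ᶠ h in 𝓝[>] (0 : ℝ), (∫ r, (G₁ b r - G₁ a r) ∂ν) + (∫ t, (G₂ t e - G₂ t c) ∂μ) -
        (2 * κ) * ((e - c) + (b - a)) ≤
          K * ∫ z, (δ₁ h z.1 + δ₂ h z.2) * (N₁ z.1 + N₂ z.2) ∂μ.prod ν := by
      filter_upwards [Ioo_mem_nhdsGT hh₀, hnear hU₁ a, hnear hU₁ b, hnear hU₂ c, hnear hU₂ e]
        with h hh h1 h2 h3 h4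
      have hsum := integral_mono_ae ((hD₁ h hh).add (hD₂ h hh))
        (((hRint h hh).const_mul K).const_mul h) (hinc h hh)
      simp only [Pi.add_apply] at hsum
      rw [integral_add (hD₁ h hh) (hD₂ h hh), integral_const_mul, integral_const_mul,
        integral_prod_symm _ (hD₁ h hh), integral_prod _ (hD₂ h hh)] at hsum
      have l1 : h * ((∫ r, (G₁ b r - G₁ a r) ∂ν) - 2 * κ * (e - c)) ≤
          ∫ r, ∫ t, (G₁ t r - G₁ (t - h) r) ∂μ ∂ν := by
        have : h * ((∫ r, (G₁ b r - G₁ a r) ∂ν) - 2 * κ * (e - c)) =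
            ∫ r, h * (G₁ b r - G₁ a r - 2 * κ) ∂ν := by
          rw [integral_const_mul, integral_sub hX₁ (integrable_const _)]
          simp [ν, hce]; left; ring
        rw [this]
        exact integral_mono ((hX₁.sub (integrable_const _)).const_mul h)
          (hD₁ h hh).integral_prod_right fun r => le_integral_sub_translate hab hh.1 (hcL₁ r)
            (fun x hx => (hl₁ _ _ _).trans (h2 x hx)) fun x hx => (hl₁ _ _ _).trans (h1 x hx)
      have l2 : h * ((∫ t, (G₂ t e - G₂ t c) ∂μ) - 2 * κ * (b - a)) ≤
          ∫ t, ∫ r, (G₂ t r - G₂ t (r - h)) ∂ν ∂μ := by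
        have : h * ((∫ t, (G₂ t e - G₂ t c) ∂μ) - 2 * κ * (b - a)) =
            ∫ t, h * (G₂ t e - G₂ t c - 2 * κ) ∂μ := by
          rw [integral_const_mul, integral_sub hX₂ (integrable_const _)]
          simp [μ, hab]; left; ring
        rw [this]
        exact integral_mono ((hX₂.sub (integrable_const _)).const_mul h)
          (hD₂ h hh).integral_prod_left fun t => le_integral_sub_translate hce hh.1 (hcL₂ t)
            (fun x hx => (hl₂ _ _ _).trans (h4 x hx)) fun x hx => (hl₂ _ _ _).trans (h3 x hx)
      have := hsum.trans' (add_le_add l1 l2)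
      rw [← mul_add] at this
      have := le_of_mul_le_mul_left this hh.1
      linarith
    have hlim : Tendsto (fun h => K * ∫ z, (δ₁ h z.1 + δ₂ h z.2) * (N₁ z.1 + N₂ z.2) ∂μ.prod ν)
        (𝓝[>] 0) (𝓝 0) := by
      simpa using hR.const_mul K
    have := ge_of_tendsto hlim hev
    linarith
  refine le_of_forall_pos_le_add fun η hη => ?_
  -- The added 1 keeps the divisor positive for a degenerate rectangle.
  have hpos : 0 < 2 * ((e - c) + (b - a) + 1) := by linarith
  have := key (η / (2 * ((e - c) + (b - a) + 1))) (by positivity)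
  refine this.trans ?_
  rw [zero_add, mul_assoc, mul_comm, mul_assoc, div_mul_eq_mul_div, div_le_iff₀ hpos]
  nlinarith

end

/-! ### Doubling the time variable: the increment inequality -/

section

variable {d : ℕ} {s p m ε : ℝ}

section RampDiff

variable {v w : Space d → ℝ}

/-- The test function `H_ε(v - w)`. -/
def rampDiff (ε : ℝ) (v w : Space d → ℝ) (x : Space d) : ℝ := ramp ε (v x - w x)

lemma measurable_rampDiff (hv : Measurable v) (hw : Measurable w) :
    Measurable (rampDiff ε v w) :=
  (continuous_ramp ε).measurable.comp (hv.sub hw)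

lemma memLp_rampDiff (hε : 0 < ε) (hvm : Measurable v) (hwm : Measurable w)
    (hv : MemLp v (ENNReal.ofReal p) volume) (hw : MemLp w (ENNReal.ofReal p) volume) :
    MemLp (rampDiff ε v w) (ENNReal.ofReal p) volume := by
  refine (((hv.sub hw).const_mul (1 / ε))).mono
    (measurable_rampDiff hvm hwm).aestronglyMeasurable (ae_of_all _ fun x => ?_)
  refine (abs_ramp_le hε _).trans_eq ?_
  simp only [Pi.sub_apply]
  rw [norm_mul, Real.norm_of_nonneg (by positivity), Real.norm_eq_abs, div_mul_eq_mul_div, one_mul]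

lemma abs_diffQuot_rampDiff_le (hε : 0 < ε) (z : Space d × Space d) :
    |diffQuot s p (rampDiff ε v w) z| ≤ 1 / ε * (|diffQuot s p v z| + |diffQuot s p w z|) := by
  simp only [diffQuot, abs_div,
    abs_of_nonneg (by positivity : 0 ≤ ‖z.1 - z.2‖ ^ (((d : ℝ) + s * p) / p))]
  rw [← add_div, ← mul_div_assoc]
  gcongr
  refine (abs_ramp_sub_le hε _ _).trans ?_
  rw [div_mul_eq_mul_div, one_mul]
  gcongr
  rw [show v z.1 - w z.1 - (v z.2 - w z.2) = (v z.1 - v z.2) - (w z.1 - w z.2) by ring]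
  exact abs_sub _ _

lemma memLp_diffQuot_rampDiff (hε : 0 < ε) (hvm : Measurable v) (hwm : Measurable w)
    (hv : MemLp (diffQuot s p v) (ENNReal.ofReal p) volume)
    (hw : MemLp (diffQuot s p w) (ENNReal.ofReal p) volume) :
    MemLp (diffQuot s p (rampDiff ε v w)) (ENNReal.ofReal p) volume := by
  refine ((hv.abs.add hw.abs).const_mul (1 / ε)).mono
    (measurable_diffQuot (measurable_rampDiff hvm hwm)).aestronglyMeasurable
    (ae_of_all _ fun z => ?_)
  exact (abs_diffQuot_rampDiff_le hε z).trans (le_abs_self _)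

lemma norm_toLp_diffQuot_rampDiff_le [Fact (1 < p)] (hε : 0 < ε) (hvm : Measurable v)
    (hwm : Measurable w) (hv : MemLp (diffQuot s p v) (ENNReal.ofReal p) volume)
    (hw : MemLp (diffQuot s p w) (ENNReal.ofReal p) volume) :
    ‖(memLp_diffQuot_rampDiff hε hvm hwm hv hw).toLp‖ ≤
      1 / ε * ((eLpNorm (diffQuot s p v) (ENNReal.ofReal p) volume).toReal +
        (eLpNorm (diffQuot s p w) (ENNReal.ofReal p) volume).toReal) := by
  have h1 : eLpNorm (diffQuot s p (rampDiff ε v w)) (ENNReal.ofReal p) volume ≤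
      ENNReal.ofReal (1 / ε) * (eLpNorm (diffQuot s p v) (ENNReal.ofReal p) volume +
        eLpNorm (diffQuot s p w) (ENNReal.ofReal p) volume) := by
    refine (eLpNorm_le_mul_eLpNorm_of_ae_le_mul (c := 1 / ε)
      (g := fun z => |diffQuot s p v z| + |diffQuot s p w z|) (ae_of_all _ fun z => ?_) _).trans ?_
    · rw [Real.norm_of_nonneg (by positivity : 0 ≤ |diffQuot s p v z| + |diffQuot s p w z|)]
      exact abs_diffQuot_rampDiff_le hε z
    · gcongr
      refine (eLpNorm_add_le hv.1.norm hw.1.norm Fact.out).trans_eq ?_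
      rw [eLpNorm_norm, eLpNorm_norm]
  rw [Lp.norm_toLp, ← ENNReal.toReal_add hv.2.ne hw.2.ne,
    ← ENNReal.toReal_ofReal (by positivity : 0 ≤ 1 / ε), ← ENNReal.toReal_mul]
  exact ENNReal.toReal_mono
    (ENNReal.mul_ne_top ENNReal.ofReal_ne_top (ENNReal.add_ne_top.2 ⟨hv.2.ne, hw.2.ne⟩)) h1

/-- Both factors have the sign of (v - w)(x) - (v - w)(y): the first as r ↦ r^(p-1) is increasing,
the second as the ramp is. -/
lemma flux_sub_mul_diffQuot_rampDiff_nonneg (hp : 1 < p) (hε : 0 < ε) (z : Space d × Space d) :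
    0 ≤ (flux s p v z - flux s p w z) * diffQuot s p (rampDiff ε v w) z := by
  set k := ‖z.1 - z.2‖ ^ (((d : ℝ) + s * p) / p) with hk
  have hk0 : 0 ≤ k := by positivity
  have hmono := (spow_strictMono (sub_pos.2 hp)).monotone
  simp only [flux, diffQuot, rampDiff, ← hk]
  rcases le_total (v z.1 - w z.1) (v z.2 - w z.2) with h | h
  · refine mul_nonneg_of_nonpos_of_nonpos (sub_nonpos.2 (hmono ?_))
      (div_nonpos_of_nonpos_of_nonneg (sub_nonpos.2 (monotone_ramp hε h)) hk0)
    exact div_le_div_of_nonneg_right (by linarith) hk0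
  · refine mul_nonneg (sub_nonneg.2 (hmono ?_))
      (div_nonneg (sub_nonneg.2 (monotone_ramp hε h)) hk0)
    exact div_le_div_of_nonneg_right (by linarith) hk0

lemma integrable_flux_sub_mul [hp : Fact (1 < p)] (hε : 0 < ε) (hvm : Measurable v)
    (hwm : Measurable w) (hv : MemLp (diffQuot s p v) (ENNReal.ofReal p) volume)
    (hw : MemLp (diffQuot s p w) (ENNReal.ofReal p) volume) :
    Integrable (fun z => (flux s p v z - flux s p w z) * diffQuot s p (rampDiff ε v w) z)
      volume :=
  integrable_mul_of_conj ((memLp_flux hp.out hv).sub (memLp_flux hp.out hw))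
    (memLp_diffQuot_rampDiff hε hvm hwm hv hw)

lemma dualPairing_fluxLp_sub [hp : Fact (1 < p)] (hε : 0 < ε) (hvm : Measurable v)
    (hwm : Measurable w) (hv : MemLp (diffQuot s p v) (ENNReal.ofReal p) volume)
    (hw : MemLp (diffQuot s p w) (ENNReal.ofReal p) volume) :
    dualPairing volume p (fluxLp s p v - fluxLp s p w)
      (memLp_diffQuot_rampDiff hε hvm hwm hv hw).toLp =
      ∫ z, (flux s p v z - flux s p w z) * diffQuot s p (rampDiff ε v w) z := by
  rw [fluxLp_of_memLp (memLp_flux hp.out hv), fluxLp_of_memLp (memLp_flux hp.out hw),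
    ← MemLp.toLp_sub, dualPairing_toLp]
  rfl

end RampDiff

/-- The local energy of a solution at a given time. -/
def energyNorm (s p m : ℝ) (u : ℝ → L1 d) (t : ℝ) : ℝ :=
  (eLpNorm (diffQuot s p (powAt m (extend u) t)) (ENNReal.ofReal p) volume).toReal

/-- The distance of the backward average of the flux from the flux. -/
def averageError (s p m : ℝ) [Fact (1 < p)] (u : ℝ → L1 d) (h t : ℝ) : ℝ :=
  ‖h⁻¹ • (∫ r in (t - h)..t, fluxLp s p (powAt m (extend u) r)) -
    fluxLp s p (powAt m (extend u) t)‖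

/-- The entropy for u₂ is the one for u₁ with arguments exchanged and negated; since signed powers
are odd, its slope is again H_ε(u₁^m(t) - u₂^m(r)). Both weak formulations are therefore tested with
the same function. -/
lemma doubling_increment_le_dualPairing [hp : Fact (1 < p)] (hd : 1 ≤ d) (hs₀ : 0 < s)
    (hs₁ : s < 1) (hm : 0 < m) (hε : 0 < ε) {u₀₁ u₀₂ : L1 d} {u₁ u₂ : ℝ → L1 d}
    (h₁ : IsDistributionalSolution s p m u₀₁ u₁) (h₂ : IsDistributionalSolution s p m u₀₂ u₂)
    {t r h : ℝ} (hh : 0 < h) (ht : h < t) (hr : h < r)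
    (hζ : MemLp (rampDiff ε (powAt m (extend u₁) t) (powAt m (extend u₂) r))
      (ENNReal.ofReal p) volume)
    (hZ : MemLp (diffQuot s p (rampDiff ε (powAt m (extend u₁) t) (powAt m (extend u₂) r)))
      (ENNReal.ofReal p) volume) :
    entropyInt m ε (extend u₁ t) (extend u₂ r) - entropyInt m ε (extend u₁ (t - h)) (extend u₂ r) +
      (entropyInt m ε (-extend u₂ r) (-extend u₁ t) -
        entropyInt m ε (-extend u₂ (r - h)) (-extend u₁ t)) ≤
      1 / 2 * (dualPairing volume p (∫ τ in (r - h)..r, fluxLp s p (powAt m (extend u₂) τ))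
          hZ.toLp -
        dualPairing volume p (∫ τ in (t - h)..t, fluxLp s p (powAt m (extend u₁) τ)) hZ.toLp) := by
  have hrm := measurable_rampDiff (ε := ε) (measurable_powAt (extend u₁) hm t)
    (measurable_powAt (extend u₂) hm r)
  have w₁ := h₁.weak_increment hd hs₀ hs₁ hm (sub_pos.2 ht) (hh.trans ht) hrm
    (fun x => abs_ramp_le_one _ _) hζ hZ
  have w₂ := h₂.weak_increment hd hs₀ hs₁ hm (sub_pos.2 hr) (hh.trans hr) hrm
    (fun x => abs_ramp_le_one _ _) hζ hZ
  rw [← extend_of_nonneg u₁ (hh.trans ht).le, ← extend_of_nonneg u₁ (sub_pos.2 ht).le] at w₁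
  rw [← extend_of_nonneg u₂ (hh.trans hr).le, ← extend_of_nonneg u₂ (sub_pos.2 hr).le] at w₂
  have i₁ : entropyInt m ε (extend u₁ t) (extend u₂ r) -
      entropyInt m ε (extend u₁ (t - h)) (extend u₂ r) ≤
      ∫ x, (extend u₁ t - extend u₁ (t - h) : L1 d) x *
        rampDiff ε (powAt m (extend u₁) t) (powAt m (extend u₂) r) x :=
    entropyInt_sub_le hm hε _ _ _
  have i₂ : entropyInt m ε (-extend u₂ r) (-extend u₁ t) -
      entropyInt m ε (-extend u₂ (r - h)) (-extend u₁ t) ≤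
      -∫ x, (extend u₂ r - extend u₂ (r - h) : L1 d) x *
        rampDiff ε (powAt m (extend u₁) t) (powAt m (extend u₂) r) x := by
    refine (entropyInt_sub_le hm hε _ _ _).trans_eq ?_
    rw [← integral_neg]
    refine integral_congr_ae ?_
    filter_upwards [Lp.coeFn_neg (extend u₂ r), Lp.coeFn_neg (extend u₁ t),
      Lp.coeFn_neg (extend u₂ r - extend u₂ (r - h))] with x e1 e2 e3
    have e4 : -extend u₂ r - -extend u₂ (r - h) = -(extend u₂ r - extend u₂ (r - h)) := by abel
    rw [e4, e3, e1, e2, Pi.neg_apply, Pi.neg_apply, Pi.neg_apply, spow_neg, spow_neg,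
      neg_sub_neg, neg_mul]
    rfl
  rw [w₁] at i₁
  rw [w₂] at i₂
  linarith

lemma dualPairing_eq_add {α : Type*} [MeasurableSpace α] {μ : Measure α} [Fact (1 < p)] {h : ℝ}
    (hh : 0 < h) (I A : Lp ℝ (ENNReal.ofReal p.conjExponent) μ) (Z : Lp ℝ (ENNReal.ofReal p) μ) :
    dualPairing μ p I Z = h * dualPairing μ p (h⁻¹ • I - A) Z + h * dualPairing μ p A Z := by
  rw [map_sub, map_smul, sub_apply, smul_apply, smul_eq_mul]
  field_simp
  ring

/-- Replacing each averaged flux by its value at the current time leaves -(h/2)⟨A₁ - A₂, Z⟩ ≤ 0,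
which is dropped; Hölder bounds what remains. -/
lemma le_of_dualPairing {α : Type*} [MeasurableSpace α] {μ : Measure α} [Fact (1 < p)] {h : ℝ}
    (hh : 0 < h) {A₁ A₂ I₁ I₂ : Lp ℝ (ENNReal.ofReal p.conjExponent) μ}
    {Z : Lp ℝ (ENNReal.ofReal p) μ} {N X : ℝ} (hZ : ‖Z‖ ≤ N)
    (hnn : 0 ≤ dualPairing μ p (A₁ - A₂) Z)
    (hX : X ≤ 1 / 2 * (dualPairing μ p I₂ Z - dualPairing μ p I₁ Z)) :
    X ≤ h * (1 / 2 * ((‖h⁻¹ • I₁ - A₁‖ + ‖h⁻¹ • I₂ - A₂‖) * N)) := by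
  rw [dualPairing_eq_add hh I₁ A₁, dualPairing_eq_add hh I₂ A₂] at hX
  rw [map_sub, sub_apply] at hnn
  have b₁ := neg_le_of_abs_le (abs_dualPairing_le (h⁻¹ • I₁ - A₁) Z)
  have b₂ := le_of_abs_le (abs_dualPairing_le (h⁻¹ • I₂ - A₂) Z)
  have b₃ := mul_le_mul_of_nonneg_left hZ
    (add_nonneg (norm_nonneg (h⁻¹ • I₁ - A₁)) (norm_nonneg (h⁻¹ • I₂ - A₂)))
  refine hX.trans ?_
  rw [← mul_add, ← mul_add, ← mul_sub, mul_left_comm]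
  refine mul_le_mul_of_nonneg_left ?_ hh.le
  linarith

lemma doubling_increment [hp : Fact (1 < p)] (hd : 1 ≤ d) (hs₀ : 0 < s) (hs₁ : s < 1)
    (hm : 0 < m) (hε : 0 < ε) {u₀₁ u₀₂ : L1 d} {u₁ u₂ : ℝ → L1 d}
    (h₁ : IsDistributionalSolution s p m u₀₁ u₁) (h₂ : IsDistributionalSolution s p m u₀₂ u₂)
    {t r h : ℝ} (hh : 0 < h) (ht : h < t) (hr : h < r)
    (hg₁ : MemLp (powAt m (extend u₁) t) (ENNReal.ofReal p) volume ∧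
      MemLp (diffQuot s p (powAt m (extend u₁) t)) (ENNReal.ofReal p) volume)
    (hg₂ : MemLp (powAt m (extend u₂) r) (ENNReal.ofReal p) volume ∧
      MemLp (diffQuot s p (powAt m (extend u₂) r)) (ENNReal.ofReal p) volume) :
    entropyInt m ε (extend u₁ t) (extend u₂ r) - entropyInt m ε (extend u₁ (t - h)) (extend u₂ r) +
      (entropyInt m ε (-extend u₂ r) (-extend u₁ t) -
        entropyInt m ε (-extend u₂ (r - h)) (-extend u₁ t)) ≤
      h * (1 / (2 * ε) * ((averageError s p m u₁ h t + averageError s p m u₂ h r) *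
        (energyNorm s p m u₁ t + energyNorm s p m u₂ r))) := by
  have hvm := measurable_powAt (extend u₁) hm t
  have hwm := measurable_powAt (extend u₂) hm r
  have hZ := memLp_diffQuot_rampDiff hε hvm hwm hg₁.2 hg₂.2
  have hN := norm_toLp_diffQuot_rampDiff_le hε hvm hwm hg₁.2 hg₂.2
  have hnn : 0 ≤ dualPairing volume p (fluxLp s p (powAt m (extend u₁) t) -
      fluxLp s p (powAt m (extend u₂) r)) hZ.toLp := by
    rw [dualPairing_fluxLp_sub hε hvm hwm hg₁.2 hg₂.2]
    exact integral_nonneg fun z => flux_sub_mul_diffQuot_rampDiff_nonneg hp.out hε z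
  have i₁ := le_of_dualPairing hh hN hnn (doubling_increment_le_dualPairing hd hs₀ hs₁ hm hε h₁ h₂
    hh ht hr (memLp_rampDiff hε hvm hwm hg₁.1 hg₂.1) hZ)
  refine i₁.trans_eq ?_
  rw [averageError, averageError, energyNorm, energyNorm]
  field_simp

end

/-! ### The doubled-time inequality on rectangles -/

section

variable {d : ℕ} {s p m ε : ℝ}

namespace IsDistributionalSolution

variable {u₀ : L1 d} {u : ℝ → L1 d} {a b : ℝ}

lemma memLp_averageError [hp : Fact (1 < p)] (hm : 0 < m)
    (hu : IsDistributionalSolution s p m u₀ u) (ha : 0 < a) (hab : a < b) {h : ℝ} (hh0 : 0 < h)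
    (hh : h < a / 2) :
    MemLp (averageError s p m u h) (ENNReal.ofReal p.conjExponent)
      (volume.restrict (Icc a b)) :=
  memLp_average_sub (F := fun t => fluxLp s p (powAt m (extend u) t)) (a' := a / 2)
    (Real.HolderConjugate.conjExponent hp.out).symm.lt (by linarith) hab
    (hu.memLp_fluxLp hm (half_pos ha) (by linarith)) (by linarith) hh0

lemma memLp_energyNorm [hp : Fact (1 < p)] (hm : 0 < m)
    (hu : IsDistributionalSolution s p m u₀ u) (ha : 0 < a) (hab : a < b) :
    MemLp (energyNorm s p m u) (ENNReal.ofReal p) (volume.restrict (Icc a b)) :=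
  hu.memLp_eLpNorm_diffQuot hm ha hab

lemma tendsto_integral_averageError_mul [hp : Fact (1 < p)] (hm : 0 < m)
    (hu : IsDistributionalSolution s p m u₀ u) (ha : 0 < a) (hab : a < b) {w : ℝ → ℝ}
    (hw : MemLp w (ENNReal.ofReal p) (volume.restrict (Icc a b))) :
    Tendsto (fun h => ∫ t in Icc a b, averageError s p m u h t * w t) (𝓝[>] 0) (𝓝 0) :=
  tendsto_integral_average_sub_mul (F := fun t => fluxLp s p (powAt m (extend u) t))
    (stronglyMeasurable_fluxLp hm hu.continuous_extend) (half_lt_self ha)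
    (hu.memLp_fluxLp hm (half_pos ha) (by linarith)) hw

lemma tendsto_integral_averageError [hp : Fact (1 < p)] (hm : 0 < m)
    (hu : IsDistributionalSolution s p m u₀ u) (ha : 0 < a) (hab : a < b) :
    Tendsto (fun h => ∫ t in Icc a b, averageError s p m u h t) (𝓝[>] 0) (𝓝 0) := by
  simpa only [mul_one] using
    hu.tendsto_integral_averageError_mul hm ha hab (w := fun _ => 1) (memLp_const 1)

end IsDistributionalSolution

section Doubling

variable {u₀₁ u₀₂ : L1 d} {u₁ u₂ : ℝ → L1 d} {a b c e : ℝ}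

lemma entropyInt_rectangle [hp : Fact (1 < p)] (hd : 1 ≤ d) (hs₀ : 0 < s) (hs₁ : s < 1)
    (hm : 0 < m) (hε : 0 < ε) (h₁ : IsDistributionalSolution s p m u₀₁ u₁)
    (h₂ : IsDistributionalSolution s p m u₀₂ u₂) (ha : 0 < a) (hab : a < b) (hc : 0 < c)
    (hce : c < e) :
    (∫ r in Icc c e, (entropyInt m ε (extend u₁ b) (extend u₂ r) -
        entropyInt m ε (extend u₁ a) (extend u₂ r))) +
      ∫ t in Icc a b, (entropyInt m ε (-extend u₂ e) (-extend u₁ t) -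
        entropyInt m ε (-extend u₂ c) (-extend u₁ t)) ≤ 0 := by
  have hU₁ := h₁.continuous_extend
  have hU₂ := h₂.continuous_extend
  have hp1 : (1 : ℝ≥0∞) ≤ ENNReal.ofReal p := Fact.out
  have hq1 : (1 : ℝ≥0∞) ≤ ENNReal.ofReal p.conjExponent := Fact.out
  -- Backward windows of this length stay in [a/2, b] and [c/2, e], away from time 0, where the flux
  -- is known to be integrable.
  have hh₀ : 0 < min a c / 2 := half_pos (lt_min ha hc)
  have hha : ∀ {h}, h ∈ Ioo 0 (min a c / 2) → h < a / 2 := fun hh =>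
    hh.2.trans_le (by linarith [min_le_left a c])
  have hhc : ∀ {h}, h ∈ Ioo 0 (min a c / 2) → h < c / 2 := fun hh =>
    hh.2.trans_le (by linarith [min_le_right a c])
  have hN₁ := h₁.memLp_energyNorm hm ha hab
  have hN₂ := h₂.memLp_energyNorm hm hc hce
  refine rectangle_of_increment (U₁ := extend u₁) (U₂ := extend u₂)
    (G₁ := fun t r => entropyInt m ε (extend u₁ t) (extend u₂ r))
    (G₂ := fun t r => entropyInt m ε (-extend u₂ r) (-extend u₁ t)) hU₁ hU₂
    (measurable_entropyInt hm hε (A := fun z : ℝ × ℝ => extend u₁ z.1)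
      (B := fun z : ℝ × ℝ => extend u₂ z.2) (hU₁.comp continuous_fst) (hU₂.comp continuous_snd))
    (measurable_entropyInt hm hε (A := fun z : ℝ × ℝ => -extend u₂ z.2)
      (B := fun z : ℝ × ℝ => -extend u₁ z.1) (hU₂.comp continuous_snd).neg
      (hU₁.comp continuous_fst).neg)
    (fun t r => ?_) (fun t r => ?_) (fun t t' r => abs_entropyInt_sub_le hm hε _ _ _)
    (fun t r r' => ?_) (K := 1 / (2 * ε)) (δ₁ := averageError s p m u₁)
    (δ₂ := averageError s p m u₂) (N₁ := energyNorm s p m u₁) (N₂ := energyNorm s p m u₂)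
    hab.le hce.le hh₀
    (fun h hh => (h₁.memLp_averageError hm ha hab hh.1 (hha hh)).integrable hq1)
    (fun h hh => (h₂.memLp_averageError hm hc hce hh.1 (hhc hh)).integrable hq1)
    (hN₁.integrable hp1) (hN₂.integrable hp1)
    (fun h hh => integrable_mul_of_conj (h₁.memLp_averageError hm ha hab hh.1 (hha hh)) hN₁)
    (fun h hh => integrable_mul_of_conj (h₂.memLp_averageError hm hc hce hh.1 (hhc hh)) hN₂)
    (h₁.tendsto_integral_averageError hm ha hab) (h₂.tendsto_integral_averageError hm hc hce)
    (h₁.tendsto_integral_averageError_mul hm ha hab hN₁)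
    (h₂.tendsto_integral_averageError_mul hm hc hce hN₂) fun h hh => ?_
  · rw [abs_of_nonneg (entropyInt_nonneg hm hε _ _)]
    exact entropyInt_le hm hε _ _
  · rw [abs_of_nonneg (entropyInt_nonneg hm hε _ _)]
    refine (entropyInt_le hm hε _ _).trans_eq ?_
    rw [neg_sub_neg]
  · refine (abs_entropyInt_sub_le hm hε _ _ _).trans_eq ?_
    rw [neg_sub_neg, norm_sub_rev]
  · have m₁ := Measure.quasiMeasurePreserving_fst (μ := volume.restrict (Icc a b))
      (ν := volume.restrict (Icc c e)) |>.ae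
      ((ae_restrict_mem measurableSet_Icc).and (ae_restrict_of_ae (h₁.ae_memLp hp.out)))
    have m₂ := Measure.quasiMeasurePreserving_snd (μ := volume.restrict (Icc a b))
      (ν := volume.restrict (Icc c e)) |>.ae
      ((ae_restrict_mem measurableSet_Icc).and (ae_restrict_of_ae (h₂.ae_memLp hp.out)))
    filter_upwards [m₁, m₂] with z hz₁ hz₂
    have hta := hha hh
    have htc := hhc hh
    exact doubling_increment hd hs₀ hs₁ hm hε h₁ h₂ hh.1 (by linarith [hz₁.1.1])
      (by linarith [hz₂.1.1]) (hz₁.2 (ha.trans_le hz₁.1.1)) (hz₂.2 (hc.trans_le hz₂.1.1))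

lemma tendsto_integral_entropyInt_sub (hm : 0 < m) {ε : ℕ → ℝ} (hε : ∀ n, 0 < ε n)
    (h0 : Tendsto ε atTop (𝓝 0)) {A B : ℝ → L1 d} (hA : Continuous A) (hB : Continuous B)
    {C : ℝ → L1 d} (hC : Continuous C) (a b : ℝ) :
    Tendsto (fun n => ∫ t in Icc a b, (entropyInt m (ε n) (A t) (C t) -
      entropyInt m (ε n) (B t) (C t))) atTop
      (𝓝 (∫ t in Icc a b, (‖(A t - C t)⁺‖ - ‖(B t - C t)⁺‖))) := by
  refine tendsto_integral_of_dominated_convergence (fun t => ‖A t - B t‖) (fun n =>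
    ((measurable_entropyInt hm (hε n) hA hC).sub
      (measurable_entropyInt hm (hε n) hB hC)).aestronglyMeasurable)
    (Continuous.integrableOn_Icc (by fun_prop))
    (fun n => ae_of_all _ fun t => abs_entropyInt_sub_le hm (hε n) _ _ _)
    (ae_of_all _ fun t => (tendsto_entropyInt hm hε h0 _ _).sub (tendsto_entropyInt hm hε h0 _ _))

/-- The doubled-time inequality for the positive part. -/
lemma posPart_rectangle [hp : Fact (1 < p)] (hd : 1 ≤ d) (hs₀ : 0 < s) (hs₁ : s < 1)
    (hm : 0 < m) (h₁ : IsDistributionalSolution s p m u₀₁ u₁)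
    (h₂ : IsDistributionalSolution s p m u₀₂ u₂) (ha : 0 < a) (hab : a < b) (hc : 0 < c)
    (hce : c < e) :
    (∫ r in Icc c e, (‖(extend u₁ b - extend u₂ r)⁺‖ - ‖(extend u₁ a - extend u₂ r)⁺‖)) +
      ∫ t in Icc a b, (‖(extend u₁ t - extend u₂ e)⁺‖ - ‖(extend u₁ t - extend u₂ c)⁺‖) ≤ 0 := by
  have h0 : Tendsto (fun n : ℕ => 1 / ((n : ℝ) + 1)) atTop (𝓝 0) :=
    tendsto_one_div_add_atTop_nhds_zero_nat
  have hε : ∀ n : ℕ, 0 < 1 / ((n : ℝ) + 1) := fun n => Nat.one_div_pos_of_nat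
  have hU₁ := h₁.continuous_extend
  have hU₂ := h₂.continuous_extend
  have l₁ := tendsto_integral_entropyInt_sub hm hε h0 (A := fun _ => extend u₁ b)
    (B := fun _ => extend u₁ a) continuous_const continuous_const hU₂ c e
  have l₂ := tendsto_integral_entropyInt_sub hm hε h0 (A := fun _ => -extend u₂ e)
    (B := fun _ => -extend u₂ c) (C := fun t => -extend u₁ t) continuous_const continuous_const hU₁.neg a b
  -- The two entropies may differ for ε > 0 but share the limit ‖(u₁ - u₂)⁺‖.
  simp only [neg_sub_neg] at l₂
  exact le_of_tendsto' (l₁.add l₂) fun n =>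
    entropyInt_rectangle hd hs₀ hs₁ hm (hε n) h₁ h₂ ha hab hc hce

end Doubling

end

/-! ### Return to the diagonal and L¹ monotonicity -/

section

/-- A continuous function with nonpositive divergence on the squares centred on the diagonal is
antitone along the diagonal. -/
lemma diagonal_le_of_square {G : ℝ → ℝ → ℝ} (hG : Continuous (Function.uncurry G))
    (hR : ∀ a b, 0 < a → a < b →
      (∫ r in Icc a b, (G b r - G a r)) + ∫ t in Icc a b, (G t b - G t a) ≤ 0)
    {t T : ℝ} (ht : 0 < t) (htT : t ≤ T) : G T T ≤ G t t := by
  have hG' : ∀ {X : Type} [TopologicalSpace X] {f g : X → ℝ}, Continuous f → Continuous g →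
      Continuous fun x => G (f x) (g x) := fun hf hg => hG.comp (hf.prodMk hg)
  -- The sum of G over the two points at offset y on either side of the diagonal. The near sides of
  -- the square at r carry H(y, r) and the far sides H(y, r + (δ - y)), for y ∈ [0, δ].
  set H : ℝ → ℝ → ℝ := fun y r => G (r + y) r + G r (r + y) with hH
  have hHc : ∀ {X : Type} [TopologicalSpace X] {f g : X → ℝ}, Continuous f → Continuous g →
      Continuous fun x => H (f x) (g x) := fun hf hg =>
    (hG' (hg.add hf) hg).add (hG' hg (hg.add hf))
  have hsq : ∀ δ r, 0 < δ → 0 < r → ∫ y in Icc 0 δ, (H y (r + (δ - y)) - H y r) ≤ 0 := by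
    intro δ r hδ hr
    have h0 := hR r (r + δ) hr (by linarith)
    have i : ∀ {f g : ℝ → ℝ}, Continuous f → Continuous g → ∀ a b,
      IntervalIntegrable (fun x => G (f x) (g x)) volume a b := fun hf hg a b =>
      (hG' hf hg).intervalIntegrable a b
    rw [integral_Icc_eq_integral_Ioc, integral_Icc_eq_integral_Ioc,
      ← intervalIntegral.integral_of_le (by linarith),
      ← intervalIntegral.integral_of_le (by linarith),
      intervalIntegral.integral_sub (i (by fun_prop) (by fun_prop) _ _)
        (i (by fun_prop) (by fun_prop) _ _),
      intervalIntegral.integral_sub (i (by fun_prop) (by fun_prop) _ _)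
        (i (by fun_prop) (by fun_prop) _ _)] at h0
    rw [integral_Icc_eq_integral_Ioc, ← intervalIntegral.integral_of_le hδ.le,
      intervalIntegral.integral_sub
        ((hHc (by fun_prop) (by fun_prop)).intervalIntegrable _ _)
        ((hHc (by fun_prop) (by fun_prop)).intervalIntegrable _ _)]
    simp only [hH]
    rw [intervalIntegral.integral_add (i (by fun_prop) (by fun_prop) _ _)
        (i (by fun_prop) (by fun_prop) _ _),
      intervalIntegral.integral_add (i (by fun_prop) (by fun_prop) _ _)
        (i (by fun_prop) (by fun_prop) _ _)]
    have e1 := intervalIntegral.integral_comp_sub_left (a := 0) (b := δ) (fun x => G (r + δ) x)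
      (r + δ)
    have e2 := intervalIntegral.integral_comp_sub_left (a := 0) (b := δ) (fun x => G x (r + δ))
      (r + δ)
    have e3 := intervalIntegral.integral_comp_add_left (a := 0) (b := δ) (fun x => G x r) r
    have e4 := intervalIntegral.integral_comp_add_left (a := 0) (b := δ) (fun x => G r x) r
    simp only [add_sub_cancel_right, sub_zero, add_zero] at e1 e2 e3 e4
    have e5 : ∀ y : ℝ, r + (δ - y) = r + δ - y := fun y => by ring
    simp only [e5, sub_add_cancel]
    linarith
  refine le_of_forall_pos_le_add fun κ' hκ' => ?_
  -- The final estimate reads 2(G(T,T) - G(t,t)) ≤ 12κ.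
  set κ := κ' / 6 with hκdef
  have hκ : 0 < κ := by positivity
  have hnear : ∀ τ, ∀ᶠ δ in 𝓝[>] (0 : ℝ), ∀ x ∈ Icc τ (τ + 2 * δ), ∀ y ∈ Icc τ (τ + 2 * δ),
      |G x y - G τ τ| ≤ κ := by
    intro τ
    obtain ⟨ρ, hρ, hρ'⟩ := Metric.continuousAt_iff.1 (hG.continuousAt (x := (τ, τ))) κ hκ
    filter_upwards [Ioo_mem_nhdsGT (half_pos hρ)] with δ hδ x hx y hy
    refine (hρ' (x := (x, y)) (max_lt ?_ ?_)).le
    · simp only [Real.dist_eq]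
      rw [abs_of_nonneg (by linarith [hx.1])]
      linarith [hx.2, hδ.2]
    · simp only [Real.dist_eq]
      rw [abs_of_nonneg (by linarith [hy.1])]
      linarith [hy.2, hδ.2]
  obtain ⟨δ, hδ, nt, nT⟩ := 
    ((eventually_mem_nhdsWithin (a := (0 : ℝ)) (s := Ioi 0)).and ((hnear t).and (hnear T))).exists
  have hδ : 0 < δ := hδ
  have hHn : ∀ {τ}, (∀ x ∈ Icc τ (τ + 2 * δ), ∀ y ∈ Icc τ (τ + 2 * δ), |G x y - G τ τ| ≤ κ) →
      ∀ y ∈ Icc 0 δ, ∀ r ∈ Icc τ (τ + δ), |H y r - 2 * G τ τ| ≤ 2 * κ := by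
    intro τ h y hy r hr
    have m1 : r + y ∈ Icc τ (τ + 2 * δ) := ⟨by linarith [hr.1, hy.1], by linarith [hr.2, hy.2]⟩
    have m2 : r ∈ Icc τ (τ + 2 * δ) := ⟨hr.1, by linarith [hr.2]⟩
    have := abs_le.1 (h _ m1 _ m2)
    have := abs_le.1 (h _ m2 _ m1)
    rw [abs_le]
    constructor <;> simp only [hH] <;> linarith
  have hint : Integrable (Function.uncurry fun y r => H y (r + (δ - y)) - H y r)
      ((volume.restrict (Icc 0 δ)).prod (volume.restrict (Icc t T))) := by
    rw [Measure.prod_restrict]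
    refine ContinuousOn.integrableOn_compact (isCompact_Icc.prod isCompact_Icc)
      (Continuous.continuousOn ?_)
    exact (hHc (f := fun z : ℝ × ℝ => z.1) (g := fun z => z.2 + (δ - z.1)) (by fun_prop)
      (by fun_prop)).sub (hHc (f := fun z : ℝ × ℝ => z.1) (g := fun z => z.2) (by fun_prop)
      (by fun_prop))
  have hle : ∫ y in Icc 0 δ, ∫ r in Icc t T, (H y (r + (δ - y)) - H y r) ≤ 0 := by
    rw [integral_integral_swap hint]
    exact setIntegral_nonpos measurableSet_Icc fun r hr => hsq δ r hδ (ht.trans_le hr.1)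
  -- For fixed y the integral in r telescopes with step δ - y. Two values of H near an endpoint
  -- differ by at most 4κ, costing 8κ in total; comparing H with 2G at both ends costs another 4κ.
  have hge : ∀ y ∈ Icc 0 δ, (δ - y) * (2 * (G T T - G t t) - 12 * κ) ≤
      ∫ r in Icc t T, (H y (r + (δ - y)) - H y r) := by
    intro y hy
    rcases hy.2.eq_or_lt with rfl | hlt
    · simp
    have hb := hHn nT y hy
    have ha := hHn nt y hy
    have mem : ∀ {τ x}, x ∈ Icc (τ - (δ - y)) τ → x + (δ - y) ∈ Icc τ (τ + δ) := fun hx =>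
      ⟨by linarith [hx.1], by linarith [hx.2, hy.1]⟩
    have me : ∀ {τ}, τ ∈ Icc (τ - (δ - y)) τ := ⟨by linarith, le_rfl⟩
    have key := le_integral_sub_translate (L := fun r => H y (r + (δ - y))) (κ := 4 * κ) htT
      (sub_pos.2 hlt) (hHc continuous_const (by fun_prop)) (fun x hx => ?_) fun x hx => ?_
    · simp only [sub_add_cancel] at key
      refine le_trans (mul_le_mul_of_nonneg_left ?_ (sub_pos.2 hlt).le) key
      have := abs_le.1 (hb _ (mem me))
      have := abs_le.1 (ha _ (mem me))
      linarith
    · have := abs_le.1 (hb _ (mem hx))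
      have := abs_le.1 (hb _ (mem me))
      rw [abs_le]
      constructor <;> linarith
    · have := abs_le.1 (ha _ (mem hx))
      have := abs_le.1 (ha _ (mem me))
      rw [abs_le]
      constructor <;> linarith
  have hfin := setIntegral_mono_on
    (Continuous.integrableOn_Icc (by fun_prop)) hint.integral_prod_left measurableSet_Icc hge
  rw [integral_mul_const] at hfin
  have hval : ∫ y in Icc 0 δ, (δ - y) = δ ^ 2 / 2 := by
    rw [integral_Icc_eq_integral_Ioc, ← intervalIntegral.integral_of_le hδ.le,
      intervalIntegral.integral_comp_sub_left (fun x => x) δ, integral_id]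
    ring
  rw [hval] at hfin
  have hneg := hfin.trans hle
  have : 2 * (G T T - G t t) - 12 * κ ≤ 0 := by
    by_contra! hcon
    have : 0 < δ ^ 2 / 2 * (2 * (G T T - G t t) - 12 * κ) := by positivity
    linarith
  linarith

variable {d : ℕ} {s p m : ℝ}

/-- The L¹ comparison principle. Differentiability in time plays no role, so it holds for all
distributional solutions. -/
lemma antitoneOn_norm_posPart [hp : Fact (1 < p)] (hd : 1 ≤ d) (hs₀ : 0 < s) (hs₁ : s < 1)
    (hm : 0 < m) {u₀₁ u₀₂ : L1 d} {u₁ u₂ : ℝ → L1 d}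
    (h₁ : IsDistributionalSolution s p m u₀₁ u₁) (h₂ : IsDistributionalSolution s p m u₀₂ u₂) :
    AntitoneOn (fun t => ‖(extend u₁ t - extend u₂ t)⁺‖) (Ioi 0) := by
  have hU₁ := h₁.continuous_extend
  have hU₂ := h₂.continuous_extend
  have hpos : Continuous fun A : L1 d => ‖A⁺‖ := continuous_posPart.norm
  intro t ht T hT htT
  refine diagonal_le_of_square (G := fun t r => ‖(extend u₁ t - extend u₂ r)⁺‖)
    (hpos.comp (f := fun z : ℝ × ℝ => extend u₁ z.1 - extend u₂ z.2) (by fun_prop))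
    (fun a b ha hab => posPart_rectangle hd hs₀ hs₁ hm h₁ h₂ ha hab ha hab) ht htT

end

/-! ### Time derivatives at a fixed time -/

section

variable {d : ℕ} {s p m : ℝ}

lemma exists_continuousLinearMap_integral_mul {ζ : Space d → ℝ} (hζ : Measurable ζ) {C : ℝ}
    (hbd : ∀ x, |ζ x| ≤ C) : ∃ ℓ : L1 d →L[ℝ] ℝ, ∀ A : L1 d, ℓ A = ∫ x, A x * ζ x := by
  have hi : ∀ A : L1 d, Integrable (fun x => A x * ζ x) volume := fun A =>
    (L1.integrable_coeFn A).mul_bdd (c := C) hζ.aestronglyMeasurable (ae_of_all _ hbd)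
  let ℓ : L1 d →ₗ[ℝ] ℝ :=
    { toFun := fun A => ∫ x, A x * ζ x
      map_add' := fun A B => by
        rw [← integral_add (hi A) (hi B)]
        refine integral_congr_ae ?_
        filter_upwards [Lp.coeFn_add A B] with x hx
        rw [hx, Pi.add_apply, add_mul]
      map_smul' := fun c A => by
        rw [RingHom.id_apply, smul_eq_mul, ← integral_const_mul]
        refine integral_congr_ae ?_
        filter_upwards [Lp.coeFn_smul c A] with x hx
        rw [hx, Pi.smul_apply, smul_eq_mul, mul_assoc] }
  refine ⟨ℓ.mkContinuous C fun A => ?_, fun A => rfl⟩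
  rw [norm_eq_integral_abs, ← integral_const_mul]
  refine (norm_integral_le_integral_norm _).trans (integral_mono_ae (hi A).norm
    ((L1.integrable_coeFn A).abs.const_mul C) (ae_of_all _ fun x => ?_))
  simp only [norm_mul, Real.norm_eq_abs]
  rw [mul_comm]
  exact mul_le_mul_of_nonneg_right (hbd x) (abs_nonneg _)

/-- The weak increment equates two scalar functions of the upper time near t; both are
differentiable there, so their derivatives agree. -/
lemma IsDistributionalSolution.integral_deriv_mul [hp : Fact (1 < p)] (hd : 1 ≤ d) (hs₀ : 0 < s)
    (hs₁ : s < 1) (hm : 0 < m) {u₀ : L1 d} {u : ℝ → L1 d}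
    (hu : IsDistributionalSolution s p m u₀ u) {a t : ℝ} (ha : 0 < a) (ht : 0 < t) {u' : L1 d}
    (hu' : HasDerivAt (extend u) u' t)
    (hF : HasDerivAt (fun b => ∫ τ in a..b, fluxLp s p (powAt m (extend u) τ))
      (fluxLp s p (powAt m (extend u) t)) t)
    {ζ : Space d → ℝ} (hζm : Measurable ζ) {C : ℝ} (hbd : ∀ x, |ζ x| ≤ C)
    (hζ : MemLp ζ (ENNReal.ofReal p) volume)
    (hZ : MemLp (diffQuot s p ζ) (ENNReal.ofReal p) volume) :
    ∫ x, u' x * ζ x =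
      -(1 / 2) * dualPairing volume p (fluxLp s p (powAt m (extend u) t)) hZ.toLp := by
  obtain ⟨ℓ, hℓ⟩ := exists_continuousLinearMap_integral_mul hζm hbd
  set D := (dualPairing volume p).flip hZ.toLp with hD
  have d1 : HasDerivAt (fun b => ℓ (extend u b)) (ℓ u') t := ℓ.hasFDerivAt.comp_hasDerivAt t hu'
  have d2 : HasDerivAt (fun b => D (∫ τ in a..b, fluxLp s p (powAt m (extend u) τ)))
      (D (fluxLp s p (powAt m (extend u) t))) t := D.hasFDerivAt.comp_hasDerivAt t hF
  have d3 := (d2.const_mul (-(1 / 2))).add_const (ℓ (extend u a))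
  have heq : (fun b => ℓ (extend u b)) =ᶠ[𝓝 t] fun b =>
      -(1 / 2) * D (∫ τ in a..b, fluxLp s p (powAt m (extend u) τ)) + ℓ (extend u a) := by
    filter_upwards [Ioi_mem_nhds ht] with b hb
    have := hu.weak_increment hd hs₀ hs₁ hm ha hb hζm hbd hζ hZ
    rw [← hℓ, map_sub, ← extend_of_nonneg u ha.le, ← extend_of_nonneg u (le_of_lt hb)] at this
    rw [hD, ContinuousLinearMap.flip_apply, ← this, sub_add_cancel]
  rw [← hℓ, d1.unique (d3.congr_of_eventuallyEq heq)]
  rfl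

/-- The derivative of the `L¹` norm of the positive part. -/
lemma hasDerivAt_norm_posPart_eq {w : ℝ → L1 d} {t c : ℝ} {w' : L1 d} (hw : HasDerivAt w w' t)
    (hφ : HasDerivAt (fun r => ‖(w r)⁺‖) c t) :
    c = ∫ x, w' x * {x | 0 < w t x}.indicator 1 x := by
  have hS : MeasurableSet {x | 0 < w t x} :=
    measurableSet_lt measurable_const (Lp.stronglyMeasurable (w t)).measurable
  have hbd : ∀ x, |{x | 0 < w t x}.indicator (1 : Space d → ℝ) x| ≤ 1 := fun x => by
    by_cases hx : x ∈ {x | 0 < w t x} <;> simp [hx]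
  have hζ : Measurable ({x | 0 < w t x}.indicator (1 : Space d → ℝ)) :=
    measurable_one.indicator hS
  obtain ⟨ℓ, hℓ⟩ := exists_continuousLinearMap_integral_mul hζ hbd
  have hle : ∀ A : L1 d, ℓ A ≤ ‖A⁺‖ := fun A => by
    rw [hℓ, norm_posPart_eq]
    refine integral_mono ((L1.integrable_coeFn A).mul_bdd (c := 1) hζ.aestronglyMeasurable
      (ae_of_all _ hbd)) (L1.integrable_coeFn A).pos_part fun x => ?_
    by_cases hx : x ∈ {x | 0 < w t x} <;> simp [hx]
  have heq : ℓ (w t) = ‖(w t)⁺‖ := by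
    rw [hℓ, norm_posPart_eq]
    congr 1 with x
    by_cases hx : 0 < w t x
    · simp [hx, hx.le]
    · simp [hx, not_lt.1 hx]
  -- ℓ is a supporting functional of A ↦ ‖A⁺‖ at w(t): it lies below everywhere and touches at r =
  -- t. The difference is minimal there and its derivative vanishes, so no chain rule for the
  -- positive part is needed.
  have hmin : IsLocalMin (fun r => ‖(w r)⁺‖ - ℓ (w r)) t :=
    Eventually.of_forall fun r => by
      simp only [heq, sub_self]
      exact sub_nonneg.2 (hle _)
  have := hmin.hasDerivAt_eq_zero (hφ.sub (ℓ.hasFDerivAt.comp_hasDerivAt t hw))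
  rw [← hℓ]
  linarith

end

/-! ### The dissipation at a fixed time -/

section

variable {d : ℕ} {s p m : ℝ}

section FixedTime

variable {U₁ U₂ : ℝ → L1 d} {t : ℝ}

lemma measurableSet_dissipationDomain : MeasurableSet (dissipationDomain U₁ U₂ t) := by
  have h₁ : Measurable (U₁ t) := (Lp.stronglyMeasurable (U₁ t)).measurable
  have h₂ : Measurable (U₂ t) := (Lp.stronglyMeasurable (U₂ t)).measurable
  have h₁f : Measurable fun z : Space d × Space d => U₁ t z.1 := h₁.comp measurable_fst
  have h₁s : Measurable fun z : Space d × Space d => U₁ t z.2 := h₁.comp measurable_snd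
  have h₂f : Measurable fun z : Space d × Space d => U₂ t z.1 := h₂.comp measurable_fst
  have h₂s : Measurable fun z : Space d × Space d => U₂ t z.2 := h₂.comp measurable_snd
  exact ((measurableSet_lt h₂f h₁f).inter (measurableSet_le h₁s h₂s)).union
    ((measurableSet_le h₁f h₂f).inter (measurableSet_lt h₂s h₁s))

lemma flux_sub_mul_diffQuot {v w ζ : Space d → ℝ} (hs : 0 ≤ s) (hp : 1 < p)
    (z : Space d × Space d) : (flux s p v z - flux s p w z) * diffQuot s p ζ z =
      (spow (v z.1 - v z.2) (p - 1) - spow (w z.1 - w z.2) (p - 1)) * (ζ z.1 - ζ z.2) /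
        ‖z.1 - z.2‖ ^ ((d : ℝ) + s * p) := by
  rw [sub_mul, flux_mul_diffQuot hs hp, flux_mul_diffQuot hs hp, ← sub_div, ← sub_mul]

lemma tendsto_rampDiff (hm : 0 < m) {ε : ℕ → ℝ} (hε : ∀ n, 0 < ε n)
    (h0 : Tendsto ε atTop (𝓝 0)) (x : Space d) :
    Tendsto (fun n => rampDiff (ε n) (powAt m U₁ t) (powAt m U₂ t) x) atTop
      (𝓝 (if U₂ t x < U₁ t x then 1 else 0)) := by
  have := tendsto_ramp hε h0 (powAt m U₁ t x - powAt m U₂ t x)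
  simp only [sub_pos, powAt, (spow_strictMono hm).lt_iff_lt] at this
  exact this

/-- Fatou as ε → 0: on D(t) the ramp increments tend to ±1, with the sign of the flux difference,
which produces the absolute value. The rest of the product space contributes a nonnegative amount
and is dropped. -/
lemma dissipation_le (hs : 0 ≤ s) (hp : 1 < p) (hm : 0 < m) {ε : ℕ → ℝ} (hε : ∀ n, 0 < ε n)
    (h0 : Tendsto ε atTop (𝓝 0)) :
    dissipation s p m U₁ U₂ t ≤ liminf (fun n => ∫⁻ z, ENNReal.ofReal
      ((flux s p (powAt m U₁ t) z - flux s p (powAt m U₂ t) z) *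
        diffQuot s p (rampDiff (ε n) (powAt m U₁ t) (powAt m U₂ t)) z)) atTop := by
  have hvm := measurable_powAt U₁ hm t
  have hwm := measurable_powAt U₂ hm t
  refine le_trans ?_ (lintegral_liminf_le fun n => (((measurable_flux hp hvm).sub
    (measurable_flux hp hwm)).mul (measurable_diffQuot
      (measurable_rampDiff hvm hwm))).ennreal_ofReal)
  rw [dissipation]
  refine (setLIntegral_mono' measurableSet_dissipationDomain fun z hz => ?_).trans
    (setLIntegral_le_lintegral _ _)
  have hl := (((((tendsto_rampDiff (U₁ := U₁) (U₂ := U₂) (t := t) hm hε h0 z.1).sub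
    (tendsto_rampDiff (U₁ := U₁) (U₂ := U₂) (t := t) hm hε h0 z.2)).const_mul
    (spow (powAt m U₁ t z.1 - powAt m U₁ t z.2) (p - 1) -
      spow (powAt m U₂ t z.1 - powAt m U₂ t z.2) (p - 1))).div_const
    (‖z.1 - z.2‖ ^ ((d : ℝ) + s * p))))
  have hl' := (ENNReal.continuous_ofReal.tendsto _).comp hl
  simp only [flux_sub_mul_diffQuot hs hp]
  refine le_trans ?_ hl'.liminf_eq.ge
  refine ENNReal.ofReal_le_ofReal (div_le_div_of_nonneg_right ?_ (by positivity))
  have hmono := (spow_strictMono (sub_pos.2 hp)).monotone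
  have hmono' := (spow_strictMono hm).monotone
  rcases hz with ⟨h1, h2⟩ | ⟨h1, h2⟩
  · rw [if_pos h1, if_neg h2.not_gt, sub_zero, mul_one, abs_of_nonneg]
    exact sub_nonneg.2 (hmono (sub_le_sub (hmono' h1.le) (hmono' h2)))
  · rw [if_neg h1.not_gt, if_pos h2, zero_sub, mul_neg, mul_one, abs_of_nonpos]
    exact sub_nonpos.2 (hmono (sub_le_sub (hmono' h1) (hmono' h2.le)))

/-- On {u₁ > u₂} × {u₁ ≤ u₂}, which has positive product measure and misses the diagonal, strict
monotonicity of both signed powers makes the integrand positive. -/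
lemma dissipation_pos (hp : 1 < p) (hm : 0 < m) (h₁ : 0 < volume {x | U₂ t x < U₁ t x})
    (h₂ : 0 < volume {x | U₁ t x ≤ U₂ t x}) : 0 < dissipation s p m U₁ U₂ t := by
  have hvm := measurable_powAt U₁ hm t
  have hwm := measurable_powAt U₂ hm t
  have hc := (continuous_spow (sub_pos.2 hp)).measurable
  have hmeas : Measurable fun z : Space d × Space d => ENNReal.ofReal
      (|spow (powAt m U₁ t z.1 - powAt m U₁ t z.2) (p - 1)
        - spow (powAt m U₂ t z.1 - powAt m U₂ t z.2) (p - 1)|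
      / ‖z.1 - z.2‖ ^ ((d : ℝ) + s * p)) := by
    have e : ∀ {v : Space d → ℝ}, Measurable v →
        Measurable fun z : Space d × Space d => spow (v z.1 - v z.2) (p - 1) := fun hv =>
      hc.comp ((hv.comp measurable_fst).sub (hv.comp measurable_snd))
    exact (((e hvm).sub (e hwm)).abs.div (by fun_prop)).ennreal_ofReal
  rw [dissipation, setLIntegral_pos_iff hmeas]
  refine lt_of_lt_of_le ?_ (measure_mono (s := {x | U₂ t x < U₁ t x} ×ˢ {x | U₁ t x ≤ U₂ t x})
    fun z hz => ?_)
  · rw [Measure.volume_eq_prod, Measure.prod_prod]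
    exact ENNReal.mul_pos h₁.ne' h₂.ne'
  · obtain ⟨h1, h2⟩ : U₂ t z.1 < U₁ t z.1 ∧ U₁ t z.2 ≤ U₂ t z.2 := hz
    refine ⟨?_, Or.inl ⟨h1, h2⟩⟩
    rw [Function.mem_support, ← pos_iff_ne_zero, ENNReal.ofReal_pos]
    have hne : z.1 ≠ z.2 := fun h => by
      rw [h] at h1
      exact h1.not_ge h2
    have hlt : powAt m U₂ t z.1 - powAt m U₂ t z.2 < powAt m U₁ t z.1 - powAt m U₁ t z.2 := by
      have e₁ : powAt m U₂ t z.1 < powAt m U₁ t z.1 := spow_strictMono hm h1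
      have e₂ : powAt m U₁ t z.2 ≤ powAt m U₂ t z.2 := (spow_strictMono hm).monotone h2
      linarith
    exact div_pos (abs_pos.2 (sub_pos.2 (spow_strictMono (sub_pos.2 hp) hlt)).ne')
      (Real.rpow_pos_of_pos (norm_pos_iff.2 (sub_ne_zero.2 hne)) _)

end FixedTime

lemma dissipation_extend (u₁ u₂ : ℝ → L1 d) {t : ℝ} (ht : 0 ≤ t) :
    dissipation s p m (extend u₁) (extend u₂) t = dissipation s p m u₁ u₂ t := by
  simp only [dissipation, dissipationDomain, powAt_extend _ ht, extend_of_nonneg _ ht]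

/-- At a time of differentiability the dissipation is controlled by the derivative of the norm of
the positive part. -/
lemma dissipation_le_neg_deriv [hp : Fact (1 < p)] (hd : 1 ≤ d) (hs₀ : 0 < s) (hs₁ : s < 1)
    (hm : 0 < m) {u₀₁ u₀₂ : L1 d} {u₁ u₂ : ℝ → L1 d}
    (h₁ : IsDistributionalSolution s p m u₀₁ u₁) (h₂ : IsDistributionalSolution s p m u₀₂ u₂)
    {a t c : ℝ} (ha : 0 < a) (ht : 0 < t) {u₁' u₂' : L1 d}
    (hu₁ : HasDerivAt (extend u₁) u₁' t) (hu₂ : HasDerivAt (extend u₂) u₂' t)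
    (hF₁ : HasDerivAt (fun b => ∫ τ in a..b, fluxLp s p (powAt m (extend u₁) τ))
      (fluxLp s p (powAt m (extend u₁) t)) t)
    (hF₂ : HasDerivAt (fun b => ∫ τ in a..b, fluxLp s p (powAt m (extend u₂) τ))
      (fluxLp s p (powAt m (extend u₂) t)) t)
    (hg₁ : MemLp (powAt m (extend u₁) t) (ENNReal.ofReal p) volume ∧
      MemLp (diffQuot s p (powAt m (extend u₁) t)) (ENNReal.ofReal p) volume)
    (hg₂ : MemLp (powAt m (extend u₂) t) (ENNReal.ofReal p) volume ∧
      MemLp (diffQuot s p (powAt m (extend u₂) t)) (ENNReal.ofReal p) volume)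
    (hφ : HasDerivAt (fun r => ‖(extend u₁ r - extend u₂ r)⁺‖) c t) :
    dissipation s p m u₁ u₂ t ≤ ENNReal.ofReal (-2 * c) := by
  rw [← dissipation_extend u₁ u₂ ht.le]
  have hvm := measurable_powAt (extend u₁) hm t
  have hwm := measurable_powAt (extend u₂) hm t
  set ε : ℕ → ℝ := fun n => 1 / ((n : ℝ) + 1) with hεdef
  have h0 : Tendsto ε atTop (𝓝 0) := tendsto_one_div_add_atTop_nhds_zero_nat
  have hε : ∀ n, 0 < ε n := fun n => Nat.one_div_pos_of_nat
  have hrm : ∀ n, Measurable (rampDiff (ε n) (powAt m (extend u₁) t) (powAt m (extend u₂) t)) :=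
    fun n => measurable_rampDiff hvm hwm
  have hid : ∀ n, -2 * ∫ x, (u₁' - u₂' : L1 d) x *
      rampDiff (ε n) (powAt m (extend u₁) t) (powAt m (extend u₂) t) x =
      ∫ z, (flux s p (powAt m (extend u₁) t) z - flux s p (powAt m (extend u₂) t) z) *
        diffQuot s p (rampDiff (ε n) (powAt m (extend u₁) t) (powAt m (extend u₂) t)) z := by
    intro n
    obtain ⟨ℓ, hℓ⟩ := exists_continuousLinearMap_integral_mul (hrm n) (C := 1)
      fun x => abs_ramp_le_one _ _
    have hζ := memLp_rampDiff (hε n) hvm hwm hg₁.1 hg₂.1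
    have hZ := memLp_diffQuot_rampDiff (hε n) hvm hwm hg₁.2 hg₂.2
    have i₁ := h₁.integral_deriv_mul hd hs₀ hs₁ hm ha ht hu₁ hF₁ (hrm n) (C := 1)
      (fun x => abs_ramp_le_one _ _) hζ hZ
    have i₂ := h₂.integral_deriv_mul hd hs₀ hs₁ hm ha ht hu₂ hF₂ (hrm n) (C := 1)
      (fun x => abs_ramp_le_one _ _) hζ hZ
    rw [← dualPairing_fluxLp_sub (hε n) hvm hwm hg₁.2 hg₂.2, map_sub, sub_apply, ← hℓ, map_sub,
      hℓ, hℓ, i₁, i₂]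
    ring
  have hlim : Tendsto (fun n => ∫ x, (u₁' - u₂' : L1 d) x *
      rampDiff (ε n) (powAt m (extend u₁) t) (powAt m (extend u₂) t) x) atTop (𝓝 c) := by
    rw [hasDerivAt_norm_posPart_eq (hu₁.sub hu₂) hφ]
    refine tendsto_integral_of_dominated_convergence (fun x => |(u₁' - u₂' : L1 d) x|)
      (fun n => (Lp.aestronglyMeasurable _).mul (hrm n).aestronglyMeasurable)
      (L1.integrable_coeFn _).abs (fun n => ae_of_all _ fun x => ?_) ?_
    · rw [norm_mul]
      exact mul_le_of_le_one_right (norm_nonneg _) (abs_ramp_le_one _ _)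
    · filter_upwards [Lp.coeFn_sub (extend u₁ t) (extend u₂ t)] with x hx
      have := (tendsto_rampDiff (U₁ := extend u₁) (U₂ := extend u₂) (t := t) hm hε h0 x).const_mul
        ((u₁' - u₂' : L1 d) x)
      convert this using 2
      simp only [indicator_apply, mem_ofPred_eq, Pi.sub_apply, hx, sub_pos, Pi.one_apply]
  refine (dissipation_le hs₀.le hp.out hm hε h0).trans_eq ?_
  have hl := (ENNReal.continuous_ofReal.tendsto _).comp (hlim.const_mul (-2))
  refine Eq.trans ?_ hl.liminf_eq
  congr 1 with n
  rw [Function.comp_apply, hid, ofReal_integral_eq_lintegral_ofReal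
    (integrable_flux_sub_mul (hε n) hvm hwm hg₁.2 hg₂.2)
    (ae_of_all _ fun z => flux_sub_mul_diffQuot_rampDiff_nonneg hp.out (hε n) z)]

end

/-! ### Integration in time -/

section

variable {d : ℕ} {s p m : ℝ}

/-- Collects the good times: differentiability in L¹, Lebesgue differentiation of the Bochner
primitive of the flux, and spatial regularity. -/
lemma IsStrongDistributionalSolution.ae_hasDerivAt [hp : Fact (1 < p)] (hm : 0 < m) {u₀ : L1 d}
    {u : ℝ → L1 d} (hu : IsStrongDistributionalSolution s p m u₀ u) {a b : ℝ} (ha : 0 < a)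
    (hab : a ≤ b) : ∀ᵐ t : ℝ, t ∈ Icc a b → HasDerivAt (extend u) (deriv (extend u) t) t ∧
      HasDerivAt (fun b => ∫ τ in a..b, fluxLp s p (powAt m (extend u) τ))
        (fluxLp s p (powAt m (extend u) t)) t ∧
      MemLp (powAt m (extend u) t) (ENNReal.ofReal p) volume ∧
      MemLp (diffQuot s p (powAt m (extend u) t)) (ENNReal.ofReal p) volume := by
  have hi := hu.intervalIntegrable_fluxLp hm ha (ha.trans_le hab)
  filter_upwards [hu.differentiable, hi.ae_hasDerivAt_integral, hu.ae_memLp hp.out]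
    with t h1 h2 h3 ht
  have ht0 : 0 < t := ha.trans_le ht.1
  rw [uIcc_of_le hab] at h2
  refine ⟨DifferentiableAt.hasDerivAt ?_, h2 ht a (left_mem_Icc.2 hab), h3 ht0⟩
  refine (h1 ht0).congr_of_eventuallyEq ?_
  filter_upwards [Ioi_mem_nhds ht0] with r hr
  exact extend_of_nonneg u (le_of_lt hr)

/-- The dissipation is dominated by an integrable function whose integral is at most the decrease
of the norm of the positive part. -/
lemma exists_dissipation_le [hp : Fact (1 < p)] (hd : 1 ≤ d) (hs₀ : 0 < s) (hs₁ : s < 1)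
    (hm : 0 < m) {u₀₁ u₀₂ : L1 d} {u₁ u₂ : ℝ → L1 d}
    (h₁ : IsStrongDistributionalSolution s p m u₀₁ u₁)
    (h₂ : IsStrongDistributionalSolution s p m u₀₂ u₂) {t₁ t₂ : ℝ} (ht₁ : 0 < t₁)
    (ht : t₁ ≤ t₂) : ∃ g : ℝ → ℝ≥0∞, AEMeasurable g (volume.restrict (Ioc t₁ t₂)) ∧
      (∀ᵐ τ ∂volume.restrict (Ioc t₁ t₂), dissipation s p m u₁ u₂ τ ≤ g τ) ∧
      ∫⁻ τ in Ioc t₁ t₂, g τ ≤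
        ENNReal.ofReal (2 * (‖(u₁ t₁ - u₂ t₁)⁺‖ - ‖(u₁ t₂ - u₂ t₂)⁺‖)) := by
  set φ : ℝ → ℝ := fun t => ‖(extend u₁ t - extend u₂ t)⁺‖ with hφ
  have hanti : AntitoneOn φ (Ioi 0) := antitoneOn_norm_posPart hd hs₀ hs₁ hm
    h₁.toIsDistributionalSolution h₂.toIsDistributionalSolution
  have hmono : MonotoneOn (fun t => -φ t) (uIcc t₁ t₂) := by
    rw [uIcc_of_le ht]
    exact (hanti.mono fun t h => ht₁.trans_le h.1).neg
  have hval : ∀ {t}, 0 < t → φ t = ‖(u₁ t - u₂ t)⁺‖ := fun h => by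
    simp only [hφ, extend_of_nonneg _ h.le]
  have hint := hmono.intervalIntegrable_deriv
  -- Lebesgue's theorem for monotone functions bounds the integral of the derivative by the
  -- increment. A singular part of φ can only make this strict, in the favourable direction.
  have hmem := hmono.intervalIntegral_deriv_mem_uIcc
  rw [intervalIntegrable_iff, uIoc_of_le ht] at hint
  have hle : φ t₂ ≤ φ t₁ := hanti ht₁ (ht₁.trans_le ht) ht
  rw [uIcc_of_le (by linarith), intervalIntegral.integral_of_le ht] at hmem
  have hnn : ∀ᵐ τ ∂volume.restrict (Ioc t₁ t₂), 0 ≤ deriv (fun t => -φ t) τ := by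
    rw [← Measure.restrict_congr_set Ioo_ae_eq_Ioc]
    filter_upwards [ae_restrict_mem measurableSet_Ioo] with τ hτ
    rw [← derivWithin_of_mem_nhds (Icc_mem_nhds hτ.1 hτ.2), ← uIcc_of_le ht]
    exact hmono.derivWithin_nonneg
  -- The majorant -2φ' is measurable in τ, so measurability of the dissipation in time need not be
  -- proved.
  refine ⟨fun τ => ENNReal.ofReal (2 * deriv (fun t => -φ t) τ),
    (hint.1.aemeasurable.const_mul 2).ennreal_ofReal, ?_, ?_⟩
  · have hdiff := hmono.ae_differentiableWithinAt_of_mem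
    rw [uIcc_of_le ht] at hdiff
    rw [← Measure.restrict_congr_set Ioo_ae_eq_Ioc]
    filter_upwards [ae_restrict_mem measurableSet_Ioo, ae_restrict_of_ae hdiff,
      ae_restrict_of_ae (h₁.ae_hasDerivAt hm ht₁ ht),
      ae_restrict_of_ae (h₂.ae_hasDerivAt hm ht₁ ht)] with τ hτ hd' g₁ g₂
    have hτ' : τ ∈ Icc t₁ t₂ := Ioo_subset_Icc_self hτ
    obtain ⟨a₁, b₁, c₁⟩ := g₁ hτ'
    obtain ⟨a₂, b₂, c₂⟩ := g₂ hτ'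
    have hder := ((hd' hτ').differentiableAt (Icc_mem_nhds hτ.1 hτ.2)).hasDerivAt.neg
    have hder' : HasDerivAt φ (-deriv (fun t => -φ t) τ) τ := by
      have e : (-fun t => -φ t) = φ := funext fun t => neg_neg _
      rwa [e] at hder
    refine (dissipation_le_neg_deriv hd hs₀ hs₁ hm h₁.toIsDistributionalSolution
      h₂.toIsDistributionalSolution ht₁ (ht₁.trans hτ.1) a₁ a₂ b₁ b₂ c₁ c₂ hder').trans_eq ?_
    rw [neg_mul_neg]
  · rw [← ofReal_integral_eq_lintegral_ofReal (hint.const_mul 2)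
      (hnn.mono fun τ h => mul_nonneg zero_le_two h), integral_const_mul,
      ← hval ht₁, ← hval (ht₁.trans_le ht)]
    exact ENNReal.ofReal_le_ofReal (by linarith [hmem.2])

end

end DoublyNonlinear

end

/-! ### The refined dissipation inequality and strict decrease -/

theorem mainTheorem9 (d : ℕ) (hd : 1 ≤ d) (s p m : ℝ) (hs₀ : 0 < s) (hs₁ : s < 1) (hp : 1 < p)
    (hm : 0 < m) (u₀₁ u₀₂ : DoublyNonlinear.L1 d) (u₁ u₂ : ℝ → DoublyNonlinear.L1 d)
    (h₁ : DoublyNonlinear.IsStrongDistributionalSolution s p m u₀₁ u₁)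
    (h₂ : DoublyNonlinear.IsStrongDistributionalSolution s p m u₀₂ u₂)
    (t₁ t₂ : ℝ) (ht₁ : 0 < t₁) (ht : t₁ < t₂) :
    (∫⁻ τ in Ioc t₁ t₂, DoublyNonlinear.dissipation s p m u₁ u₂ τ) < ⊤ ∧
    ‖(u₁ t₂ - u₂ t₂)⁺‖ ≤ ‖(u₁ t₁ - u₂ t₁)⁺‖
      - 1 / 2 * (∫⁻ τ in Ioc t₁ t₂, DoublyNonlinear.dissipation s p m u₁ u₂ τ).toReal ∧
    (0 < volume {τ : ℝ | τ ∈ Ioc t₁ t₂ ∧ 0 < volume {x | u₂ τ x < u₁ τ x} ∧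
        0 < volume {x | u₁ τ x ≤ u₂ τ x}} →
      ‖(u₁ t₂ - u₂ t₂)⁺‖ < ‖(u₁ t₁ - u₂ t₁)⁺‖) := by
  have hp' : Fact (1 < p) := ⟨hp⟩
  obtain ⟨g, hgm, hIg, hg⟩ := DoublyNonlinear.exists_dissipation_le hd hs₀ hs₁ hm h₁ h₂ ht₁ ht.le
  have hI := (lintegral_mono_ae hIg).trans hg
  have hle : ‖(u₁ t₂ - u₂ t₂)⁺‖ ≤ ‖(u₁ t₁ - u₂ t₁)⁺‖ := by
    have := DoublyNonlinear.antitoneOn_norm_posPart hd hs₀ hs₁ hm h₁.toIsDistributionalSolution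
      h₂.toIsDistributionalSolution ht₁ (ht₁.trans ht) ht.le
    simpa only [DoublyNonlinear.extend_of_nonneg _ ht₁.le,
      DoublyNonlinear.extend_of_nonneg _ (ht₁.trans ht).le] using this
  refine ⟨hI.trans_lt ENNReal.ofReal_lt_top, ?_, fun hpos => ?_⟩
  · have := ENNReal.toReal_mono ENNReal.ofReal_ne_top hI
    rw [ENNReal.toReal_ofReal (by linarith)] at this
    linarith
  · by_contra! hcon
    -- Without strict decrease the majorant g has zero integral, so g and with it the dissipation
    -- vanish at almost every time, against positivity on a set of times of positive measure.
    rw [ENNReal.ofReal_of_nonpos (by linarith), nonpos_iff_eq_zero,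
      lintegral_eq_zero_iff' hgm] at hg
    refine hpos.ne' (measure_mono_null ?_
      (ae_iff.1 ((ae_restrict_iff' measurableSet_Ioc).1 (hIg.and hg))))
    intro τ hτ h0
    obtain ⟨h1, h2⟩ := h0 hτ.1
    rw [h2] at h1
    exact (DoublyNonlinear.dissipation_pos hp hm hτ.2.1 hτ.2.2).not_ge h1
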